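/- Let $M\ge 2$, let $c_1,\dots,c_M\in\mathbb C$ be distinct, and let $\Omega=\mathbb C\setminus\{c_1,\dots,c_M\}$. Put $d=\frac12\min_{j\ne k}|c_j-c_k|$ and $r_0=\frac1d+\max_j|c_j|$, and for $t\ge r_0$ let $\Omega_t=\{|z|<t\}\setminus\bigcup_{j=1}^M\{|z-c_j|\le 1/t\}$. Let $n\ge 1$ and let $f=(f_0:\dots:f_n):\Omega\to\mathbb P^n(\mathbb C)$ be a holomorphic curve, where $f_0,\dots,f_n$ are holomorphic on $\Omega$ without common zeros. With $\|f\|=\max_i|f_i|$, its characteristic function is $$T_f(r)=\frac1{2\pi}\int_0^{2\pi}\log\|f(re^{i\theta})\|\,d\theta+\frac1{2\pi}\sum_{j=1}^M\int_0^{2\pi}\log\|f(c_j+\tfrac1re^{i\theta})\|\,d\theta,\qquad r>r_0.$$ For a hyperplane $H=\{a_0z_0+\dots+a_nz_n=0\}$, $a=(a_0,\dots,a_n)\neq0$, with $(a,f)=\sum_i a_if_i\not\equiv0$, let $n_f^n(t,H)$ be the number of zeros of $(a,f)$ in $\overline{\Omega}_t$, where a zero of multiplicity $m$ is counted $\min(m,n)$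 times, and let $N_f^n(r,H)=\int_{r_0}^r\frac{n_f^n(t,H)}{t}\,dt$. Suppose that $f$ is linearly nondegenerate, that is, its image is not contained in any hyperplane of $\mathbb P^n(\mathbb C)$, and let $H_1,\dots,H_q$, $q>n$, be hyperplanes in $\mathbb P^n(\mathbb C)$ in general position, that is, any $n+1$ of them with distinct indices have empty intersection. Then there are a constant $C\ge 0$ and a measurable set $E\subset\mathbb R$ of finite Lebesgue measure such that, for all $r>r_0$ with $r\notin E$, one has $T_f(r)>0$ and $$(q-n-1)\,T_f(r)\le\sum_{l=1}^q N_f^n(r,H_l)+C\,\bigl(\log r+\log T_f(r)\bigr).$$ -/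

import Mathlib

open scoped LinearAlgebra.Projectivization

namespace PuncturedPlane

noncomputable section

/-- The punctured plane `Ω = ℂ \ {c₁, …, c_M}`. -/
def Omega {M : ℕ} (c : Fin M → ℂ) : Set ℂ := (Set.range c)ᶜ

/-- `d`, half of the minimal distance between two of the punctures. -/
def halfMinDist {M : ℕ} (c : Fin M → ℂ) : ℝ :=
  (1 / 2) * ⨅ p : {p : Fin M × Fin M // p.1 ≠ p.2}, ‖c p.1.1 - c p.1.2‖

/-- `r₀ = 1 / d + max |c_j|`. -/
def r0 {M : ℕ} (c : Fin M → ℂ) : ℝ := 1 / halfMinDist c + ⨆ j, ‖c j‖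

/-- `Ω_t = D_t(0) \ ⋃ⱼ closure D_{1/t}(c_j)`. -/
def OmegaAt {M : ℕ} (c : Fin M → ℂ) (t : ℝ) : Set ℂ :=
  Metric.ball 0 t \ ⋃ j, Metric.closedBall (c j) (1 / t)

/-- A holomorphic curve `(f₀ : … : f_n) : Ω → ℙⁿ(ℂ)` given by a reduced representation: the `f_i`
are holomorphic on `Ω` and have no common zero there. (Values of `toFun` off `Ω` are irrelevant.) -/
structure HolomorphicCurve {M : ℕ} (c : Fin M → ℂ) (n : ℕ) where
  /-- The reduced representation `z ↦ (f₀ z, …, f_n z)`. -/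
  toFun : ℂ → Fin (n + 1) → ℂ
  holomorphic : ∀ i, DifferentiableOn ℂ (fun z => toFun z i) (Omega c)
  no_common_zero : ∀ z ∈ Omega c, toFun z ≠ 0

/-- The support in `ℙⁿ(ℂ)` of the hyperplane `a₀ z₀ + … + a_n z_n = 0`. -/
def hyperplane {n : ℕ} (a : Fin (n + 1) → ℂ) : Set (ℙ ℂ (Fin (n + 1) → ℂ)) :=
  {p | a ⬝ᵥ p.rep = 0}

theorem mk_mem_hyperplane {n : ℕ} (a v : Fin (n + 1) → ℂ) (hv : v ≠ 0) :
    Projectivization.mk ℂ v hv ∈ hyperplane a ↔ a ⬝ᵥ v = 0 := by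
  obtain ⟨u, hu⟩ := Projectivization.exists_smul_eq_mk_rep ℂ v hv
  have hu0 : (u : ℂ) ≠ 0 := u.ne_zero
  rw [hyperplane, Set.mem_ofPred_eq, ← hu, Units.smul_def, dotProduct_smul, smul_eq_mul]
  simp [hu0]

/-- The hyperplanes with coefficient vectors `a₁, …, a_q` are in general position in `ℙⁿ(ℂ)`: the
supports of any `n + 1` of them with distinct indices have empty intersection. -/
def InGeneralPosition {n q : ℕ} (a : Fin q → Fin (n + 1) → ℂ) : Prop :=
  ∀ i : Fin (n + 1) → Fin q, Function.Injective i → ⋂ k, hyperplane (a (i k)) = ∅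

namespace HolomorphicCurve

variable {M : ℕ} {c : Fin M → ℂ} {n : ℕ}

/-- The underlying map `Ω → ℙⁿ(ℂ)`. -/
def toProj (f : HolomorphicCurve c n) (z : Omega c) : ℙ ℂ (Fin (n + 1) → ℂ) :=
  Projectivization.mk ℂ (f.toFun z) (f.no_common_zero z z.2)

/-- The image of the curve is not contained in any hyperplane of `ℙⁿ(ℂ)`. -/
def LinearlyNondegenerate (f : HolomorphicCurve c n) : Prop :=
  ∀ a : Fin (n + 1) → ℂ, a ≠ 0 → ¬ Set.range f.toProj ⊆ hyperplane a

/-- The characteristic function `T_f(r)`. The norm on `Fin (n + 1) → ℂ` is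
`max (|f₀|, …, |f_n|)`. -/
def T (f : HolomorphicCurve c n) (r : ℝ) : ℝ :=
  Real.circleAverage (fun z => Real.log ‖f.toFun z‖) 0 r
    + ∑ j, Real.circleAverage (fun z => Real.log ‖f.toFun z‖) (c j) (1 / r)

/-- `(a, f) = a₀ f₀ + … + a_n f_n`. -/
def pair (a : Fin (n + 1) → ℂ) (f : HolomorphicCurve c n) (z : ℂ) : ℂ := a ⬝ᵥ f.toFun z

/-- The number of zeros of `(a, f)` in the closure of `Ω_t`, where a zero of multiplicity `m` is
counted `min m δ` times. -/
def truncatedCount (f : HolomorphicCurve c n) (δ : ℕ) (a : Fin (n + 1) → ℂ) (t : ℝ) : ℕ :=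
  ∑ᶠ z ∈ closure (OmegaAt c t), min (analyticOrderNatAt (pair a f) z) δ

/-- The truncated counting function
`N_f^δ(r, H) = ∫_{r₀}^r n_f^δ(t, H) / t dt`, `H` the hyperplane with coefficient vector `a`. -/
def N (f : HolomorphicCurve c n) (δ : ℕ) (r : ℝ) (a : Fin (n + 1) → ℂ) : ℝ :=
  ∫ t in (r0 c)..r, (f.truncatedCount δ a t : ℝ) / t

end HolomorphicCurve

end

end PuncturedPlane

section

open scoped LinearAlgebra.Projectivization
open MeasureTheory Set Filter Topology Complex
open scoped ENNReal ComplexConjugate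

namespace PuncturedPlane

/-! This is Cartan's Wronskian argument, carried out on the `M + 1` ends of `Ω`: the neighbourhoods
of `∞` and of the punctures. Write `F_l = (a_l, f)` and let `W` be the Wronskian of `f_0, …, f_n`.
Linear nondegeneracy makes `W` not identically zero (`exists_wronskian_ne_zero`). At a given point,
general position makes all but `n + 1` of the `|F_l|` at least a fixed multiple of `‖f‖`. The
Wronskian of the remaining `n + 1` functions is a nonzero constant times `W`; it is also their
product times a determinant with entries `(F_l / F_m)^(k) / (F_l / F_m)`. Taking logarithms bounds
`(q - n - 1) log ‖f‖` by `∑ log |F_l| - log |W|` plus a multiple of the `log⁺` of these entries plus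
a constant (`exists_mul_log_norm_le`).

Now average over all boundary circles (`endSum`). The left side becomes `(q - n - 1) T_f`. Jensen's
formula (`endSum_log_norm_sub_endSum`) turns `∑ log |F_l| - log |W|` into a weighted sum of
vanishing orders, up to a constant. Since `W` vanishes to order at least `∑ (ord F_l - n)⁺`, what
survives is the counting truncated at `n` (`sum_analyticOrderNatAt_le`). Jensen's formula for this
multiply connected region rests on Cauchy's theorem for a disc with round holes
(`circleIntegral_eq_sum_circleIntegral`).

There remains the error term: the averages of the `log⁺` must be `O(log r + log T_f)` off a small
set. Each end is the image of a half-plane under a `2πi`-periodic map, so circles become vertical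
periods with abscissa `x = log r`. For periodic holomorphic `A, B` the period integral of `log (|A|²
+ |B|²)` is convex in `x`, and its second derivative dominates the integral of `4 |A'B - AB'|² /
(|A|² + |B|²)²`. Summing this over the rescalings `B ↦ e^{k/2} B` with weights `(1 + |k|)⁻³`
controls the second antiderivative of the density `|(A/B)'/(A/B)|² / (1 + |log |A/B||)³` linearly by
the characteristic (`exists_lintegral_logDensity_le`). A Borel growth lemma
(`exists_expNegligible_le`) removes both integrations outside a set of finite `e^x dx`-measure, that
is, of finite Lebesgue measure in `r`. Concavity of `log` then gives the lemma on the logarithmic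
derivative (`exists_integral_posLog_logDerivQuot_le`), and induction on `k` extends it to higher
derivatives.

Finally `T_f(r) ≥ log r - C` (`exists_le_T`), because some `(a, f)` with `a ≠ 0` has a zero; this
gives positivity of `T_f` and absorbs the constants. -/

/-! ### Exceptional sets and the Borel growth lemma. -/

/-- A set of parameters `x = log r` whose image under `exp` has finite Lebesgue measure. -/
def ExpNegligible (E : Set ℝ) : Prop :=
  MeasurableSet E ∧ ∫⁻ x in E, ENNReal.ofReal (Real.exp x) < ⊤

theorem ExpNegligible.union {E F : Set ℝ} (hE : ExpNegligible E) (hF : ExpNegligible F) :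
    ExpNegligible (E ∪ F) :=
  ⟨hE.1.union hF.1, (lintegral_union_le _ _ _).trans_lt (ENNReal.add_lt_top.2 ⟨hE.2, hF.2⟩)⟩

theorem ExpNegligible.empty : ExpNegligible ∅ := ⟨MeasurableSet.empty, by simp⟩

theorem ExpNegligible.biUnion {ι : Type*} (s : Finset ι) {E : ι → Set ℝ}
    (hE : ∀ i ∈ s, ExpNegligible (E i)) : ExpNegligible (⋃ i ∈ s, E i) := by
  classical
  induction s using Finset.induction_on with
  | empty => simpa using ExpNegligible.empty
  | insert i s _ ih =>
    rw [Finset.set_biUnion_insert]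
    exact (hE i (Finset.mem_insert_self i s)).union
      (ih fun j hj => hE j (Finset.mem_insert_of_mem hj))

theorem ExpNegligible.volume_image {E : Set ℝ} (hE : ExpNegligible E) :
    MeasurableSet (Real.exp '' E) ∧ volume (Real.exp '' E) < ⊤ := by
  refine ⟨hE.1.image_of_continuousOn_injOn Real.continuous_exp.continuousOn
    Real.exp_injective.injOn, ?_⟩
  have h := lintegral_image_eq_lintegral_abs_deriv_mul hE.1
    (fun x _ => (Real.hasDerivAt_exp x).hasDerivWithinAt) Real.exp_injective.injOn (fun _ => 1)
  simp only [lintegral_one, Measure.restrict_apply_univ, mul_one, abs_of_pos (Real.exp_pos _)] at h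
  rw [h]
  exact hE.2

theorem lintegral_Ioc_mono (g : ℝ → ℝ≥0∞) (a : ℝ) : Monotone fun x => ∫⁻ t in Ioc a x, g t :=
  fun _ _ h => lintegral_mono_set (Ioc_subset_Ioc_right h)

/-- `∫ g / (1 + ∫ g)²` is finite, in a discretised form. -/
theorem lintegral_div_sq_lt_top {a : ℝ} {g : ℝ → ℝ≥0∞} (hg : Measurable g)
    (hfin : ∀ x, ∫⁻ t in Ioc a x, g t < ⊤) :
    ∫⁻ x in Ioi a, g x / (1 + ∫⁻ t in Ioc a x, g t) ^ 2 < ⊤ := by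
  set G : ℝ → ℝ≥0∞ := fun x => ∫⁻ t in Ioc a x, g t with hG
  have hGm : Monotone G := lintegral_Ioc_mono g a
  set S : ℕ → Set ℝ := fun m => {x | a < x ∧ (m : ℝ≥0∞) ≤ G x ∧ G x < m + 1} with hS
  have hSm : ∀ m, MeasurableSet (S m) := fun m =>
    measurableSet_Ioi.inter ((hGm.measurable measurableSet_Ici).inter
      (hGm.measurable measurableSet_Iio))
  set ν : Measure ℝ := (volume.withDensity g).restrict (Ioi a) with hν
  have hνI : ∀ x, ν (Iic x) = G x := fun x => by
    rw [hν, Measure.restrict_apply measurableSet_Iic, inter_comm, Ioi_inter_Iic,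
      withDensity_apply _ measurableSet_Ioc]
  have : IsLocallyFiniteMeasure ν := ⟨fun x => ⟨Iic (x + 1), Iic_mem_nhds (by linarith), by
    rw [hνI]; exact hfin _⟩⟩
  have hSν : ∀ m, ν (S m) ≤ 1 := by
    intro m
    -- By inner regularity it suffices to bound compact subsets of `S m`. Such a set has a least
    -- point `p` and a greatest point `r` inside `S m`, so `ν (p, r] = G r - G p ≤ 1`, while `p`
    -- itself carries no mass.
    rw [(hSm m).measure_eq_iSup_isCompact]
    refine iSup_le fun K => iSup_le fun hKS => iSup_le fun hK => ?_
    rcases K.eq_empty_or_nonempty with rfl | hne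
    · simp
    obtain ⟨p, hp⟩ := hK.exists_isLeast hne
    obtain ⟨r, hr⟩ := hK.exists_isGreatest hne
    have hpr : p ≤ r := hp.2 hr.1
    have hsing : ν {p} = 0 := by
      have : ν ≪ volume := Measure.restrict_le_self.absolutelyContinuous.trans
        (withDensity_absolutelyContinuous _ _)
      exact this (by simp)
    have h1 : K ⊆ {p} ∪ Ioc p r := fun x hx => by
      rcases (hp.2 hx).eq_or_lt with h | h
      · exact Or.inl h.symm
      · exact Or.inr ⟨h, hr.2 hx⟩
    have h2 : ν (Ioc p r) + G p = G r := by
      rw [← hνI, ← hνI, ← Iic_union_Ioc_eq_Iic hpr, measure_union _ measurableSet_Ioc, add_comm]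
      exact Set.disjoint_left.2 fun x hx hx' => absurd hx'.1 (not_lt.2 hx)
    have h3 : ν (Ioc p r) + m ≤ 1 + m := by
      calc ν (Ioc p r) + m ≤ ν (Ioc p r) + G p := by gcongr; exact (hKS hp.1).2.1
        _ = G r := h2
        _ ≤ 1 + m := by rw [add_comm]; exact (hKS hr.1).2.2.le
    calc ν K ≤ ν ({p} ∪ Ioc p r) := measure_mono h1
      _ ≤ ν {p} + ν (Ioc p r) := measure_union_le _ _
      _ ≤ 1 := by
        rw [hsing, zero_add]
        exact (ENNReal.add_le_add_iff_right (ENNReal.natCast_ne_top m)).1 h3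
  have hcover : Ioi a ⊆ ⋃ m, S m := by
    intro x hx
    have hx' : G x ≠ ⊤ := (hfin x).ne
    obtain ⟨t, ht⟩ : ∃ t : NNReal, (t : ℝ≥0∞) = G x := ⟨_, ENNReal.coe_toNNReal hx'⟩
    refine mem_iUnion.2 ⟨⌊t⌋₊, hx, ?_, ?_⟩
    · rw [← ht]; exact_mod_cast Nat.floor_le (zero_le (a := t))
    · rw [← ht]; exact_mod_cast Nat.lt_floor_add_one t
  calc ∫⁻ x in Ioi a, g x / (1 + G x) ^ 2
      ≤ ∫⁻ x in ⋃ m, S m, g x / (1 + G x) ^ 2 := lintegral_mono_set hcover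
    _ ≤ ∑' m, ∫⁻ x in S m, g x / (1 + G x) ^ 2 := lintegral_iUnion_le _ _
    _ ≤ ∑' m : ℕ, (1 / ((m : ℝ≥0∞) + 1) ^ 2) := by
        refine ENNReal.tsum_le_tsum fun m => ?_
        calc ∫⁻ x in S m, g x / (1 + G x) ^ 2
            ≤ ∫⁻ x in S m, (1 / ((m : ℝ≥0∞) + 1) ^ 2) * g x := by
              refine setLIntegral_mono (hg.const_mul _) fun x hx => ?_
              rw [mul_comm, one_div, ← div_eq_mul_inv, add_comm (m : ℝ≥0∞)]
              gcongr
              exact hx.2.1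
          _ = (1 / ((m : ℝ≥0∞) + 1) ^ 2) * ν (S m) := by
              rw [lintegral_const_mul _ hg, hν, Measure.restrict_apply (hSm m),
                inter_eq_left.2 (fun x hx => hx.1), withDensity_apply _ (hSm m)]
          _ ≤ 1 / ((m : ℝ≥0∞) + 1) ^ 2 := mul_le_of_le_one_right' (hSν m)
    _ < ⊤ := by
        have h := (summable_nat_add_iff 1).2 (Real.summable_one_div_nat_pow.2 (one_lt_two))
        have h2 := h.tsum_ofReal_lt_top
        refine lt_of_eq_of_lt (tsum_congr fun m => ?_) h2
        rw [ENNReal.ofReal_div_of_pos (by positivity), ENNReal.ofReal_pow (by positivity)]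
        simp only [ENNReal.ofReal_one, ENNReal.ofReal_natCast]
        push_cast
        rfl

/-- Chebyshev's inequality: on this set `e^x` is at most `g / (1 + ∫ g)²`, which has finite
integral. -/
theorem expNegligible_lt {a : ℝ} {g : ℝ → ℝ≥0∞} (hg : Measurable g)
    (hfin : ∀ x, ∫⁻ t in Ioc a x, g t < ⊤) :
    ExpNegligible {x | a < x ∧ ENNReal.ofReal (Real.exp x) * (1 + ∫⁻ t in Ioc a x, g t) ^ 2 < g x}
    := by
  have hGm := (lintegral_Ioc_mono g a).measurable
  have hm : MeasurableSet {x | a < x ∧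
      ENNReal.ofReal (Real.exp x) * (1 + ∫⁻ t in Ioc a x, g t) ^ 2 < g x} :=
    measurableSet_Ioi.inter (measurableSet_lt
      ((Real.measurable_exp.ennreal_ofReal).mul ((hGm.const_add _).pow_const 2)) hg)
  refine ⟨hm, lt_of_le_of_lt ?_ (lintegral_div_sq_lt_top hg hfin)⟩
  calc _ ≤ ∫⁻ x in {x | a < x ∧
      ENNReal.ofReal (Real.exp x) * (1 + ∫⁻ t in Ioc a x, g t) ^ 2 < g x},
        g x / (1 + ∫⁻ t in Ioc a x, g t) ^ 2 := by
        refine setLIntegral_mono' hm fun x hx => ?_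
        rw [ENNReal.le_div_iff_mul_le]
        · exact hx.2.le
        · left; simp
        · left; simpa using (hfin x).ne
    _ ≤ _ := lintegral_mono_set fun x hx => hx.1

/-- Borel-type growth lemma for a second antiderivative. -/
theorem exists_expNegligible_le {a : ℝ} {D : ℝ → ℝ≥0∞} (hD : Measurable D)
    (hfin : ∀ x, ∫⁻ t in Ioc a x, ENNReal.ofReal (x - t) * D t < ⊤) :
    ∃ E, ExpNegligible E ∧ ∀ x, a < x → x ∉ E →
      D x ≤ ENNReal.ofReal (Real.exp x) * (1 + ENNReal.ofReal (Real.exp x) *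
        (1 + ∫⁻ t in Ioc a x, ENNReal.ofReal (x - t) * D t) ^ 2) ^ 2 := by
  set V : ℝ → ℝ≥0∞ := fun x => ∫⁻ t in Ioc a x, D t with hV
  have hVm : Measurable V := (lintegral_Ioc_mono D a).measurable
  have hVfin : ∀ x, V x < ⊤ := by
    intro x
    -- Moving the endpoint to `x + 1` makes the kernel `x + 1 - t` at least `1` on `(a, x]`.
    refine lt_of_le_of_lt ?_ (hfin (x + 1))
    calc V x ≤ ∫⁻ t in Ioc a x, ENNReal.ofReal (x + 1 - t) * D t := by
          refine setLIntegral_mono' measurableSet_Ioc fun t ht => ?_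
          refine le_mul_of_one_le_left' ?_
          rw [ENNReal.one_le_ofReal]
          linarith [ht.2]
      _ ≤ _ := lintegral_mono_set (Ioc_subset_Ioc_right (by linarith))
  -- By Tonelli the iterated antiderivative of `D` is the integral against `x - t`. The growth
  -- estimate is then used twice, for `D` against `V` and for `V` against its antiderivative.
  have hJ : ∀ x, ∫⁻ s in Ioc a x, V s = ∫⁻ t in Ioc a x, ENNReal.ofReal (x - t) * D t := by
    intro x
    have h1 : ∀ s ∈ Ioc a x, V s = ∫⁻ t in Ioc a x, (Iic s).indicator D t := by
      intro s hs
      rw [lintegral_indicator measurableSet_Iic, Measure.restrict_restrict measurableSet_Iic,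
        inter_comm, Ioc_inter_Iic, min_eq_right hs.2]
    rw [setLIntegral_congr_fun measurableSet_Ioc h1, lintegral_lintegral_swap]
    · refine setLIntegral_congr_fun measurableSet_Ioc fun t ht => ?_
      have h2 : ∀ s, (Iic s).indicator D t = (Ici t).indicator (fun _ => D t) s := by
        intro s
        by_cases h : t ≤ s <;> simp [indicator, h]
      simp only [h2]
      rw [lintegral_indicator measurableSet_Ici, lintegral_const, Measure.restrict_restrict
        measurableSet_Ici, Measure.restrict_apply MeasurableSet.univ, univ_inter, mul_comm]
      congr 1
      have : Ici t ∩ Ioc a x = Icc t x := by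
        ext s
        simp only [mem_inter_iff, mem_Ici, mem_Ioc, mem_Icc]
        exact ⟨fun h => ⟨h.1, h.2.2⟩, fun h => ⟨h.1, ht.1.trans_le h.1, h.2⟩⟩
      rw [this, Real.volume_Icc]
    · refine Measurable.aemeasurable ?_
      have : (Function.uncurry fun s t => (Iic s).indicator D t)
          = {p : ℝ × ℝ | p.2 ≤ p.1}.indicator (fun p => D p.2) := by
        ext ⟨s, t⟩
        simp [Function.uncurry, indicator]
      rw [this]
      exact (hD.comp measurable_snd).indicator (measurableSet_le measurable_snd measurable_fst)
  refine ⟨_, (expNegligible_lt hD hVfin).union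
    (expNegligible_lt hVm (a := a) fun x => by rw [hJ]; exact hfin x), fun x hx hxE => ?_⟩
  simp only [mem_union, not_or, mem_ofPred_eq, not_and, not_lt] at hxE
  refine (hxE.1 hx).trans ?_
  gcongr
  refine (hxE.2 hx).trans ?_
  rw [hJ]

/-! ### Calculus for parameter integrals and a convexity estimate. -/

theorem hasDerivAt_intervalIntegral_of_continuousOn {w w' : ℝ → ℝ → ℝ} {s : Set ℝ} (hs : IsOpen s)
    {x a b : ℝ} (hx : x ∈ s)
    (hw : ∀ x ∈ s, ∀ y, HasDerivAt (fun x => w x y) (w' x y) x)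
    (hwc : ∀ x ∈ s, Continuous (w x))
    (hw' : ContinuousOn (Function.uncurry w') (s ×ˢ univ)) :
    HasDerivAt (fun x => ∫ y in a..b, w x y) (∫ y in a..b, w' x y) x := by
  obtain ⟨δ, hδ, hδs⟩ := Metric.nhds_basis_closedBall.mem_iff.1 (hs.mem_nhds hx)
  have hK : IsCompact (Metric.closedBall x δ ×ˢ uIcc a b) :=
    (isCompact_closedBall x δ).prod isCompact_uIcc
  obtain ⟨C, hC⟩ := hK.exists_bound_of_continuousOn
    (hw'.mono (prod_mono hδs (subset_univ _)))
  have hcont : Continuous (w' x) := by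
    rw [← continuousOn_univ]
    exact hw'.comp (by fun_prop : ContinuousOn (fun y : ℝ => (x, y)) univ) fun y _ => ⟨hx, trivial⟩
  refine (intervalIntegral.hasDerivAt_integral_of_dominated_loc_of_deriv_le
    (s := Metric.closedBall x δ) (bound := fun _ => C) (Metric.closedBall_mem_nhds x hδ)
    ?_ ((hwc x hx).intervalIntegrable _ _) hcont.aestronglyMeasurable ?_
    intervalIntegrable_const ?_).2
  · filter_upwards [hs.mem_nhds hx] with t ht using (hwc t ht).aestronglyMeasurable
  · exact Eventually.of_forall fun y hy t ht => hC (t, y) ⟨ht, uIoc_subset_uIcc hy⟩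
  · exact Eventually.of_forall fun y _ t ht => hw t (hδs ht) y

theorem continuousOn_intervalIntegral {w : ℝ → ℝ → ℝ} {s : Set ℝ} (hs : IsOpen s) {a b : ℝ}
    (hw : ContinuousOn (Function.uncurry w) (s ×ˢ univ)) :
    ContinuousOn (fun x => ∫ y in a..b, w x y) s := by
  intro x hx
  refine ContinuousAt.continuousWithinAt ?_
  obtain ⟨δ, hδ, hδs⟩ := Metric.nhds_basis_closedBall.mem_iff.1 (hs.mem_nhds hx)
  have hK : IsCompact (Metric.closedBall x δ ×ˢ uIcc a b) :=
    (isCompact_closedBall x δ).prod isCompact_uIcc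
  obtain ⟨C, hC⟩ := hK.exists_bound_of_continuousOn
    (hw.mono (prod_mono hδs (subset_univ _)))
  have hcont : ∀ t ∈ s, Continuous (w t) := fun t ht => by
    rw [← continuousOn_univ]
    exact hw.comp (by fun_prop : ContinuousOn (fun y : ℝ => (t, y)) univ) fun y _ => ⟨ht, trivial⟩
  refine intervalIntegral.continuousAt_of_dominated_interval (bound := fun _ => C) ?_ ?_
    intervalIntegrable_const ?_
  · filter_upwards [hs.mem_nhds hx] with t ht using (hcont t ht).aestronglyMeasurable
  · filter_upwards [Metric.closedBall_mem_nhds x hδ] with t ht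
    exact Eventually.of_forall fun y hy => hC (t, y) ⟨ht, uIoc_subset_uIcc hy⟩
  · refine Eventually.of_forall fun y _ => ?_
    have h1 : ContinuousAt (Function.uncurry w) (x, y) :=
      hw.continuousAt ((hs.prod isOpen_univ).mem_nhds ⟨hx, trivial⟩)
    exact ContinuousAt.comp (f := fun t : ℝ => (t, y)) h1 (by fun_prop)

/-- Second-order Taylor estimate for a convex function, with the slope at the base point estimated
by a difference quotient. -/
theorem integral_sub_mul_le_of_hasDerivAt {m m1 m2 I : ℝ → ℝ} {x0 x1 x2 x : ℝ}
    (hm : ∀ t, x0 < t → HasDerivAt m (m1 t) t) (hm1 : ∀ t, x0 < t → HasDerivAt m1 (m2 t) t)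
    (hm2 : ContinuousOn m2 (Ioi x0)) (hI : ContinuousOn I (Ioi x0))
    (hI0 : ∀ t, x0 < t → 0 ≤ I t) (hIm : ∀ t, x0 < t → I t ≤ m2 t)
    (h01 : x0 < x1) (h12 : x1 < x2) (h2 : x2 ≤ x) :
    ∫ t in x2..x, (x - t) * I t ≤ m x - m x2 - (x - x2) * ((m x2 - m x1) / (x2 - x1)) := by
  have hmono : MonotoneOn m1 (Ioi x0) := by
    refine monotoneOn_of_deriv_nonneg (convex_Ioi x0)
      (fun t ht => (hm1 t ht).continuousAt.continuousWithinAt)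
      (fun t ht => (hm1 t (interior_subset ht)).differentiableAt.differentiableWithinAt)
      fun t ht => ?_
    rw [interior_Ioi] at ht
    rw [(hm1 t ht).deriv]
    exact (hI0 t ht).trans (hIm t ht)
  -- The slope at `x2` is bounded below by a difference quotient, so the final estimate involves
  -- only values of `m`. Such an estimate survives a limit in which derivatives are not controlled.
  obtain ⟨ξ, hξ, hξ'⟩ := exists_hasDerivAt_eq_slope m m1 h12
    (fun t ht => (hm t (h01.trans_le ht.1)).continuousAt.continuousWithinAt)
    (fun t ht => hm t (h01.trans ht.1))
  have hslope : (m x2 - m x1) / (x2 - x1) ≤ m1 x2 := by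
    rw [← hξ']
    exact hmono (h01.trans hξ.1) (h01.trans h12) hξ.2.le
  have hsub : uIcc x2 x ⊆ Ioi x0 := by
    rw [uIcc_of_le h2]
    exact fun t ht => (h01.trans h12).trans_le ht.1
  have hint2 : IntervalIntegrable m2 volume x2 x := (hm2.mono hsub).intervalIntegrable
  have hm1c : ContinuousOn m1 (uIcc x2 x) :=
    fun t ht => (hm1 t (hsub ht)).continuousAt.continuousWithinAt
  have hparts := intervalIntegral.integral_mul_deriv_eq_deriv_mul (a := x2) (b := x)
    (u := fun t => x - t) (u' := fun _ => -1) (v := m1) (v' := m2)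
    (fun t _ => by simpa using (hasDerivAt_id t).const_sub x)
    (fun t ht => hm1 t (hsub ht)) intervalIntegrable_const hint2
  have hfund : ∫ t in x2..x, m1 t = m x - m x2 :=
    intervalIntegral.integral_eq_sub_of_hasDerivAt (fun t ht => hm t (hsub ht))
      hm1c.intervalIntegrable
  simp only [neg_mul, one_mul, intervalIntegral.integral_neg, hfund, sub_self, zero_mul] at hparts
  have hle : ∫ t in x2..x, (x - t) * I t ≤ ∫ t in x2..x, (x - t) * m2 t := by
    refine intervalIntegral.integral_mono_on h2 ?_ ?_ fun t ht => ?_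
    · exact ((continuousOn_const.sub continuousOn_id).mul (hI.mono hsub)).intervalIntegrable
    · exact ((continuousOn_const.sub continuousOn_id).mul (hm2.mono hsub)).intervalIntegrable
    · have : x0 < t := (h01.trans h12).trans_le ht.1
      exact mul_le_mul_of_nonneg_left (hIm t this) (by linarith [ht.2])
  have : (x - x2) * ((m x2 - m x1) / (x2 - x1)) ≤ (x - x2) * m1 x2 :=
    mul_le_mul_of_nonneg_left hslope (by linarith)
  linarith

/-! ### Period integrals of `log (|A|² + |B|² + ε)` on a half-plane. -/

/-- The half-plane `Re ζ > a`. -/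
def halfPlane (a : ℝ) : Set ℂ := {ζ | a < ζ.re}

theorem isOpen_halfPlane (a : ℝ) : IsOpen (halfPlane a) := isOpen_lt continuous_const continuous_re

theorem isPreconnected_halfPlane (a : ℝ) : IsPreconnected (halfPlane a) :=
  (convex_halfSpace_re_gt a).isPreconnected

@[simp] theorem ofReal_add_mul_I_mem_halfPlane {a x y : ℝ} :
    (x : ℂ) + y * I ∈ halfPlane a ↔ a < x := by simp [halfPlane]

section Smooth

variable {A B : ℂ → ℂ} {a ε : ℝ}

/-- `‖A‖² + ‖B‖² + ε`. -/
noncomputable def sumSq (A B : ℂ → ℂ) (ε : ℝ) (ζ : ℂ) : ℝ := ‖A ζ‖ ^ 2 + ‖B ζ‖ ^ 2 + ε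

/-- `A' conj A + B' conj B`, the `∂`-derivative of `sumSq`. -/
noncomputable def sumSqD (A B : ℂ → ℂ) (ζ : ℂ) : ℂ :=
  deriv A ζ * conj (A ζ) + deriv B ζ * conj (B ζ)

/-- `A'' conj A + B'' conj B`. -/
noncomputable def sumSqDD (A B : ℂ → ℂ) (ζ : ℂ) : ℂ :=
  deriv (deriv A) ζ * conj (A ζ) + deriv (deriv B) ζ * conj (B ζ)

theorem sumSq_pos (hε : 0 < ε) (ζ : ℂ) : 0 < sumSq A B ε ζ := by
  unfold sumSq; positivity

theorem hasDerivAt_sumSq (hA : DifferentiableOn ℂ A (halfPlane a))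
    (hB : DifferentiableOn ℂ B (halfPlane a)) {γ : ℝ → ℂ} {t : ℝ} {d : ℂ}
    (hγ : HasDerivAt γ d t) (ht : γ t ∈ halfPlane a) :
    HasDerivAt (fun t => sumSq A B ε (γ t)) (2 * (d * sumSqD A B (γ t)).re) t := by
  have hU := (isOpen_halfPlane a).mem_nhds ht
  have h1 := ((hA.differentiableAt hU).hasDerivAt.comp_of_eq t hγ rfl).norm_sq
  have h2 := ((hB.differentiableAt hU).hasDerivAt.comp_of_eq t hγ rfl).norm_sq
  refine ((h1.add h2).add_const ε).congr_deriv ?_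
  simp only [Function.comp, Complex.inner, sumSqD, mul_re, mul_im, add_re, add_im, conj_re, conj_im]
  ring

theorem hasDerivAt_sumSqD (hA : DifferentiableOn ℂ A (halfPlane a))
    (hB : DifferentiableOn ℂ B (halfPlane a)) {γ : ℝ → ℂ} {t : ℝ} {d : ℂ}
    (hγ : HasDerivAt γ d t) (ht : γ t ∈ halfPlane a) :
    HasDerivAt (fun t => sumSqD A B (γ t)) (d * sumSqDD A B (γ t) + conj d *
      ((‖deriv A (γ t)‖ ^ 2 + ‖deriv B (γ t)‖ ^ 2 : ℝ) : ℂ)) t := by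
  have hU := (isOpen_halfPlane a).mem_nhds ht
  have h1 := (hA.differentiableAt hU).hasDerivAt.comp_of_eq t hγ rfl
  have h2 := (hB.differentiableAt hU).hasDerivAt.comp_of_eq t hγ rfl
  have h3 := ((hA.deriv (isOpen_halfPlane a)).differentiableAt hU).hasDerivAt.comp_of_eq t hγ rfl
  have h4 := ((hB.deriv (isOpen_halfPlane a)).differentiableAt hU).hasDerivAt.comp_of_eq t hγ rfl
  refine ((h3.mul h1.star).add (h4.mul h2.star)).congr_deriv ?_
  simp only [Function.comp, sumSqDD, star_def, map_mul, ofReal_add, ofReal_pow, ← mul_conj']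
  ring

theorem hasDerivAt_log_sumSq (hA : DifferentiableOn ℂ A (halfPlane a))
    (hB : DifferentiableOn ℂ B (halfPlane a)) (hε : 0 < ε) {γ : ℝ → ℂ} {t : ℝ} {d : ℂ}
    (hγ : HasDerivAt γ d t) (ht : γ t ∈ halfPlane a) :
    HasDerivAt (fun t => Real.log (sumSq A B ε (γ t)))
      (2 * (d * sumSqD A B (γ t)).re / sumSq A B ε (γ t)) t :=
  (hasDerivAt_sumSq hA hB hγ ht).log (sumSq_pos hε _).ne'

/-- The second derivative of `log (‖A‖² + ‖B‖² + ε)` in the direction `d`. -/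
noncomputable def logSumSqDD (A B : ℂ → ℂ) (ε : ℝ) (d ζ : ℂ) : ℝ :=
  (2 * (d * (d * sumSqDD A B ζ + conj d *
      ((‖deriv A ζ‖ ^ 2 + ‖deriv B ζ‖ ^ 2 : ℝ) : ℂ))).re * sumSq A B ε ζ -
    2 * (d * sumSqD A B ζ).re * (2 * (d * sumSqD A B ζ).re)) / sumSq A B ε ζ ^ 2

theorem hasDerivAt_logSumSqD (hA : DifferentiableOn ℂ A (halfPlane a))
    (hB : DifferentiableOn ℂ B (halfPlane a)) (hε : 0 < ε) {γ : ℝ → ℂ} {t : ℝ} {d : ℂ}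
    (hγ : HasDerivAt γ d t) (ht : γ t ∈ halfPlane a) :
    HasDerivAt (fun t => 2 * (d * sumSqD A B (γ t)).re / sumSq A B ε (γ t))
      (logSumSqDD A B ε d (γ t)) t := by
  have h1 := ((hasDerivAt_sumSqD hA hB hγ ht).const_mul d)
  have h2 := (reCLM.hasFDerivAt.comp_hasDerivAt t h1).const_mul 2
  exact h2.div (hasDerivAt_sumSq hA hB hγ ht) (sumSq_pos hε _).ne'

/-- A lower bound for the Laplacian of `log (‖A‖² + ‖B‖² + ε)`. -/
noncomputable def wronskianDensity (A B : ℂ → ℂ) (ε : ℝ) (ζ : ℂ) : ℝ :=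
  4 * ‖deriv A ζ * B ζ - A ζ * deriv B ζ‖ ^ 2 / sumSq A B ε ζ ^ 2

/-- The right side is the Laplacian: the terms with `A''` and `B''` cancel because `1² + I² = 0`.
Lagrange's identity then leaves `4 |A'B - AB'|² + 4 ε (|A'|² + |B'|²)` over the squared denominator,
and the `ε`-term is nonnegative. -/
theorem wronskianDensity_le (hε : 0 ≤ ε) (ζ : ℂ) :
    wronskianDensity A B ε ζ ≤ logSumSqDD A B ε 1 ζ + logSumSqDD A B ε I ζ := by
  unfold wronskianDensity logSumSqDD
  rw [← add_div]
  refine div_le_div_of_nonneg_right ?_ (by positivity)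
  have h1 : 0 ≤ ε * (‖deriv A ζ‖ ^ 2 + ‖deriv B ζ‖ ^ 2) := by positivity
  unfold sumSq sumSqDD sumSqD at *
  simp only [Complex.sq_norm, normSq_apply] at *
  simp only [mul_re, mul_im, add_re, add_im, sub_re, sub_im, conj_re, conj_im, I_re, I_im, one_re,
    one_im, ofReal_re, ofReal_im, map_one, conj_I, neg_re, neg_im]
  nlinarith [h1]

variable (hA : DifferentiableOn ℂ A (halfPlane a)) (hB : DifferentiableOn ℂ B (halfPlane a))

theorem continuousOn_comp_add_mul_I {E : Type*} [TopologicalSpace E] {f : ℂ → E}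
    (hf : ContinuousOn f (halfPlane a)) :
    ContinuousOn (Function.uncurry fun x y : ℝ => f (x + y * I)) (Ioi a ×ˢ univ) :=
  hf.comp (by fun_prop) fun p hp => ofReal_add_mul_I_mem_halfPlane.2 hp.1

theorem continuous_comp_add_mul_I {E : Type*} [TopologicalSpace E] {f : ℂ → E}
    (hf : ContinuousOn f (halfPlane a)) {x : ℝ} (hx : a < x) :
    Continuous fun y : ℝ => f (x + y * I) := by
  rw [← continuousOn_univ]
  exact hf.comp (by fun_prop) fun p _ => ofReal_add_mul_I_mem_halfPlane.2 hx

include hA hB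

theorem continuousOn_sumSq : ContinuousOn (sumSq A B ε) (halfPlane a) :=
  ((hA.continuousOn.norm.pow 2).add (hB.continuousOn.norm.pow 2)).add continuousOn_const

theorem continuousOn_sumSqD : ContinuousOn (sumSqD A B) (halfPlane a) :=
  ((hA.deriv (isOpen_halfPlane a)).continuousOn.mul
    (continuous_conj.comp_continuousOn hA.continuousOn)).add
  ((hB.deriv (isOpen_halfPlane a)).continuousOn.mul
    (continuous_conj.comp_continuousOn hB.continuousOn))

theorem continuousOn_logSumSqDD (hε : 0 < ε) (d : ℂ) :
    ContinuousOn (logSumSqDD A B ε d) (halfPlane a) := by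
  have h1 : ContinuousOn (sumSqDD A B) (halfPlane a) :=
    (((hA.deriv (isOpen_halfPlane a)).deriv (isOpen_halfPlane a)).continuousOn.mul
      (continuous_conj.comp_continuousOn hA.continuousOn)).add
    (((hB.deriv (isOpen_halfPlane a)).deriv (isOpen_halfPlane a)).continuousOn.mul
      (continuous_conj.comp_continuousOn hB.continuousOn))
  have h2 := continuousOn_sumSqD hA hB
  have h3 := continuousOn_sumSq (ε := ε) hA hB
  have h4 := (hA.deriv (isOpen_halfPlane a)).continuousOn
  have h5 := (hB.deriv (isOpen_halfPlane a)).continuousOn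
  unfold logSumSqDD
  refine ContinuousOn.div ?_ (h3.pow 2) fun ζ _ => pow_ne_zero _ (sumSq_pos hε _).ne'
  refine ContinuousOn.sub (ContinuousOn.mul (continuousOn_const.mul (continuous_re.comp_continuousOn
    (continuousOn_const.mul ((continuousOn_const.mul h1).add (continuousOn_const.mul
      (continuous_ofReal.comp_continuousOn ((h4.norm.pow 2).add (h5.norm.pow 2)))))))) h3) ?_
  exact (continuousOn_const.mul (continuous_re.comp_continuousOn (continuousOn_const.mul h2))).mul
    (continuousOn_const.mul (continuous_re.comp_continuousOn (continuousOn_const.mul h2)))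

theorem continuousOn_wronskianDensity (hε : 0 < ε) :
    ContinuousOn (wronskianDensity A B ε) (halfPlane a) := by
  have h3 := continuousOn_sumSq (ε := ε) hA hB
  have h4 := (hA.deriv (isOpen_halfPlane a)).continuousOn
  have h5 := (hB.deriv (isOpen_halfPlane a)).continuousOn
  exact (continuousOn_const.mul (((h4.mul hB.continuousOn).sub
    (hA.continuousOn.mul h5)).norm.pow 2)).div (h3.pow 2)
    fun ζ _ => pow_ne_zero _ (sumSq_pos hε _).ne'

/-- Periodicity kills the integral of the second `y`-derivative, so the second `x`-derivative of the
period integral is the integral of the whole Laplacian. The convexity estimate applies with the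
Wronskian density as a minorant. -/
theorem integral_wronskianDensity_le (hε : 0 < ε)
    (hAp : Function.Periodic A (2 * Real.pi * I)) (hBp : Function.Periodic B (2 * Real.pi * I))
    {x1 x2 x : ℝ} (h01 : a < x1) (h12 : x1 < x2) (h2 : x2 ≤ x) :
    ∫ t in x2..x, (x - t) * ∫ y in (0 : ℝ)..2 * Real.pi, wronskianDensity A B ε (t + y * I) ≤
      (∫ y in (0 : ℝ)..2 * Real.pi, Real.log (sumSq A B ε (x + y * I)))
      - (∫ y in (0 : ℝ)..2 * Real.pi, Real.log (sumSq A B ε (x2 + y * I)))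
      - (x - x2) * (((∫ y in (0 : ℝ)..2 * Real.pi, Real.log (sumSq A B ε (x2 + y * I)))
        - (∫ y in (0 : ℝ)..2 * Real.pi, Real.log (sumSq A B ε (x1 + y * I)))) / (x2 - x1)) := by
  have hlogc : ContinuousOn (fun ζ => Real.log (sumSq A B ε ζ)) (halfPlane a) :=
    (continuousOn_sumSq hA hB).log fun ζ _ => (sumSq_pos hε _).ne'
  have hDc : ∀ d : ℂ, ContinuousOn (fun ζ => 2 * (d * sumSqD A B ζ).re / sumSq A B ε ζ)
      (halfPlane a) := fun d =>
    (continuousOn_const.mul (continuous_re.comp_continuousOn (continuousOn_const.mul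
      (continuousOn_sumSqD hA hB)))).div (continuousOn_sumSq hA hB) fun ζ _ => (sumSq_pos hε _).ne'
  have hγ1 : ∀ x y : ℝ, HasDerivAt (fun x : ℝ => (x : ℂ) + y * I) 1 x := fun x y =>
    (ofRealCLM.hasDerivAt.add_const _)
  have hγ2 : ∀ x y : ℝ, HasDerivAt (fun y : ℝ => (x : ℂ) + y * I) I y := fun x y => by
    simpa using ((ofRealCLM.hasDerivAt (x := y)).mul_const I).const_add (x : ℂ)
  refine integral_sub_mul_le_of_hasDerivAt (x0 := a)
    (m := fun x => ∫ y in (0 : ℝ)..2 * Real.pi, Real.log (sumSq A B ε (x + y * I)))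
    (m1 := fun x => ∫ y in (0 : ℝ)..2 * Real.pi,
      2 * (1 * sumSqD A B (x + y * I)).re / sumSq A B ε (x + y * I))
    (m2 := fun x => ∫ y in (0 : ℝ)..2 * Real.pi, logSumSqDD A B ε 1 (x + y * I))
    (fun t ht => ?_) (fun t ht => ?_) ?_ ?_ (fun t ht => ?_) (fun t ht => ?_) h01 h12 h2
  · exact hasDerivAt_intervalIntegral_of_continuousOn isOpen_Ioi ht
      (fun x hx y => hasDerivAt_log_sumSq hA hB hε (hγ1 x y) (ofReal_add_mul_I_mem_halfPlane.2 hx))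
      (fun x hx => continuous_comp_add_mul_I hlogc hx) (continuousOn_comp_add_mul_I (hDc 1))
  · exact hasDerivAt_intervalIntegral_of_continuousOn isOpen_Ioi ht
      (fun x hx y => hasDerivAt_logSumSqD hA hB hε (hγ1 x y) (ofReal_add_mul_I_mem_halfPlane.2 hx))
      (fun x hx => continuous_comp_add_mul_I (hDc 1) hx)
      (continuousOn_comp_add_mul_I (continuousOn_logSumSqDD hA hB hε 1))
  · exact continuousOn_intervalIntegral isOpen_Ioi
      (continuousOn_comp_add_mul_I (continuousOn_logSumSqDD hA hB hε 1))
  · exact continuousOn_intervalIntegral isOpen_Ioi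
      (continuousOn_comp_add_mul_I (continuousOn_wronskianDensity hA hB hε))
  · refine intervalIntegral.integral_nonneg (by positivity) fun y _ => ?_
    unfold wronskianDensity
    positivity
  · have hc := fun d => continuous_comp_add_mul_I (continuousOn_logSumSqDD hA hB hε d) ht
    -- The integrand is the derivative in `y` of a function built from `A`, `B`, `A'`, `B'`, all of
    -- period `2πi`; hence the endpoint values agree.
    have hIzero : ∫ y in (0 : ℝ)..2 * Real.pi, logSumSqDD A B ε I (t + y * I) = 0 := by
      rw [intervalIntegral.integral_eq_sub_of_hasDerivAt (fun y _ => hasDerivAt_logSumSqD hA hB hε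
        (hγ2 t y) (ofReal_add_mul_I_mem_halfPlane.2 ht)) ((hc I).intervalIntegrable _ _)]
      have hAd : Function.Periodic (deriv A) (2 * Real.pi * I) := fun ζ => by
        rw [← deriv_comp_add_const]
        congr 1
        exact funext hAp
      have hBd : Function.Periodic (deriv B) (2 * Real.pi * I) := fun ζ => by
        rw [← deriv_comp_add_const]
        congr 1
        exact funext hBp
      have h0 : (t : ℂ) + ((2 * Real.pi : ℝ) : ℂ) * I = t + ((0 : ℝ) : ℂ) * I + 2 * Real.pi * I := by
        push_cast; ring
      rw [h0]
      simp only [sumSqD, sumSq, hAp _, hBp _, hAd _, hBd _, sub_self]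
    calc ∫ y in (0 : ℝ)..2 * Real.pi, wronskianDensity A B ε (t + y * I)
        ≤ ∫ y in (0 : ℝ)..2 * Real.pi, (logSumSqDD A B ε 1 (t + y * I)
          + logSumSqDD A B ε I (t + y * I)) :=
          intervalIntegral.integral_mono_on (by positivity)
            ((continuous_comp_add_mul_I
              (continuousOn_wronskianDensity hA hB hε) ht).intervalIntegrable _ _)
            (((hc 1).add (hc I)).intervalIntegrable _ _)
            fun y _ => wronskianDensity_le hε.le _
      _ = _ := by
          rw [intervalIntegral.integral_add ((hc 1).intervalIntegrable _ _)
            ((hc I).intervalIntegrable _ _), hIzero, add_zero]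

end Smooth

/-! ### Integrability on vertical lines and removal of the smoothing `ε`. -/

section Lines

variable {A B : ℂ → ℂ} {a : ℝ}

theorem analyticOnNhd_comp_add_mul_I (hA : DifferentiableOn ℂ A (halfPlane a)) {x : ℝ}
    (hx : a < x) : AnalyticOnNhd ℝ (fun y : ℝ => A (x + y * I)) univ := by
  intro y _
  have h1 : AnalyticAt ℝ A (x + y * I) := (hA.analyticAt ((isOpen_halfPlane a).mem_nhds
    (ofReal_add_mul_I_mem_halfPlane.2 hx))).restrictScalars
  have h2 : AnalyticAt ℝ (fun y : ℝ => (x : ℂ) + y * I) y :=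
    analyticAt_const.add ((ofRealCLM.analyticAt y).mul analyticAt_const)
  exact AnalyticAt.fun_comp (f := fun y : ℝ => (x : ℂ) + y * I) h1 h2

/-- The identity theorem forbids vanishing on a whole vertical line. On the line the function is
real-analytic, so the complement of its zero set is codiscrete, hence of full measure. -/
theorem ae_ne_zero_of_exists_ne_zero (hA : DifferentiableOn ℂ A (halfPlane a))
    (hA0 : ∃ ζ ∈ halfPlane a, A ζ ≠ 0) {x : ℝ} (hx : a < x) :
    ∀ᵐ y : ℝ, A (x + y * I) ≠ 0 := by
  have hne : ∃ y : ℝ, A (x + y * I) ≠ 0 := by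
    by_contra! h
    obtain ⟨ζ, hζ, hζ0⟩ := hA0
    refine hζ0 (AnalyticOnNhd.eqOn_zero_of_preconnected_of_frequently_eq_zero
      (hA.analyticOnNhd (isOpen_halfPlane a)) (isPreconnected_halfPlane a) (z₀ := (x : ℂ))
      (by simpa [halfPlane] using hx) ?_ hζ)
    have hlim : Tendsto (fun n : ℕ => (x : ℂ) + ((1 / ((n : ℝ) + 1) : ℝ) : ℂ) * I) atTop
        (𝓝[≠] (x : ℂ)) := by
      refine tendsto_nhdsWithin_iff.2 ⟨?_, Eventually.of_forall fun n => ?_⟩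
      · have := ((continuous_ofReal.tendsto 0).comp
          tendsto_one_div_add_atTop_nhds_zero_nat).mul_const I
        simpa using this.const_add (x : ℂ)
      · simp only [mem_compl_iff, mem_singleton_iff, add_eq_left, mul_eq_zero, I_ne_zero, or_false,
          ofReal_eq_zero]
        positivity
    exact hlim.frequently (Frequently.of_forall fun n => h _)
  obtain ⟨y, hy⟩ := hne
  have h := (analyticOnNhd_comp_add_mul_I hA hx).preimage_zero_mem_codiscrete hy
  have h2 := ae_restrict_le_codiscreteWithin (μ := volume) (U := (univ : Set ℝ))
    MeasurableSet.univ h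
  rw [Measure.restrict_univ] at h2
  exact h2

theorem intervalIntegrable_log_norm_line (hA : DifferentiableOn ℂ A (halfPlane a)) {x : ℝ}
    (hx : a < x) (p r : ℝ) :
    IntervalIntegrable (fun y : ℝ => Real.log ‖A (x + y * I)‖) volume p r :=
  MeromorphicOn.intervalIntegrable_log_norm fun y _ =>
    (analyticOnNhd_comp_add_mul_I hA hx y trivial).meromorphicAt

theorem measurable_log_sumSq (hA : DifferentiableOn ℂ A (halfPlane a))
    (hB : DifferentiableOn ℂ B (halfPlane a)) (ε : ℝ) {x : ℝ} (hx : a < x) :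
    Measurable fun y : ℝ => Real.log (sumSq A B ε (x + y * I)) :=
  Real.measurable_log.comp (continuous_comp_add_mul_I (continuousOn_sumSq hA hB) hx).measurable

theorem two_mul_log_norm_le_log_sumSq {ε : ℝ} (hε : 0 ≤ ε) {ζ : ℂ} (h : A ζ ≠ 0) :
    2 * Real.log ‖A ζ‖ ≤ Real.log (sumSq A B ε ζ) := by
  have h1 : 0 < ‖A ζ‖ := norm_pos_iff.2 h
  have h2 : Real.log (‖A ζ‖ ^ 2) = 2 * Real.log ‖A ζ‖ := by rw [Real.log_pow]; norm_num
  rw [← h2]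
  refine Real.log_le_log (by positivity) ?_
  unfold sumSq
  nlinarith [sq_nonneg ‖B ζ‖]

/-- A bound uniform in `ε ∈ [0, 1]` which is integrable on vertical lines even when `A` has zeros
there. It is the dominating function for `ε → 0`. -/
theorem abs_log_sumSq_le {ε : ℝ} (hε : 0 ≤ ε) (hε1 : ε ≤ 1) {ζ : ℂ} (h : A ζ ≠ 0) :
    |Real.log (sumSq A B ε ζ)| ≤ 2 * |Real.log ‖A ζ‖| + |Real.log (sumSq A B 1 ζ)| := by
  have h1 := two_mul_log_norm_le_log_sumSq (B := B) hε h
  have h0 : 0 < sumSq A B ε ζ := by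
    have : 0 < ‖A ζ‖ := norm_pos_iff.2 h
    unfold sumSq; positivity
  have h2 : Real.log (sumSq A B ε ζ) ≤ Real.log (sumSq A B 1 ζ) :=
    Real.log_le_log h0 (by unfold sumSq; linarith)
  have h3 := neg_abs_le (Real.log ‖A ζ‖)
  have h4 := le_abs_self (Real.log (sumSq A B 1 ζ))
  have h5 := abs_nonneg (Real.log ‖A ζ‖)
  have h6 := abs_nonneg (Real.log (sumSq A B 1 ζ))
  rw [abs_le]
  constructor <;> linarith

variable (hA : DifferentiableOn ℂ A (halfPlane a)) (hB : DifferentiableOn ℂ B (halfPlane a))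
  (hA0 : ∃ ζ ∈ halfPlane a, A ζ ≠ 0)

include hA hB hA0

theorem intervalIntegrable_log_sumSq {ε : ℝ} (hε : 0 ≤ ε) (hε1 : ε ≤ 1) {x : ℝ} (hx : a < x)
    (p r : ℝ) :
    IntervalIntegrable (fun y : ℝ => Real.log (sumSq A B ε (x + y * I))) volume p r := by
  have h1 : IntervalIntegrable (fun y : ℝ => 2 * |Real.log ‖A (x + y * I)‖| +
      |Real.log (sumSq A B 1 (x + y * I))|) volume p r := by
    refine ((intervalIntegrable_log_norm_line hA hx p r).abs.const_mul 2).add ?_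
    exact (continuous_comp_add_mul_I ((continuousOn_sumSq hA hB).log
      fun ζ _ => (sumSq_pos one_pos ζ).ne') hx).abs.intervalIntegrable _ _
  refine h1.mono_fun (measurable_log_sumSq hA hB ε hx).aestronglyMeasurable ?_
  filter_upwards [ae_restrict_of_ae (ae_ne_zero_of_exists_ne_zero hA hA0 hx)] with y hy
  rw [Real.norm_eq_abs, Real.norm_eq_abs]
  exact (abs_log_sumSq_le hε hε1 hy).trans (le_abs_self _)

theorem tendsto_integral_log_sumSq {x : ℝ} (hx : a < x) (p r : ℝ) :
    Tendsto (fun n : ℕ => ∫ y in p..r, Real.log (sumSq A B (1 / ((n : ℝ) + 1)) (x + y * I))) atTop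
      (𝓝 (∫ y in p..r, Real.log (sumSq A B 0 (x + y * I)))) := by
  refine intervalIntegral.tendsto_integral_filter_of_dominated_convergence
    (fun y : ℝ => 2 * |Real.log ‖A (x + y * I)‖| + |Real.log (sumSq A B 1 (x + y * I))|)
    (Eventually.of_forall fun n => (measurable_log_sumSq hA hB _ hx).aestronglyMeasurable)
    (Eventually.of_forall fun n => ?_) ?_ ?_
  · filter_upwards [ae_ne_zero_of_exists_ne_zero hA hA0 hx] with y hy _
    refine abs_log_sumSq_le (by positivity) ?_ hy
    rw [div_le_one (by positivity)]
    linarith [n.cast_nonneg (α := ℝ)]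
  · refine ((intervalIntegrable_log_norm_line hA hx p r).abs.const_mul 2).add ?_
    exact (continuous_comp_add_mul_I ((continuousOn_sumSq hA hB).log
      fun ζ _ => (sumSq_pos one_pos ζ).ne') hx).abs.intervalIntegrable _ _
  · filter_upwards [ae_ne_zero_of_exists_ne_zero hA hA0 hx] with y hy _
    refine Tendsto.log ?_ ?_
    · exact tendsto_const_nhds.add tendsto_one_div_add_atTop_nhds_zero_nat
    · have : 0 < ‖A (x + y * I)‖ := norm_pos_iff.2 hy
      unfold sumSq; positivity

/-- At `ε = 0` common zeros of `A` and `B` destroy smoothness, so the estimate is obtained as a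
limit along `ε = 1 / (n + 1)`: Fatou's lemma on the left, dominated convergence of the period
integrals on the right. -/
theorem lintegral_wronskianDensity_le (hAm : Measurable A) (hBm : Measurable B)
    (hAp : Function.Periodic A (2 * Real.pi * I)) (hBp : Function.Periodic B (2 * Real.pi * I))
    {x1 x2 x : ℝ} (h01 : a < x1) (h12 : x1 < x2) (h2 : x2 ≤ x) :
    ∫⁻ t in Ioc x2 x, ∫⁻ y in Ioc 0 (2 * Real.pi),
        ENNReal.ofReal ((x - t) * wronskianDensity A B 0 (t + y * I)) ≤
      ENNReal.ofReal ((∫ y in (0 : ℝ)..2 * Real.pi, Real.log (sumSq A B 0 (x + y * I)))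
      - (∫ y in (0 : ℝ)..2 * Real.pi, Real.log (sumSq A B 0 (x2 + y * I)))
      - (x - x2) * (((∫ y in (0 : ℝ)..2 * Real.pi, Real.log (sumSq A B 0 (x2 + y * I)))
        - (∫ y in (0 : ℝ)..2 * Real.pi, Real.log (sumSq A B 0 (x1 + y * I)))) / (x2 - x1))) := by
  set e : ℕ → ℝ := fun n => 1 / ((n : ℝ) + 1) with he
  have he0 : ∀ n, 0 < e n := fun n => by positivity
  have hwm : ∀ ε, Measurable (wronskianDensity A B ε) := fun ε => by
    have h1 := measurable_deriv A
    have h2 := measurable_deriv B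
    unfold wronskianDensity sumSq
    fun_prop
  set F : ℝ → ℝ → ℝ → ℝ≥0∞ := fun ε t y =>
    ENNReal.ofReal ((x - t) * wronskianDensity A B ε (t + y * I)) with hF
  have hFm : ∀ ε, Measurable (Function.uncurry (F ε)) := fun ε => by
    refine Measurable.ennreal_ofReal (Measurable.mul (by fun_prop) ((hwm ε).comp (by fun_prop)))
  have hpt : ∀ t y, F 0 t y ≤ liminf (fun n => F (e n) t y) atTop := by
    intro t y
    by_cases h0 : sumSq A B 0 (t + y * I) = 0
    -- At a common zero of `A` and `B` the quotient has denominator `0` and takes the default value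
    -- `0`, so the inequality is trivial.
    · have : F 0 t y = 0 := by simp [hF, wronskianDensity, h0]
      rw [this]; exact zero_le
    · refine (Tendsto.liminf_eq ?_).ge
      refine (ENNReal.continuous_ofReal.tendsto _).comp (Tendsto.const_mul _ ?_)
      refine Tendsto.div tendsto_const_nhds (Tendsto.pow ?_ 2) (pow_ne_zero _ h0)
      exact tendsto_const_nhds.add tendsto_one_div_add_atTop_nhds_zero_nat
  have hReal : ∀ n, ∫⁻ t in Ioc x2 x, ∫⁻ y in Ioc 0 (2 * Real.pi), F (e n) t y =
      ENNReal.ofReal (∫ t in x2..x, (x - t) * ∫ y in (0 : ℝ)..2 * Real.pi,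
        wronskianDensity A B (e n) (t + y * I)) := by
    intro n
    have hc := continuousOn_wronskianDensity hA hB (he0 n)
    have hnn : ∀ ζ, 0 ≤ wronskianDensity A B (e n) ζ := fun ζ => by
      unfold wronskianDensity; positivity
    have hsub : Icc x2 x ⊆ Ioi a := fun t ht => (h01.trans h12).trans_le ht.1
    rw [intervalIntegral.integral_of_le h2, ofReal_integral_eq_lintegral_ofReal]
    · refine setLIntegral_congr_fun measurableSet_Ioc fun t ht => ?_
      have hat : a < t := (h01.trans h12).trans ht.1
      have hxt : 0 ≤ x - t := by linarith [ht.2]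
      rw [← intervalIntegral.integral_const_mul,
        intervalIntegral.integral_of_le (by positivity), ofReal_integral_eq_lintegral_ofReal]
      · exact ((continuous_comp_add_mul_I hc hat).const_mul (x - t)).integrableOn_Ioc
      · exact Eventually.of_forall fun y => mul_nonneg hxt (hnn _)
    · have hcont : ContinuousOn (fun t : ℝ => (x - t) * ∫ y in (0 : ℝ)..2 * Real.pi,
          wronskianDensity A B (e n) (t + y * I)) (Icc x2 x) :=
        (continuousOn_const.sub continuousOn_id).mul (ContinuousOn.mono
          (continuousOn_intervalIntegral isOpen_Ioi (continuousOn_comp_add_mul_I hc)) hsub)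
      exact hcont.integrableOn_Icc.mono_set Ioc_subset_Icc_self
    · filter_upwards [ae_restrict_mem measurableSet_Ioc] with t ht
      exact mul_nonneg (by linarith [ht.2])
        (intervalIntegral.integral_nonneg (by positivity) fun y _ => hnn _)
  calc ∫⁻ t in Ioc x2 x, ∫⁻ y in Ioc 0 (2 * Real.pi), F 0 t y
      ≤ ∫⁻ t in Ioc x2 x, liminf (fun n => ∫⁻ y in Ioc 0 (2 * Real.pi), F (e n) t y) atTop := by
        refine lintegral_mono fun t => ?_
        refine (lintegral_mono fun y => hpt t y).trans (lintegral_liminf_le fun n => ?_)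
        exact (hFm (e n)).comp (measurable_const.prodMk measurable_id)
    _ ≤ liminf (fun n => ∫⁻ t in Ioc x2 x, ∫⁻ y in Ioc 0 (2 * Real.pi), F (e n) t y) atTop :=
        lintegral_liminf_le fun n => (hFm (e n)).lintegral_prod_right'
    _ ≤ liminf (fun n => ENNReal.ofReal
        ((∫ y in (0 : ℝ)..2 * Real.pi, Real.log (sumSq A B (e n) (x + y * I)))
      - (∫ y in (0 : ℝ)..2 * Real.pi, Real.log (sumSq A B (e n) (x2 + y * I)))
      - (x - x2) * (((∫ y in (0 : ℝ)..2 * Real.pi, Real.log (sumSq A B (e n) (x2 + y * I)))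
        - (∫ y in (0 : ℝ)..2 * Real.pi, Real.log (sumSq A B (e n) (x1 + y * I))))
          / (x2 - x1)))) atTop := by
        refine liminf_le_liminf (Eventually.of_forall fun n => ?_)
        rw [hReal n]
        exact ENNReal.ofReal_le_ofReal
          (integral_wronskianDensity_le hA hB (he0 n) hAp hBp h01 h12 h2)
    _ = _ := by
        refine Tendsto.liminf_eq ((ENNReal.continuous_ofReal.tendsto _).comp ?_)
        have ht := fun {x : ℝ} (hx : a < x) =>
          tendsto_integral_log_sumSq hA hB hA0 hx 0 (2 * Real.pi)
        exact ((ht (((h01.trans h12).trans_le h2))).sub (ht (h01.trans h12))).sub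
          ((((ht (h01.trans h12)).sub (ht h01)).div_const _).const_mul _)

end Lines

/-! ### From the Wronskian density to the density of the logarithmic derivative. -/

/-- The logarithmic derivative of `A / B`. -/
noncomputable def logDerivQuot (A B : ℂ → ℂ) (ζ : ℂ) : ℂ :=
  (deriv A ζ * B ζ - A ζ * deriv B ζ) / (A ζ * B ζ)

/-- `|log |A / B||`. -/
noncomputable def absLogQuot (A B : ℂ → ℂ) (ζ : ℂ) : ℝ := |Real.log ‖A ζ‖ - Real.log ‖B ζ‖|

/-- The density `|(A / B)' / (A / B)|² / (1 + |log |A / B||)³`. -/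
noncomputable def logDensity (A B : ℂ → ℂ) (ζ : ℂ) : ℝ :=
  ‖logDerivQuot A B ζ‖ ^ 2 / (1 + absLogQuot A B ζ) ^ 3

theorem absLogQuot_nonneg (A B : ℂ → ℂ) (ζ : ℂ) : 0 ≤ absLogQuot A B ζ := abs_nonneg _

theorem logDensity_nonneg (A B : ℂ → ℂ) (ζ : ℂ) : 0 ≤ logDensity A B ζ := by
  have := absLogQuot_nonneg A B ζ
  unfold logDensity; positivity

/-- `B` rescaled by `e^{k/2}`. -/
noncomputable def rescale (B : ℂ → ℂ) (k : ℤ) (ζ : ℂ) : ℂ := (Real.exp (k / 2) : ℂ) * B ζ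

theorem norm_rescale_sq (B : ℂ → ℂ) (k : ℤ) (ζ : ℂ) :
    ‖rescale B k ζ‖ ^ 2 = Real.exp k * ‖B ζ‖ ^ 2 := by
  rw [rescale, norm_mul, mul_pow, norm_real, Real.norm_of_nonneg (Real.exp_pos _).le,
    ← Real.exp_nat_mul]
  congr 2
  push_cast; ring

theorem wronskianDensity_rescale (A B : ℂ → ℂ) (k : ℤ) (ζ : ℂ) :
    wronskianDensity A (rescale B k) 0 ζ = 4 * (Real.exp k *
      ‖deriv A ζ * B ζ - A ζ * deriv B ζ‖ ^ 2) / (‖A ζ‖ ^ 2 + Real.exp k * ‖B ζ‖ ^ 2) ^ 2 := by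
  have h1 : deriv (rescale B k) ζ = (Real.exp (k / 2) : ℂ) * deriv B ζ := by
    unfold rescale
    rw [deriv_const_mul_field]
  have h2 := norm_rescale_sq (fun ζ => deriv A ζ * B ζ - A ζ * deriv B ζ) k ζ
  unfold rescale at h2
  rw [wronskianDensity, sumSq, norm_rescale_sq, h1, add_zero, ← h2, rescale]
  congr 5
  ring

/-- The weights used to average the rescaled densities. -/
noncomputable def weight (k : ℤ) : ℝ := 1 / (1 + |(k : ℝ)|) ^ 3

/-- The choice `k = ⌊2 log |A / B|⌋` makes `e^k |B|²` and `|A|²` comparable up to the factor `3 >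
e`. The rescaled Wronskian density is then at least a third of `|(A/B)'/(A/B)|²`. As `1 + |k| ≤ 2 (1
+ |log |A/B||)`, replacing the weight costs `2³ = 8`, whence `24`. At zeros of `A` or `B` the left
side is `0` by the division convention. -/
theorem exists_logDensity_le (A B : ℂ → ℂ) (ζ : ℂ) :
    ∃ k : ℤ, logDensity A B ζ ≤ 24 * (weight k * wronskianDensity A (rescale B k) 0 ζ) := by
  by_cases h : A ζ = 0 ∨ B ζ = 0
  · refine ⟨0, ?_⟩
    have : logDensity A B ζ = 0 := by
      rcases h with h | h <;> simp [logDensity, logDerivQuot, h]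
    rw [this]
    unfold weight wronskianDensity
    positivity
  push Not at h
  have ha : 0 < ‖A ζ‖ := norm_pos_iff.2 h.1
  have hb : 0 < ‖B ζ‖ := norm_pos_iff.2 h.2
  set H : ℝ := 2 * (Real.log ‖A ζ‖ - Real.log ‖B ζ‖) with hH
  set k : ℤ := ⌊H⌋ with hk
  have hk1 : (k : ℝ) ≤ H := Int.floor_le H
  have hk2 : H < k + 1 := Int.lt_floor_add_one H
  have hexpH : Real.exp H * ‖B ζ‖ ^ 2 = ‖A ζ‖ ^ 2 := by
    have h1 : Real.exp H = (‖A ζ‖ / ‖B ζ‖) ^ 2 := by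
      rw [hH, ← Real.log_div ha.ne' hb.ne', ← Real.exp_log (div_pos ha hb), ← Real.exp_nat_mul,
        Real.log_exp]
      norm_num
    rw [h1]; field_simp
  have hup : Real.exp k * ‖B ζ‖ ^ 2 ≤ ‖A ζ‖ ^ 2 := by
    rw [← hexpH]; gcongr
  have hlow : ‖A ζ‖ ^ 2 ≤ 3 * (Real.exp k * ‖B ζ‖ ^ 2) := by
    rw [← hexpH, ← mul_assoc]
    gcongr
    calc Real.exp H ≤ Real.exp (k + 1) := Real.exp_le_exp.2 hk2.le
      _ = Real.exp 1 * Real.exp k := by rw [Real.exp_add, mul_comm]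
      _ ≤ 3 * Real.exp k := by
        gcongr
        exact Real.exp_one_lt_three.le
  have habs : 1 + |(k : ℝ)| ≤ 2 * (1 + absLogQuot A B ζ) := by
    have h1 : |(k : ℝ)| ≤ |H| + 1 := by
      have h3 := le_abs_self H
      have h4 := neg_abs_le H
      rw [abs_le]; constructor <;> linarith
    have h2 : |H| = 2 * absLogQuot A B ζ := by
      rw [hH, abs_mul, absLogQuot]; norm_num
    linarith
  refine ⟨k, ?_⟩
  rw [wronskianDensity_rescale]
  set W := ‖deriv A ζ * B ζ - A ζ * deriv B ζ‖ ^ 2 with hW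
  have hWn : 0 ≤ W := by positivity
  have hL : ‖logDerivQuot A B ζ‖ ^ 2 = W / (‖A ζ‖ ^ 2 * ‖B ζ‖ ^ 2) := by
    rw [logDerivQuot, norm_div, norm_mul, div_pow, mul_pow]
  have hD : W / (‖A ζ‖ ^ 2 * ‖B ζ‖ ^ 2) ≤
      3 * (4 * (Real.exp k * W) / (‖A ζ‖ ^ 2 + Real.exp k * ‖B ζ‖ ^ 2) ^ 2) := by
    have hE := Real.exp_pos k
    rw [mul_div_assoc', div_le_div_iff₀ (by positivity) (by positivity)]
    have h1 : (‖A ζ‖ ^ 2 + Real.exp k * ‖B ζ‖ ^ 2) ^ 2 ≤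
        12 * Real.exp k * (‖A ζ‖ ^ 2 * ‖B ζ‖ ^ 2) := by
      have h2 : (‖A ζ‖ ^ 2 + Real.exp k * ‖B ζ‖ ^ 2) ^ 2 ≤ (2 * ‖A ζ‖ ^ 2) ^ 2 := by
        gcongr; linarith
      have h3 : ‖A ζ‖ ^ 2 * ‖A ζ‖ ^ 2 ≤ ‖A ζ‖ ^ 2 * (3 * (Real.exp k * ‖B ζ‖ ^ 2)) := by gcongr
      linarith
    calc W * (‖A ζ‖ ^ 2 + Real.exp k * ‖B ζ‖ ^ 2) ^ 2
        ≤ W * (12 * Real.exp k * (‖A ζ‖ ^ 2 * ‖B ζ‖ ^ 2)) := by gcongr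
      _ = _ := by ring
  have hq := absLogQuot_nonneg A B ζ
  have hw : 1 / (1 + absLogQuot A B ζ) ^ 3 ≤ 8 * weight k := by
    unfold weight
    rw [mul_one_div, div_le_div_iff₀ (by positivity) (by positivity)]
    have h1 : (1 + |(k : ℝ)|) ^ 3 ≤ (2 * (1 + absLogQuot A B ζ)) ^ 3 := by gcongr
    linarith
  rw [logDensity, hL, div_eq_mul_one_div]
  calc W / (‖A ζ‖ ^ 2 * ‖B ζ‖ ^ 2) * (1 / (1 + absLogQuot A B ζ) ^ 3)
      ≤ (3 * (4 * (Real.exp k * W) / (‖A ζ‖ ^ 2 + Real.exp k * ‖B ζ‖ ^ 2) ^ 2)) *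
        (8 * weight k) := by
        have : 0 ≤ weight k := by unfold weight; positivity
        gcongr
    _ = _ := by ring

section Rescaled

variable {A B : ℂ → ℂ} {a : ℝ}

theorem log_sumSq_rescale_le {ζ : ℂ} (hA : A ζ ≠ 0) (hB : B ζ ≠ 0) (k : ℤ) :
    Real.log (sumSq A (rescale B k) 0 ζ) ≤
      2 * max (Real.log ‖A ζ‖) (Real.log ‖B ζ‖) + (1 + |(k : ℝ)|) := by
  have ha : 0 < ‖A ζ‖ := norm_pos_iff.2 hA
  have hb : 0 < ‖B ζ‖ := norm_pos_iff.2 hB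
  set m := max (Real.log ‖A ζ‖) (Real.log ‖B ζ‖) with hm
  have h1 : ‖A ζ‖ ^ 2 ≤ Real.exp (2 * m) := by
    rw [← Real.exp_log ha, ← Real.exp_nat_mul]
    refine Real.exp_le_exp.2 ?_
    push_cast
    linarith [le_max_left (Real.log ‖A ζ‖) (Real.log ‖B ζ‖)]
  have h2 : ‖B ζ‖ ^ 2 ≤ Real.exp (2 * m) := by
    rw [← Real.exp_log hb, ← Real.exp_nat_mul]
    refine Real.exp_le_exp.2 ?_
    push_cast
    linarith [le_max_right (Real.log ‖A ζ‖) (Real.log ‖B ζ‖)]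
  rw [sumSq, norm_rescale_sq, add_zero, Real.log_le_iff_le_exp (by positivity)]
  have h3 : Real.exp k ≤ Real.exp |(k : ℝ)| := Real.exp_le_exp.2 (le_abs_self _)
  have h4 : 1 ≤ Real.exp |(k : ℝ)| := Real.one_le_exp (abs_nonneg _)
  calc ‖A ζ‖ ^ 2 + Real.exp k * ‖B ζ‖ ^ 2
      ≤ Real.exp |(k : ℝ)| * Real.exp (2 * m) + Real.exp |(k : ℝ)| * Real.exp (2 * m) := by
        gcongr
        exact h1.trans (le_mul_of_one_le_left (Real.exp_pos _).le h4)
    _ = 2 * (Real.exp (2 * m) * Real.exp |(k : ℝ)|) := by ring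
    _ ≤ Real.exp 1 * (Real.exp (2 * m) * Real.exp |(k : ℝ)|) := by
        gcongr
        linarith [Real.add_one_le_exp (1 : ℝ)]
    _ = _ := by rw [← Real.exp_add, ← Real.exp_add]; congr 1; ring

/-- The integral over a vertical period of `max (log |A|) (log |B|)`. -/
noncomputable def charInt (A B : ℂ → ℂ) (x : ℝ) : ℝ :=
  ∫ y in (0 : ℝ)..2 * Real.pi, max (Real.log ‖A (x + y * I)‖) (Real.log ‖B (x + y * I)‖)

theorem IntervalIntegrable.max' {f g : ℝ → ℝ} {p r : ℝ} (hf : IntervalIntegrable f volume p r)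
    (hg : IntervalIntegrable g volume p r) :
    IntervalIntegrable (fun y => max (f y) (g y)) volume p r :=
  ⟨hf.1.sup hg.1, hf.2.sup hg.2⟩

variable (hA : DifferentiableOn ℂ A (halfPlane a)) (hB : DifferentiableOn ℂ B (halfPlane a))
  (hA0 : ∃ ζ ∈ halfPlane a, A ζ ≠ 0) (hB0 : ∃ ζ ∈ halfPlane a, B ζ ≠ 0)

include hA hB in
theorem intervalIntegrable_max_log {x : ℝ} (hx : a < x) (p r : ℝ) :
    IntervalIntegrable (fun y : ℝ => max (Real.log ‖A (x + y * I)‖) (Real.log ‖B (x + y * I)‖))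
      volume p r :=
  IntervalIntegrable.max' (intervalIntegrable_log_norm_line hA hx p r)
    (intervalIntegrable_log_norm_line hB hx p r)

include hB in
theorem differentiableOn_rescale (k : ℤ) : DifferentiableOn ℂ (rescale B k) (halfPlane a) :=
  (differentiableOn_const _).mul hB

include hA hB hA0

theorem le_integral_log_sumSq_rescale {x : ℝ} (hx : a < x) (k : ℤ) :
    2 * ∫ y in (0 : ℝ)..2 * Real.pi, Real.log ‖A (x + y * I)‖ ≤
      ∫ y in (0 : ℝ)..2 * Real.pi, Real.log (sumSq A (rescale B k) 0 (x + y * I)) := by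
  rw [← intervalIntegral.integral_const_mul]
  refine intervalIntegral.integral_mono_ae (by positivity)
    ((intervalIntegrable_log_norm_line hA hx _ _).const_mul 2)
    (intervalIntegrable_log_sumSq hA (differentiableOn_rescale hB k) hA0 le_rfl zero_le_one hx _ _)
    ?_
  filter_upwards [ae_ne_zero_of_exists_ne_zero hA hA0 hx] with y h1
    using two_mul_log_norm_le_log_sumSq le_rfl h1

include hB0

theorem integral_log_sumSq_rescale_le {x : ℝ} (hx : a < x) (k : ℤ) :
    ∫ y in (0 : ℝ)..2 * Real.pi, Real.log (sumSq A (rescale B k) 0 (x + y * I)) ≤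
      2 * charInt A B x + 2 * Real.pi * (1 + |(k : ℝ)|) := by
  have hi := intervalIntegrable_max_log hA hB hx 0 (2 * Real.pi)
  have h1 : ∫ y in (0 : ℝ)..2 * Real.pi, Real.log (sumSq A (rescale B k) 0 (x + y * I)) ≤
      ∫ y in (0 : ℝ)..2 * Real.pi, (2 * max (Real.log ‖A (x + y * I)‖) (Real.log ‖B (x + y * I)‖)
        + (1 + |(k : ℝ)|)) := by
    refine intervalIntegral.integral_mono_ae (by positivity)
      (intervalIntegrable_log_sumSq hA (differentiableOn_rescale hB k) hA0 le_rfl zero_le_one hx _ _)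
      ((hi.const_mul 2).add intervalIntegrable_const) ?_
    filter_upwards [ae_ne_zero_of_exists_ne_zero hA hA0 hx, ae_ne_zero_of_exists_ne_zero hB hB0 hx]
      with y h1 h2 using log_sumSq_rescale_le h1 h2 k
  refine h1.trans_eq ?_
  rw [intervalIntegral.integral_add (hi.const_mul 2) intervalIntegrable_const,
    intervalIntegral.integral_const_mul, charInt]
  simp
  ring

/-- For each `k` the second antiderivative of the rescaled Wronskian density is at most `1 + |k|`
times a quantity independent of `k`. The cubic weight leaves `(1 + |k|)⁻²`, which is summable; this
is the reason for the exponent `3`. -/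
theorem exists_lintegral_logDensity_le (hAm : Measurable A) (hBm : Measurable B)
    (hAp : Function.Periodic A (2 * Real.pi * I)) (hBp : Function.Periodic B (2 * Real.pi * I))
    {b : ℝ} (hab : a < b) :
    ∃ C, 0 ≤ C ∧ ∀ x, b ≤ x →
      ∫⁻ t in Ioc b x, ∫⁻ y in Ioc 0 (2 * Real.pi),
        ENNReal.ofReal ((x - t) * logDensity A B (t + y * I)) ≤
      ENNReal.ofReal (C * (max (charInt A B x) 0 + (x - b) + 1)) := by
  obtain ⟨x1, h01, h12⟩ := exists_between hab
  -- `c2` controls the period integrals at `b` from below and `c3 (1 + |k|)` those at `x1` from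
  -- above, for every `k`. Together they bound minus the base slope by `L (c2 + c3) (1 + |k|)`.
  set c2 := |2 * ∫ y in (0 : ℝ)..2 * Real.pi, Real.log ‖A (b + y * I)‖| with hc2
  set c3 := 2 * |charInt A B x1| + 2 * Real.pi with hc3
  set L := 1 / (b - x1) with hL
  have hc2n : 0 ≤ c2 := abs_nonneg _
  have hc3n : 0 ≤ c3 := by positivity
  have hL0 : 0 ≤ L := by
    have : 0 < b - x1 := sub_pos.2 h12
    positivity
  set C0 := 2 + 2 * Real.pi + c2 + L * (c2 + c3) with hC0
  have hC0n : 0 ≤ C0 := by positivity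
  have hsum : Summable fun k : ℤ => 1 / (1 + |(k : ℝ)|) ^ 2 := by
    have h := (summable_nat_add_iff 1).2 (Real.summable_one_div_nat_pow.2 one_lt_two)
    refine Summable.of_nat_of_neg ?_ ?_ <;>
    · refine h.congr fun n => ?_
      push_cast
      simp [add_comm]
  set S := ∑' k : ℤ, ENNReal.ofReal (1 / (1 + |(k : ℝ)|) ^ 2) with hS
  have hSfin : S ≠ ⊤ := hsum.tsum_ofReal_lt_top.ne
  have hrm : ∀ k, Measurable (rescale B k) := fun k => hBm.const_mul _
  have hwm : ∀ k, Measurable (wronskianDensity A (rescale B k) 0) := fun k => by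
    have h1 := measurable_deriv A
    have h2 := measurable_deriv (rescale B k)
    have h3 := hrm k
    unfold wronskianDensity sumSq
    fun_prop
  have hweight : ∀ k, 0 ≤ 24 * weight k := fun k => by unfold weight; positivity
  refine ⟨24 * C0 * S.toReal, by positivity, fun x hx => ?_⟩
  set X := max (charInt A B x) 0 + (x - b) + 1 with hX
  have hX1 : 0 ≤ max (charInt A B x) 0 := le_max_right _ _
  have hxb : 0 ≤ x - b := sub_nonneg.2 hx
  have hXn : 0 ≤ X := by positivity
  have hk : ∀ k : ℤ, ∫⁻ t in Ioc b x, ∫⁻ y in Ioc 0 (2 * Real.pi),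
      ENNReal.ofReal ((x - t) * wronskianDensity A (rescale B k) 0 (t + y * I)) ≤
      ENNReal.ofReal ((1 + |(k : ℝ)|) * (C0 * X)) := by
    intro k
    refine (lintegral_wronskianDensity_le hA (differentiableOn_rescale hB k) hA0 hAm (hrm k) hAp
      (fun ζ => by simp only [rescale, hBp ζ]) h01 h12 hx).trans (ENNReal.ofReal_le_ofReal ?_)
    have e1 := integral_log_sumSq_rescale_le hA hB hA0 hB0 (hab.trans_le hx) k
    have e2 := le_integral_log_sumSq_rescale hA hB hA0 hab k
    have e3 := integral_log_sumSq_rescale_le hA hB hA0 hB0 h01 k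
    set m := ∫ y in (0 : ℝ)..2 * Real.pi, Real.log (sumSq A (rescale B k) 0 (x + y * I))
    set m2 := ∫ y in (0 : ℝ)..2 * Real.pi, Real.log (sumSq A (rescale B k) 0 (b + y * I))
    set m1 := ∫ y in (0 : ℝ)..2 * Real.pi, Real.log (sumSq A (rescale B k) 0 (x1 + y * I))
    set K := 1 + |(k : ℝ)| with hK
    have hK1 : 1 ≤ K := by linarith [abs_nonneg (k : ℝ)]
    have f2 : -c2 ≤ m2 := (neg_abs_le _).trans e2
    have f1 : m ≤ 2 * max (charInt A B x) 0 + 2 * Real.pi * K := by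
      linarith [le_max_left (charInt A B x) 0]
    have f3 : m1 ≤ c3 * K := by
      have h1 : 2 * charInt A B x1 ≤ 2 * |charInt A B x1| * K := by
        have := le_abs_self (charInt A B x1)
        nlinarith [abs_nonneg (charInt A B x1)]
      rw [hc3, add_mul]
      linarith
    have f4 : -((x - b) * ((m2 - m1) / (b - x1))) ≤ (x - b) * (L * (c2 + c3)) * K := by
      have h1 : (m2 - m1) / (b - x1) = L * (m2 - m1) := by rw [hL]; ring
      have h2 : -(m2 - m1) ≤ (c2 + c3) * K := by nlinarith
      calc -((x - b) * ((m2 - m1) / (b - x1))) = (x - b) * (L * (-(m2 - m1))) := by rw [h1]; ring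
        _ ≤ (x - b) * (L * ((c2 + c3) * K)) := by gcongr
        _ = _ := by ring
    calc m - m2 - (x - b) * ((m2 - m1) / (b - x1))
        ≤ (2 * max (charInt A B x) 0) * K + 2 * Real.pi * K + c2 * K
          + (x - b) * (L * (c2 + c3)) * K := by nlinarith
      _ = K * (2 * max (charInt A B x) 0 + 2 * Real.pi + c2 + L * (c2 + c3) * (x - b)) := by ring
      _ ≤ K * (C0 * X) := by
        have hp := Real.pi_pos
        have hlc : 0 ≤ L * (c2 + c3) := by positivity
        gcongr
        rw [hC0, hX]
        nlinarith [mul_nonneg hp.le hX1, mul_nonneg hc2n hX1, mul_nonneg hlc hX1,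
          mul_nonneg hp.le hxb, mul_nonneg hc2n hxb]
  calc ∫⁻ t in Ioc b x, ∫⁻ y in Ioc 0 (2 * Real.pi),
        ENNReal.ofReal ((x - t) * logDensity A B (t + y * I))
      ≤ ∫⁻ t in Ioc b x, ∫⁻ y in Ioc 0 (2 * Real.pi), ∑' k : ℤ, ENNReal.ofReal (24 * weight k) *
        ENNReal.ofReal ((x - t) * wronskianDensity A (rescale B k) 0 (t + y * I)) := by
        refine setLIntegral_mono' measurableSet_Ioc fun t ht => lintegral_mono fun y => ?_
        obtain ⟨k, hk⟩ := exists_logDensity_le A B (t + y * I)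
        -- The index `k` depends on the point; passing to the sum over all `k` removes this
        -- dependence.
        refine le_trans ?_ (ENNReal.le_tsum k)
        rw [← ENNReal.ofReal_mul (hweight k)]
        refine ENNReal.ofReal_le_ofReal ?_
        have hxt : 0 ≤ x - t := by linarith [ht.2]
        calc _ ≤ (x - t) * (24 * (weight k * wronskianDensity A (rescale B k) 0 (t + y * I))) := by
              gcongr
          _ = _ := by ring
    _ = ∑' k : ℤ, ENNReal.ofReal (24 * weight k) * ∫⁻ t in Ioc b x, ∫⁻ y in Ioc 0 (2 * Real.pi),
        ENNReal.ofReal ((x - t) * wronskianDensity A (rescale B k) 0 (t + y * I)) := by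
        have hm : ∀ k : ℤ, Measurable (Function.uncurry fun t y : ℝ =>
            ENNReal.ofReal ((x - t) * wronskianDensity A (rescale B k) 0 (t + y * I))) := fun k =>
          Measurable.ennreal_ofReal (Measurable.mul (by fun_prop) ((hwm k).comp (by fun_prop)))
        have hm' : ∀ k : ℤ, ∀ t : ℝ, Measurable fun y : ℝ =>
            ENNReal.ofReal ((x - t) * wronskianDensity A (rescale B k) 0 (t + y * I)) := fun k t =>
          (hm k).comp (measurable_const.prodMk measurable_id)
        have h1 : ∀ t : ℝ, ∫⁻ y in Ioc 0 (2 * Real.pi), ∑' k : ℤ, ENNReal.ofReal (24 * weight k) *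
            ENNReal.ofReal ((x - t) * wronskianDensity A (rescale B k) 0 (t + y * I)) =
            ∑' k : ℤ, ENNReal.ofReal (24 * weight k) * ∫⁻ y in Ioc 0 (2 * Real.pi),
            ENNReal.ofReal ((x - t) * wronskianDensity A (rescale B k) 0 (t + y * I)) := by
          intro t
          rw [lintegral_tsum fun k => ((hm' k t).const_mul _).aemeasurable]
          exact tsum_congr fun k => lintegral_const_mul _ (hm' k t)
        simp only [h1]
        have h2 : ∀ k : ℤ, Measurable fun t : ℝ => ∫⁻ y in Ioc 0 (2 * Real.pi),
            ENNReal.ofReal ((x - t) * wronskianDensity A (rescale B k) 0 (t + y * I)) := fun k =>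
          (hm k).lintegral_prod_right'
        rw [lintegral_tsum fun k => ((h2 k).const_mul _).aemeasurable]
        exact tsum_congr fun k => lintegral_const_mul _ (h2 k)
    _ ≤ ∑' k : ℤ, ENNReal.ofReal (24 * (C0 * X)) * ENNReal.ofReal (1 / (1 + |(k : ℝ)|) ^ 2) := by
        refine ENNReal.tsum_le_tsum fun k => ?_
        calc _ ≤ ENNReal.ofReal (24 * weight k) * ENNReal.ofReal ((1 + |(k : ℝ)|) * (C0 * X)) := by
              gcongr
              exact hk k
          _ = _ := by
            rw [← ENNReal.ofReal_mul (hweight k), ← ENNReal.ofReal_mul (by positivity)]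
            congr 1
            unfold weight
            have : 1 + |(k : ℝ)| ≠ 0 := by positivity
            field_simp
    _ = ENNReal.ofReal (24 * C0 * S.toReal * X) := by
        rw [ENNReal.tsum_mul_left, ← hS, ← ENNReal.ofReal_toReal hSfin,
          ← ENNReal.ofReal_mul (by positivity), ENNReal.toReal_ofReal ENNReal.toReal_nonneg]
        congr 1; ring

end Rescaled

/-! ### The lemma on the logarithmic derivative in a half-plane. -/

section LogDeriv

variable {A B : ℂ → ℂ} {a : ℝ}

/-- The period integral of `log |A|` is convex in `x`, being a limit of convex functions (the case
`B = 0` above). It therefore stays above the line with the slope of the chord over `[x1, b]`. -/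
theorem exists_le_integral_log_norm (hA : DifferentiableOn ℂ A (halfPlane a))
    (hA0 : ∃ ζ ∈ halfPlane a, A ζ ≠ 0)
    (hAp : Function.Periodic A (2 * Real.pi * I)) {b : ℝ} (hab : a < b) :
    ∃ C, 0 ≤ C ∧ ∀ x, b ≤ x →
      -(C * (x - b + 1)) ≤ ∫ y in (0 : ℝ)..2 * Real.pi, Real.log ‖A (x + y * I)‖ := by
  obtain ⟨x1, h01, h12⟩ := exists_between hab
  have h0 : DifferentiableOn ℂ (fun _ : ℂ => (0 : ℂ)) (halfPlane a) := differentiableOn_const _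
  set m : ℝ → ℝ := fun x => ∫ y in (0 : ℝ)..2 * Real.pi,
    Real.log (sumSq A (fun _ => 0) 0 (x + y * I)) with hm
  have hm2 : ∀ x, m x = 2 * ∫ y in (0 : ℝ)..2 * Real.pi, Real.log ‖A (x + y * I)‖ := by
    intro x
    rw [← intervalIntegral.integral_const_mul]
    refine intervalIntegral.integral_congr fun y _ => ?_
    simp [sumSq, Real.log_pow]
  have hkey : ∀ x, b ≤ x → 0 ≤ m x - m b - (x - b) * ((m b - m x1) / (b - x1)) := by
    intro x hx
    have ht := fun {x : ℝ} (hx : a < x) =>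
      tendsto_integral_log_sumSq hA h0 hA0 hx 0 (2 * Real.pi)
    refine ge_of_tendsto (((ht (hab.trans_le hx)).sub (ht hab)).sub
      ((((ht hab).sub (ht h01)).div_const (b - x1)).const_mul (x - b)))
      (Eventually.of_forall fun n => ?_)
    refine le_trans ?_ (integral_wronskianDensity_le hA h0 (by positivity) hAp
      (fun _ => rfl) h01 h12 hx)
    refine intervalIntegral.integral_nonneg hx fun t ht => mul_nonneg (by linarith [ht.2])
      (intervalIntegral.integral_nonneg (by positivity) fun y _ => ?_)
    unfold wronskianDensity
    positivity
  set s := (m b - m x1) / (b - x1)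
  refine ⟨|m b| + |s|, by positivity, fun x hx => ?_⟩
  have h1 := hkey x hx
  rw [hm2 x] at h1
  have h2 := neg_abs_le (m b)
  have h3 : -((x - b) * |s|) ≤ (x - b) * s := by
    have := mul_le_mul_of_nonneg_left (neg_abs_le s) (sub_nonneg.2 hx)
    linarith
  have h4 : 0 ≤ (x - b) * |m b| := mul_nonneg (sub_nonneg.2 hx) (abs_nonneg _)
  have h5 : 0 ≤ (x - b) * |s| := mul_nonneg (sub_nonneg.2 hx) (abs_nonneg _)
  nlinarith [abs_nonneg (m b), abs_nonneg s]

theorem log_one_add_le_of_le {C b x τ Y : ℝ} (hC : 0 ≤ C) (hτ : 0 ≤ τ) (hY0 : 0 ≤ Y)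
    (hY : Y ≤ C * (τ + (x - b) + 1)) :
    Real.log (1 + Y) ≤ Real.log ((C + 1) * (1 + |b|)) + |x| + Real.log (1 + τ) := by
  have h1 : 1 + Y ≤ (C + 1) * (1 + |b|) * (1 + |x|) * (1 + τ) := by
    have hb := neg_abs_le b
    have hx := le_abs_self x
    have h2 : τ + (x - b) + 1 ≤ (1 + |b|) * (1 + |x|) * (1 + τ) := by
      have := abs_nonneg b
      have := abs_nonneg x
      have : 0 ≤ |b| * |x| := by positivity
      have : 0 ≤ |b| * τ := by positivity
      have : 0 ≤ |x| * τ := by positivity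
      have : 0 ≤ |b| * |x| * τ := by positivity
      nlinarith
    have h3 : 1 ≤ (1 + |b|) * (1 + |x|) * (1 + τ) := by
      refine one_le_mul_of_one_le_of_one_le (one_le_mul_of_one_le_of_one_le ?_ ?_) ?_
      · linarith [abs_nonneg b]
      · linarith [abs_nonneg x]
      · linarith
    have h4 := mul_le_mul_of_nonneg_left h2 hC
    linarith
  have h2 : Real.log (1 + |x|) ≤ |x| := by
    have := Real.log_le_sub_one_of_pos (x := 1 + |x|) (by positivity)
    linarith
  calc Real.log (1 + Y) ≤ Real.log ((C + 1) * (1 + |b|) * (1 + |x|) * (1 + τ)) :=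
        Real.log_le_log (by linarith) h1
    _ = Real.log ((C + 1) * (1 + |b|)) + Real.log (1 + |x|) + Real.log (1 + τ) := by
        rw [Real.log_mul (by positivity) (by positivity),
          Real.log_mul (by positivity) (by positivity)]
    _ ≤ _ := by linarith

/-- The tangent line of the concave function `log` at `1 + R`. Integrated over a period, it plays
the role of Jensen's inequality. -/
theorem log_one_add_le {R q : ℝ} (hR : 0 ≤ R) (hq : 0 ≤ q) :
    Real.log (1 + q) ≤ Real.log (1 + R) + (1 + q) / (1 + R) := by
  have h := Real.log_le_sub_one_of_pos (x := (1 + q) / (1 + R)) (by positivity)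
  rw [Real.log_div (by positivity) (by positivity)] at h
  linarith

/-- If `q ≥ 0` has integral at most `R`, then `log (1 + q)` has integral at most
`log (1 + R)` times the length plus a constant. -/
theorem integral_log_one_add_le {q : ℝ → ℝ} {R : ℝ} (hq : ∀ y, 0 ≤ q y) (hqm : Measurable q)
    (hqi : IntervalIntegrable q volume 0 (2 * Real.pi))
    (hR : ∫ y in (0 : ℝ)..2 * Real.pi, q y ≤ R) :
    IntervalIntegrable (fun y => Real.log (1 + q y)) volume 0 (2 * Real.pi) ∧
    ∫ y in (0 : ℝ)..2 * Real.pi, Real.log (1 + q y) ≤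
      2 * Real.pi * Real.log (1 + R) + (2 * Real.pi + 1) := by
  have hR0 : 0 ≤ R := (intervalIntegral.integral_nonneg (by positivity) fun y _ => hq y).trans hR
  have hlog : ∀ y, 0 ≤ Real.log (1 + q y) := fun y => Real.log_nonneg (by linarith [hq y])
  have hint : IntervalIntegrable (fun y => Real.log (1 + q y)) volume 0 (2 * Real.pi) := by
    refine hqi.mono_fun (Real.measurable_log.comp (hqm.const_add 1)).aestronglyMeasurable
      (Eventually.of_forall fun y => ?_)
    simp only [Real.norm_of_nonneg (hlog y), Real.norm_of_nonneg (hq y)]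
    have := Real.log_le_sub_one_of_pos (x := 1 + q y) (by linarith [hq y])
    linarith
  refine ⟨hint, ?_⟩
  have hint2 : IntervalIntegrable (fun y => (1 + q y) / (1 + R)) volume 0 (2 * Real.pi) :=
    (intervalIntegrable_const.add hqi).div_const _
  calc ∫ y in (0 : ℝ)..2 * Real.pi, Real.log (1 + q y)
      ≤ ∫ y in (0 : ℝ)..2 * Real.pi, (Real.log (1 + R) + (1 + q y) / (1 + R)) :=
        intervalIntegral.integral_mono_on (by positivity) hint (intervalIntegrable_const.add hint2)
          fun y _ => log_one_add_le hR0 (hq y)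
    _ = 2 * Real.pi * Real.log (1 + R) +
        (2 * Real.pi + ∫ y in (0 : ℝ)..2 * Real.pi, q y) / (1 + R) := by
        rw [intervalIntegral.integral_add intervalIntegrable_const hint2,
          intervalIntegral.integral_div,
          intervalIntegral.integral_add intervalIntegrable_const hqi]
        simp
    _ ≤ 2 * Real.pi * Real.log (1 + R) + (2 * Real.pi + 1) := by
        gcongr
        rw [div_le_iff₀ (by positivity)]
        have := Real.pi_pos
        nlinarith

/-- The squared logarithmic derivative is the density times `(1 + |log |A/B||)³`. Both factors have
controlled integrals, so `log (1 + ·)` of each can be estimated separately. -/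
theorem two_mul_posLog_norm_logDerivQuot_le (A B : ℂ → ℂ) (ζ : ℂ) :
    2 * Real.posLog ‖logDerivQuot A B ζ‖ ≤
      Real.log (1 + logDensity A B ζ) + 3 * Real.log (1 + absLogQuot A B ζ) := by
  set l := ‖logDerivQuot A B ζ‖ with hl
  have hl0 : 0 ≤ l := norm_nonneg _
  have hq := absLogQuot_nonneg A B ζ
  have hD := logDensity_nonneg A B ζ
  have h1 : 2 * Real.posLog l ≤ Real.log (1 + l ^ 2) := by
    have h2 : Real.log (l ^ 2) = 2 * Real.log l := by rw [Real.log_pow]; norm_num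
    rcases le_total l 1 with h | h
    · rw [Real.posLog_eq_zero_iff _ |>.2 (by rwa [abs_of_nonneg hl0])]
      simpa using Real.log_nonneg (by linarith [sq_nonneg l])
    · rw [Real.posLog_eq_log (by rwa [abs_of_nonneg hl0]), ← h2]
      exact Real.log_le_log (by positivity) (by linarith)
  have h3 : 1 + l ^ 2 ≤ (1 + logDensity A B ζ) * (1 + absLogQuot A B ζ) ^ 3 := by
    have h4 : logDensity A B ζ * (1 + absLogQuot A B ζ) ^ 3 = l ^ 2 := by
      rw [logDensity, ← hl]; field_simp
    have h5 : 1 ≤ (1 + absLogQuot A B ζ) ^ 3 := one_le_pow₀ (by linarith)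
    rw [add_mul, h4]; linarith
  refine h1.trans ((Real.log_le_log (by positivity) h3).trans_eq ?_)
  rw [Real.log_mul (by positivity) (by positivity), Real.log_pow]
  norm_num

theorem measurable_logDerivQuot (hAm : Measurable A) (hBm : Measurable B) :
    Measurable (logDerivQuot A B) := by
  have h1 := measurable_deriv A
  have h2 := measurable_deriv B
  unfold logDerivQuot
  fun_prop

theorem measurable_absLogQuot (hAm : Measurable A) (hBm : Measurable B) :
    Measurable (absLogQuot A B) := by unfold absLogQuot; fun_prop

theorem measurable_logDensity (hAm : Measurable A) (hBm : Measurable B) :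
    Measurable (logDensity A B) := by
  have h1 := measurable_logDerivQuot hAm hBm
  have h2 := measurable_absLogQuot hAm hBm
  unfold logDensity
  fun_prop

/-- The growth lemma converts the bound on the second antiderivative into a bound on individual
vertical lines, off an exceptional set. -/
theorem exists_lintegral_logDensity_le_ofReal
    (hA : DifferentiableOn ℂ A (halfPlane a)) (hB : DifferentiableOn ℂ B (halfPlane a))
    (hA0 : ∃ ζ ∈ halfPlane a, A ζ ≠ 0) (hB0 : ∃ ζ ∈ halfPlane a, B ζ ≠ 0)
    (hAm : Measurable A) (hBm : Measurable B)
    (hAp : Function.Periodic A (2 * Real.pi * I)) (hBp : Function.Periodic B (2 * Real.pi * I))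
    {b : ℝ} (hab : a < b) :
    ∃ C E, 0 ≤ C ∧ ExpNegligible E ∧ ∀ x, b < x → x ∉ E →
      ∫⁻ y in Ioc 0 (2 * Real.pi), ENNReal.ofReal (logDensity A B (x + y * I)) ≤
        ENNReal.ofReal (Real.exp x * (1 + Real.exp x *
          (1 + C * (max (charInt A B x) 0 + (x - b) + 1)) ^ 2) ^ 2) := by
  obtain ⟨C1, hC1, h1⟩ := exists_lintegral_logDensity_le hA hB hA0 hB0 hAm hBm hAp hBp hab
  have hQm := measurable_logDensity hAm hBm
  have hline : ∀ x : ℝ, Measurable fun y : ℝ => logDensity A B (x + y * I) :=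
    fun x => hQm.comp (by fun_prop)
  set D : ℝ → ℝ≥0∞ := fun t => ∫⁻ y in Ioc 0 (2 * Real.pi),
    ENNReal.ofReal (logDensity A B (t + y * I)) with hD
  have hDm : Measurable D := by
    have : Measurable (Function.uncurry fun t y : ℝ =>
        ENNReal.ofReal (logDensity A B (t + y * I))) :=
      Measurable.ennreal_ofReal (hQm.comp (by fun_prop))
    exact this.lintegral_prod_right'
  have hJ : ∀ x, b ≤ x → ∫⁻ t in Ioc b x, ENNReal.ofReal (x - t) * D t ≤
      ENNReal.ofReal (C1 * (max (charInt A B x) 0 + (x - b) + 1)) := by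
    intro x hx
    refine le_trans (le_of_eq ?_) (h1 x hx)
    refine setLIntegral_congr_fun measurableSet_Ioc fun t ht => ?_
    have hxt : 0 ≤ x - t := by linarith [ht.2]
    simp only [hD]
    rw [← lintegral_const_mul _ (hline t).ennreal_ofReal]
    exact lintegral_congr fun y => (ENNReal.ofReal_mul hxt).symm
  obtain ⟨E, hE, hEx⟩ := exists_expNegligible_le hDm (a := b) fun x => by
    rcases le_total b x with h | h
    · exact (hJ x h).trans_lt ENNReal.ofReal_lt_top
    · simp [Ioc_eq_empty (not_lt.2 h)]
  refine ⟨C1, E, hC1, hE, fun x hx hxE => (hEx x hx hxE).trans ?_⟩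
  have hY0 : 0 ≤ C1 * (max (charInt A B x) 0 + (x - b) + 1) := by
    have := le_max_right (charInt A B x) 0
    have : 0 ≤ x - b := by linarith
    positivity
  rw [ENNReal.ofReal_mul (Real.exp_pos x).le, ENNReal.ofReal_pow (by positivity),
    ENNReal.ofReal_add zero_le_one (by positivity), ENNReal.ofReal_mul (Real.exp_pos x).le,
    ENNReal.ofReal_pow (by positivity), ENNReal.ofReal_add zero_le_one hY0, ENNReal.ofReal_one]
  gcongr
  exact hJ x hx.le

/-- Pointwise `|u - v| = 2 max u v - u - v`. The last two integrals decrease at most linearly in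
`x`, so `|log |A/B||` is controlled by the characteristic from above. -/
theorem integral_absLogQuot_eq (hA : DifferentiableOn ℂ A (halfPlane a))
    (hB : DifferentiableOn ℂ B (halfPlane a)) {x : ℝ} (hx : a < x) :
    ∫ y in (0 : ℝ)..2 * Real.pi, absLogQuot A B (x + y * I) = 2 * charInt A B x
      - (∫ y in (0 : ℝ)..2 * Real.pi, Real.log ‖A (x + y * I)‖)
      - ∫ y in (0 : ℝ)..2 * Real.pi, Real.log ‖B (x + y * I)‖ := by
  have hiA := intervalIntegrable_log_norm_line hA hx 0 (2 * Real.pi)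
  have hiB := intervalIntegrable_log_norm_line hB hx 0 (2 * Real.pi)
  have hiM := intervalIntegrable_max_log hA hB hx 0 (2 * Real.pi)
  rw [charInt, ← intervalIntegral.integral_const_mul,
    ← intervalIntegral.integral_sub (hiM.const_mul 2) hiA,
    ← intervalIntegral.integral_sub ((hiM.const_mul 2).sub hiA) hiB]
  refine intervalIntegral.integral_congr fun y _ => ?_
  simp only [absLogQuot]
  rcases le_total (Real.log ‖A (x + y * I)‖) (Real.log ‖B (x + y * I)‖) with h | h
  · rw [max_eq_right h, abs_of_nonpos (by linarith)]; ring
  · rw [max_eq_left h, abs_of_nonneg (by linarith)]; ring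

theorem integral_posLog_logDerivQuot_le (hA : DifferentiableOn ℂ A (halfPlane a))
    (hB : DifferentiableOn ℂ B (halfPlane a)) (hAm : Measurable A) (hBm : Measurable B)
    {x R S : ℝ} (hx : a < x) (hR0 : 0 ≤ R)
    (hR : ∫⁻ y in Ioc 0 (2 * Real.pi), ENNReal.ofReal (logDensity A B (x + y * I)) ≤
      ENNReal.ofReal R)
    (hS : ∫ y in (0 : ℝ)..2 * Real.pi, absLogQuot A B (x + y * I) ≤ S) :
    IntervalIntegrable (fun y : ℝ => Real.posLog ‖logDerivQuot A B (x + y * I)‖) volume 0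
        (2 * Real.pi) ∧
    2 * ∫ y in (0 : ℝ)..2 * Real.pi, Real.posLog ‖logDerivQuot A B (x + y * I)‖ ≤
      2 * Real.pi * Real.log (1 + R) + 3 * (2 * Real.pi * Real.log (1 + S))
        + 4 * (2 * Real.pi + 1) := by
  have hpi : (0 : ℝ) ≤ 2 * Real.pi := by positivity
  have hQm : Measurable fun y : ℝ => logDensity A B (x + y * I) :=
    (measurable_logDensity hAm hBm).comp (by fun_prop)
  have hqm : Measurable fun y : ℝ => absLogQuot A B (x + y * I) :=
    (measurable_absLogQuot hAm hBm).comp (by fun_prop)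
  have hlm : Measurable fun y : ℝ => logDerivQuot A B (x + y * I) :=
    (measurable_logDerivQuot hAm hBm).comp (by fun_prop)
  have hQi : IntegrableOn (fun y : ℝ => logDensity A B (x + y * I)) (Ioc 0 (2 * Real.pi)) := by
    refine ⟨hQm.aestronglyMeasurable, ?_⟩
    rw [hasFiniteIntegral_iff_ofReal (Eventually.of_forall fun y => logDensity_nonneg _ _ _)]
    exact hR.trans_lt ENNReal.ofReal_lt_top
  have hQI : ∫ y in (0 : ℝ)..2 * Real.pi, logDensity A B (x + y * I) ≤ R := by
    rw [intervalIntegral.integral_of_le hpi, ← ENNReal.ofReal_le_ofReal_iff hR0,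
      ofReal_integral_eq_lintegral_ofReal hQi
      (Eventually.of_forall fun y => logDensity_nonneg _ _ _)]
    exact hR
  obtain ⟨hi1, hb1⟩ := integral_log_one_add_le (fun y => logDensity_nonneg A B (x + y * I))
    hQm ((intervalIntegrable_iff_integrableOn_Ioc_of_le hpi).2 hQi) hQI
  have hqi : IntervalIntegrable (fun y : ℝ => absLogQuot A B (x + y * I)) volume 0 (2 * Real.pi) :=
    ((intervalIntegrable_log_norm_line hA hx 0 (2 * Real.pi)).sub
      (intervalIntegrable_log_norm_line hB hx 0 (2 * Real.pi))).abs
  obtain ⟨hi2, hb2⟩ := integral_log_one_add_le (fun y => absLogQuot_nonneg A B (x + y * I))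
    hqm hqi hS
  have hpt : ∀ y : ℝ, 2 * Real.posLog ‖logDerivQuot A B (x + y * I)‖ ≤
      Real.log (1 + logDensity A B (x + y * I)) + 3 * Real.log (1 + absLogQuot A B (x + y * I)) :=
    fun y => two_mul_posLog_norm_logDerivQuot_le A B (x + y * I)
  have hi3 : IntervalIntegrable (fun y : ℝ => Real.posLog ‖logDerivQuot A B (x + y * I)‖) volume 0
      (2 * Real.pi) := by
    refine (hi1.add (hi2.const_mul 3)).mono_fun ?_ (Eventually.of_forall fun y => ?_)
    · have h1 : Measurable fun y : ℝ => Real.posLog ‖logDerivQuot A B (x + y * I)‖ := by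
        unfold Real.posLog
        exact measurable_const.max (Real.measurable_log.comp hlm.norm)
      exact h1.aestronglyMeasurable
    · have h := hpt y
      have h' := Real.posLog_nonneg (x := ‖logDerivQuot A B (x + y * I)‖)
      simp only [Real.norm_of_nonneg h']
      refine le_trans ?_ (le_abs_self _)
      linarith
  refine ⟨hi3, ?_⟩
  have hmono := intervalIntegral.integral_mono_on hpi (hi3.const_mul 2)
    (hi1.add (hi2.const_mul 3)) fun y _ => hpt y
  rw [intervalIntegral.integral_const_mul, intervalIntegral.integral_add hi1 (hi2.const_mul 3),
    intervalIntegral.integral_const_mul] at hmono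
  linarith

theorem log_one_add_exp_mul_le {x Y : ℝ} (hY0 : 0 ≤ Y) :
    Real.log (1 + Real.exp x * (1 + Real.exp x * (1 + Y) ^ 2) ^ 2) ≤
      Real.log 5 + 3 * |x| + 4 * Real.log (1 + Y) := by
  have he : 1 ≤ Real.exp |x| := Real.one_le_exp (abs_nonneg x)
  have hex : Real.exp x ≤ Real.exp |x| := Real.exp_le_exp.2 (le_abs_self x)
  have hle : 1 + Real.exp x * (1 + Real.exp x * (1 + Y) ^ 2) ^ 2 ≤
      5 * (Real.exp |x| ^ 3 * (1 + Y) ^ 4) := by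
    have h1 : 1 ≤ Real.exp |x| * (1 + Y) ^ 2 :=
      one_le_mul_of_one_le_of_one_le he (one_le_pow₀ (by linarith))
    have h2 : Real.exp x * (1 + Real.exp x * (1 + Y) ^ 2) ^ 2 ≤
        Real.exp |x| * (2 * (Real.exp |x| * (1 + Y) ^ 2)) ^ 2 := by
      gcongr
      calc 1 + Real.exp x * (1 + Y) ^ 2 ≤ Real.exp |x| * (1 + Y) ^ 2
            + Real.exp |x| * (1 + Y) ^ 2 := by gcongr
        _ = _ := by ring
    have h3 : 1 ≤ Real.exp |x| ^ 3 * (1 + Y) ^ 4 :=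
      one_le_mul_of_one_le_of_one_le (one_le_pow₀ he) (one_le_pow₀ (by linarith))
    have h4 : Real.exp |x| * (2 * (Real.exp |x| * (1 + Y) ^ 2)) ^ 2 =
      4 * (Real.exp |x| ^ 3 * (1 + Y) ^ 4) := by ring
    linarith
  refine (Real.log_le_log (by positivity) hle).trans_eq ?_
  rw [Real.log_mul (by norm_num) (by positivity), Real.log_mul (by positivity) (by positivity),
    Real.log_pow, Real.log_pow, Real.log_exp]
  push_cast; ring

theorem exists_integral_posLog_logDerivQuot_le_of_measurable
    (hA : DifferentiableOn ℂ A (halfPlane a)) (hB : DifferentiableOn ℂ B (halfPlane a))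
    (hA0 : ∃ ζ ∈ halfPlane a, A ζ ≠ 0) (hB0 : ∃ ζ ∈ halfPlane a, B ζ ≠ 0)
    (hAm : Measurable A) (hBm : Measurable B)
    (hAp : Function.Periodic A (2 * Real.pi * I)) (hBp : Function.Periodic B (2 * Real.pi * I))
    {b : ℝ} (hab : a < b) :
    ∃ C E, 0 ≤ C ∧ ExpNegligible E ∧ ∀ x, b < x → x ∉ E →
      IntervalIntegrable (fun y : ℝ => Real.posLog ‖logDerivQuot A B (x + y * I)‖) volume 0
        (2 * Real.pi) ∧
      ∫ y in (0 : ℝ)..2 * Real.pi, Real.posLog ‖logDerivQuot A B (x + y * I)‖ ≤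
        C * (1 + |x| + Real.log (1 + max (charInt A B x) 0)) := by
  obtain ⟨C1, E, hC1, hE, h1⟩ :=
    exists_lintegral_logDensity_le_ofReal hA hB hA0 hB0 hAm hBm hAp hBp hab
  obtain ⟨CA, hCA, hlA⟩ := exists_le_integral_log_norm hA hA0 hAp hab
  obtain ⟨CB, hCB, hlB⟩ := exists_le_integral_log_norm hB hB0 hBp hab
  set c1 := Real.log ((C1 + 1) * (1 + |b|)) with hc1
  -- The `2` comes from `2 max u v`; `CA` and `CB` come from the linear lower bounds for `log |A|`
  -- and `log |B|`.
  set C2 := 2 + CA + CB with hC2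
  set c2 := Real.log ((C2 + 1) * (1 + |b|)) with hc2
  have hc1n : 0 ≤ c1 := Real.log_nonneg (one_le_mul_of_one_le_of_one_le (by linarith)
    (by linarith [abs_nonneg b]))
  have hc2n : 0 ≤ c2 := Real.log_nonneg (one_le_mul_of_one_le_of_one_le (by linarith)
    (by linarith [abs_nonneg b]))
  have hl5 : 0 ≤ Real.log 5 := Real.log_nonneg (by norm_num)
  refine ⟨2 * Real.pi * ((Real.log 5 + 4 * c1 + 7) + 3 * (c2 + 1)) + 4 * (2 * Real.pi + 1), E,
    by positivity, hE, fun x hx hxE => ?_⟩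
  set τ := max (charInt A B x) 0 with hτ
  have hτ0 : 0 ≤ τ := le_max_right _ _
  have hxb : 0 ≤ x - b := by linarith
  have hY0 : 0 ≤ C1 * (τ + (x - b) + 1) := by positivity
  have hS : ∫ y in (0 : ℝ)..2 * Real.pi, absLogQuot A B (x + y * I) ≤
      C2 * (τ + (x - b) + 1) := by
    rw [integral_absLogQuot_eq hA hB (hab.trans hx)]
    have h2 := hlA x hx.le
    have h3 := hlB x hx.le
    have h4 : charInt A B x ≤ τ := le_max_left _ _
    have h5 := mul_nonneg hCA hτ0
    have h6 := mul_nonneg hCB hτ0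
    rw [hC2]
    linarith
  obtain ⟨hi, hmain⟩ := integral_posLog_logDerivQuot_le hA hB hAm hBm (hab.trans hx)
    (by positivity) (h1 x hx hxE) hS
  refine ⟨hi, ?_⟩
  have hlogY := log_one_add_le_of_le (b := b) (x := x) hC1 hτ0 hY0 le_rfl
  have hlogq := log_one_add_le_of_le (C := C2) (b := b) (x := x) (by positivity) hτ0
    (by positivity) le_rfl
  have hlogR := log_one_add_exp_mul_le (x := x) hY0
  have hA3 : 0 ≤ ∫ y in (0 : ℝ)..2 * Real.pi, Real.posLog ‖logDerivQuot A B (x + y * I)‖ :=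
    intervalIntegral.integral_nonneg (by positivity) fun y _ => Real.posLog_nonneg
  set lt := Real.log (1 + τ) with hlt
  have hlt0 : 0 ≤ lt := Real.log_nonneg (by linarith)
  have hxn := abs_nonneg x
  set Z := 1 + |x| + lt with hZdef
  have hZ : 1 ≤ Z := by linarith
  have hk : ∀ {c : ℝ}, 0 ≤ c → c ≤ c * Z := fun hc => le_mul_of_one_le_right hc hZ
  set lR := Real.log (1 + Real.exp x * (1 + Real.exp x * (1 + C1 * (τ + (x - b) + 1)) ^ 2) ^ 2)
  set lS := Real.log (1 + C2 * (τ + (x - b) + 1))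
  set lY := Real.log (1 + C1 * (τ + (x - b) + 1))
  have hA1 : lR ≤ (Real.log 5 + 4 * c1 + 7) * Z := by
    have := hk hl5
    have := hk hc1n
    linarith
  have hA2 : lS ≤ (c2 + 1) * Z := by
    have := hk hc2n
    linarith
  have hpi : (0 : ℝ) ≤ 2 * Real.pi := by positivity
  have hA4 := mul_le_mul_of_nonneg_left hA1 hpi
  have hA5 := mul_le_mul_of_nonneg_left hA2 hpi
  have hA6 : 4 * (2 * Real.pi + 1) ≤ 4 * (2 * Real.pi + 1) * Z := hk (by positivity)
  linarith

/-- **Lemma on the logarithmic derivative** for quotients of holomorphic functions in a half-plane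
with period `2πi`. -/
theorem exists_integral_posLog_logDerivQuot_le
    (hA : DifferentiableOn ℂ A (halfPlane a)) (hB : DifferentiableOn ℂ B (halfPlane a))
    (hA0 : ∃ ζ ∈ halfPlane a, A ζ ≠ 0) (hB0 : ∃ ζ ∈ halfPlane a, B ζ ≠ 0)
    (hAp : Function.Periodic A (2 * Real.pi * I)) (hBp : Function.Periodic B (2 * Real.pi * I))
    {b : ℝ} (hab : a < b) :
    ∃ C E, 0 ≤ C ∧ ExpNegligible E ∧ ∀ x, b < x → x ∉ E →
      IntervalIntegrable (fun y : ℝ => Real.posLog ‖logDerivQuot A B (x + y * I)‖) volume 0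
        (2 * Real.pi) ∧
      ∫ y in (0 : ℝ)..2 * Real.pi, Real.posLog ‖logDerivQuot A B (x + y * I)‖ ≤
        C * (1 + |x| + Real.log (1 + max (charInt A B x) 0)) := by
  classical
  have hmem : ∀ ζ, ζ + 2 * Real.pi * I ∈ halfPlane a ↔ ζ ∈ halfPlane a := fun ζ => by
    simp [halfPlane]
  have hext : ∀ F : ℂ → ℂ, DifferentiableOn ℂ F (halfPlane a) →
      (∃ ζ ∈ halfPlane a, F ζ ≠ 0) → Function.Periodic F (2 * Real.pi * I) →
      ∃ G, EqOn G F (halfPlane a) ∧ DifferentiableOn ℂ G (halfPlane a) ∧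
        (∃ ζ ∈ halfPlane a, G ζ ≠ 0) ∧ Measurable G ∧ Function.Periodic G (2 * Real.pi * I) := by
    intro F hF hF0 hFp
    -- Extension by zero off the half-plane makes the function measurable. The period is kept
    -- because translation by `2πi` preserves the half-plane, and derivatives inside are unchanged
    -- because the half-plane is open.
    have heq : EqOn ((halfPlane a).indicator F) F (halfPlane a) := fun ζ hζ =>
      indicator_of_mem hζ F
    refine ⟨(halfPlane a).indicator F, heq, hF.congr heq, ?_, ?_, fun ζ => ?_⟩
    · obtain ⟨ζ, hζ, hζ0⟩ := hF0
      exact ⟨ζ, hζ, by rwa [heq hζ]⟩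
    · rw [← piecewise_eq_indicator]
      exact hF.continuousOn.measurable_piecewise continuousOn_const
        (isOpen_halfPlane a).measurableSet
    · simp only [indicator, hmem, hFp ζ]
  obtain ⟨A', hAe, hA'd, hA'0, hA'm, hA'p⟩ := hext A hA hA0 hAp
  obtain ⟨B', hBe, hB'd, hB'0, hB'm, hB'p⟩ := hext B hB hB0 hBp
  obtain ⟨C, E, hC, hE, h⟩ := exists_integral_posLog_logDerivQuot_le_of_measurable hA'd hB'd
    hA'0 hB'0 hA'm hB'm hA'p hB'p hab
  refine ⟨C, E, hC, hE, fun x hx hxE => ?_⟩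
  have hxm : ∀ y : ℝ, (x : ℂ) + y * I ∈ halfPlane a := fun y =>
    ofReal_add_mul_I_mem_halfPlane.2 (hab.trans hx)
  have h1 : ∀ y : ℝ, logDerivQuot A' B' (x + y * I) = logDerivQuot A B (x + y * I) := fun y => by
    have hn := (isOpen_halfPlane a).mem_nhds (hxm y)
    rw [logDerivQuot, logDerivQuot, hAe (hxm y), hBe (hxm y),
      (hAe.eventuallyEq_of_mem hn).deriv_eq, (hBe.eventuallyEq_of_mem hn).deriv_eq]
  have h2 : charInt A' B' x = charInt A B x := by
    refine intervalIntegral.integral_congr fun y _ => ?_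
    simp only [hAe (hxm y), hBe (hxm y)]
  simpa only [h1, h2] using h x hx hxE

end LogDeriv

/-! ### Cauchy's theorem for a disc with round holes, by smooth cutoffs. -/

/-- A smooth function of `u`, equal to `0` for `u ≤ s²` and to `1` for `t² ≤ u`. -/
noncomputable def radialStep (s t u : ℝ) : ℝ := Real.smoothTransition ((u - s ^ 2) / (t ^ 2 - s ^ 2))

section RadialStep

variable {s t : ℝ}

theorem contDiff_radialStep {n : ℕ∞} : ContDiff ℝ n (radialStep s t) :=
  Real.smoothTransition.contDiff.comp ((contDiff_id.sub contDiff_const).div_const _)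

theorem sq_lt_sq_of_nonneg (hs : 0 ≤ s) (hst : s < t) : s ^ 2 < t ^ 2 :=
  pow_lt_pow_left₀ hst hs two_ne_zero

theorem radialStep_of_le (hs : 0 ≤ s) (hst : s < t) {u : ℝ} (hu : u ≤ s ^ 2) :
    radialStep s t u = 0 :=
  Real.smoothTransition.zero_of_nonpos (div_nonpos_of_nonpos_of_nonneg (by linarith)
    (by linarith [sq_lt_sq_of_nonneg hs hst]))

theorem radialStep_of_ge (hs : 0 ≤ s) (hst : s < t) {u : ℝ} (hu : t ^ 2 ≤ u) :
    radialStep s t u = 1 :=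
  Real.smoothTransition.one_of_one_le (by
    rw [one_le_div (by linarith [sq_lt_sq_of_nonneg hs hst])]; linarith)

theorem deriv_radialStep_of_lt (hs : 0 ≤ s) (hst : s < t) {u : ℝ} (hu : u < s ^ 2) :
    deriv (radialStep s t) u = 0 := by
  have h : radialStep s t =ᶠ[𝓝 u] fun _ => 0 := by
    filter_upwards [Iio_mem_nhds hu] with v hv using radialStep_of_le hs hst (le_of_lt hv)
  rw [h.deriv_eq, deriv_const]

theorem deriv_radialStep_of_gt (hs : 0 ≤ s) (hst : s < t) {u : ℝ} (hu : t ^ 2 < u) :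
    deriv (radialStep s t) u = 0 := by
  have h : radialStep s t =ᶠ[𝓝 u] fun _ => 1 := by
    filter_upwards [Ioi_mem_nhds hu] with v hv using radialStep_of_ge hs hst (le_of_lt hv)
  rw [h.deriv_eq, deriv_const]

theorem continuous_deriv_radialStep : Continuous (deriv (radialStep s t)) :=
  (contDiff_radialStep (n := 1)).continuous_deriv le_rfl

/-- `h · (∂ₓ + i ∂_y)` of the radial step function around `c`. -/
noncomputable def annulusKernel (s t : ℝ) (c : ℂ) (h : ℂ → ℂ) (z : ℂ) : ℂ :=
  ((2 * deriv (radialStep s t) (‖z - c‖ ^ 2) : ℝ) : ℂ) * ((z - c) * h z)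

theorem annulusKernel_eq_zero (hs : 0 ≤ s) (hst : s < t) {c z : ℂ} {h : ℂ → ℂ}
    (hz : z ∉ Metric.closedBall c t \ Metric.ball c s) : annulusKernel s t c h z = 0 := by
  have : deriv (radialStep s t) (‖z - c‖ ^ 2) = 0 := by
    simp only [Set.mem_sdiff, Metric.mem_closedBall, Metric.mem_ball, dist_eq_norm, not_and, not_not]
      at hz
    by_cases hzt : ‖z - c‖ ≤ t
    · exact deriv_radialStep_of_lt hs hst (pow_lt_pow_left₀ (hz hzt) (norm_nonneg _) two_ne_zero)
    · push Not at hzt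
      exact deriv_radialStep_of_gt hs hst (pow_lt_pow_left₀ hzt (hs.trans hst.le) two_ne_zero)
  simp [annulusKernel, this]

variable (hs : 0 ≤ s) (hst : s < t) {c : ℂ} {h : ℂ → ℂ} {V : Set ℂ} (hV : IsOpen V)
  (hVc : Metric.closedBall c t \ Metric.ball c s ⊆ V) (hh : ContinuousOn h V)

include hs hst hV hVc hh

theorem continuous_annulusKernel : Continuous (annulusKernel s t c h) := by
  rw [continuous_iff_continuousAt]
  intro z
  by_cases hz : z ∈ Metric.closedBall c t \ Metric.ball c s
  · have h1 := hh.continuousAt (hV.mem_nhds (hVc hz))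
    have h2 : Continuous fun z => ((2 * deriv (radialStep s t) (‖z - c‖ ^ 2) : ℝ) : ℂ) * (z - c) := by
      have := continuous_deriv_radialStep (s := s) (t := t)
      fun_prop
    have h3 := h2.continuousAt (x := z) |>.mul h1
    refine h3.congr (Eventually.of_forall fun w => ?_)
    simp only [annulusKernel, mul_assoc, Pi.mul_apply]
  · have hcl : IsClosed (Metric.closedBall c t \ Metric.ball c s) :=
      Metric.isClosed_closedBall.sdiff Metric.isOpen_ball
    have : annulusKernel s t c h =ᶠ[𝓝 z] fun _ => 0 := by
      filter_upwards [hcl.isOpen_compl.mem_nhds hz] with w hw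
        using annulusKernel_eq_zero hs hst hw
    exact continuousAt_const.congr this.symm

theorem integrable_annulusKernel : Integrable (annulusKernel s t c h) := by
  refine (continuous_annulusKernel hs hst hV hVc hh).integrable_of_hasCompactSupport ?_
  exact HasCompactSupport.intro (isCompact_closedBall c t) fun z hz =>
    annulusKernel_eq_zero hs hst fun h => hz h.1

/-- In polar coordinates the kernel is `h` times the radial derivative of the step in disguise. With
`dz = I (z - c) dθ` each circle contributes `J / I` times that derivative, and the step rises by `1`
in total. -/
theorem integral_annulusKernel {J : ℂ} (hJ : ∀ r ∈ Icc s t, (∮ z in C(c, r), h z) = J) :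
    ∫ z, annulusKernel s t c h z = J / I := by
  have hk := continuous_annulusKernel hs hst hV hVc hh
  set f : ℝ × ℝ → ℂ := fun p => (p.1 : ℂ) *
    annulusKernel s t c h (c + circleMap 0 p.1 p.2) with hf
  have hfc : Continuous f := by
    have : Continuous fun p : ℝ × ℝ => c + circleMap 0 p.1 p.2 := by
      unfold circleMap; fun_prop
    exact (by fun_prop : Continuous fun p : ℝ × ℝ => (p.1 : ℂ)).mul (hk.comp this)
  have hf0 : ∀ p : ℝ × ℝ, 0 < p.1 → p.1 ∉ Icc s t → f p = 0 := by
    intro p hp hpt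
    have : annulusKernel s t c h (c + circleMap 0 p.1 p.2) = 0 := by
      refine annulusKernel_eq_zero hs hst fun hm => hpt ?_
      simp only [Set.mem_sdiff, Metric.mem_closedBall, Metric.mem_ball, dist_eq_norm, add_sub_cancel_left,
        norm_circleMap_zero, abs_of_pos hp, not_lt] at hm
      exact ⟨hm.2, hm.1⟩
    simp [hf, this]
  have h1 : ∫ z, annulusKernel s t c h z =
      ∫ p in Ioi (0 : ℝ) ×ˢ Ioo (-Real.pi) Real.pi, f p := by
    rw [← integral_add_left_eq_self _ c, ← Complex.integral_comp_polarCoord_symm,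
      polarCoord_target]
    refine setIntegral_congr_fun (measurableSet_Ioi.prod measurableSet_Ioo) fun p _ => ?_
    simp only [hf, Complex.polarCoord_symm_apply, real_smul, circleMap, zero_add, exp_mul_I,
      ofReal_cos, ofReal_sin]
  have hfi : IntegrableOn f (Ioi (0 : ℝ) ×ˢ Ioo (-Real.pi) Real.pi) := by
    have h2 : IntegrableOn f (Icc s t ×ˢ Icc (-Real.pi) Real.pi) :=
      hfc.continuousOn.integrableOn_compact (isCompact_Icc.prod isCompact_Icc)
    refine IntegrableOn.of_forall_sdiff_eq_zero h2
      (measurableSet_Ioi.prod measurableSet_Ioo) ?_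
    rintro ⟨r, θ⟩ ⟨⟨hr, hθ⟩, hp⟩
    refine hf0 _ hr fun hrt => hp ⟨hrt, Ioo_subset_Icc_self hθ⟩
  rw [h1, Measure.volume_eq_prod, setIntegral_prod _ hfi]
  have hinner : ∀ r ∈ Ioi (0 : ℝ), ∫ θ in Ioo (-Real.pi) Real.pi, f (r, θ) =
      ((deriv (radialStep s t) (r ^ 2) * (2 * r) : ℝ) : ℂ) * (J / I) := by
    intro r hr
    by_cases hrt : r ∈ Icc s t
    · rw [← integral_Ioc_eq_integral_Ioo,
        ← intervalIntegral.integral_of_le (by linarith [Real.pi_pos])]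
      have hper : Function.Periodic (fun θ => f (r, θ)) (2 * Real.pi) := fun θ => by
        simp only [hf]
        rw [periodic_circleMap 0 r θ]
      have h3 := hper.intervalIntegral_add_eq (-Real.pi) 0
      rw [show -Real.pi + 2 * Real.pi = Real.pi by ring, zero_add] at h3
      rw [h3, ← hJ r hrt, circleIntegral, mul_div_assoc', ← intervalIntegral.integral_const_mul,
        ← intervalIntegral.integral_div]
      refine intervalIntegral.integral_congr fun θ _ => ?_
      have hcm : circleMap c r θ = c + circleMap 0 r θ := by simp [circleMap]
      simp only [hf, annulusKernel, deriv_circleMap, smul_eq_mul, add_sub_cancel_left,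
        norm_circleMap_zero, sq_abs, hcm]
      push_cast
      field_simp
    · have h4 : deriv (radialStep s t) (r ^ 2) = 0 := by
        rw [mem_Icc, not_and_or, not_le, not_le] at hrt
        rcases hrt with h | h
        · exact deriv_radialStep_of_lt hs hst (pow_lt_pow_left₀ h (le_of_lt hr) two_ne_zero)
        · exact deriv_radialStep_of_gt hs hst (pow_lt_pow_left₀ h (hs.trans hst.le) two_ne_zero)
      simp [hf0 (r, _) hr hrt, h4]
  rw [setIntegral_congr_fun measurableSet_Ioi hinner, integral_mul_const, integral_complex_ofReal]
  have hderiv : ∀ r ∈ Ici (0 : ℝ), HasDerivAt (fun r => radialStep s t (r ^ 2))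
      (deriv (radialStep s t) (r ^ 2) * (2 * r)) r := fun r _ => by
    have h5 := ((contDiff_radialStep (s := s) (t := t) (n := 1)).differentiable one_ne_zero
      (r ^ 2)).hasDerivAt
    have h6 : HasDerivAt (fun r : ℝ => r ^ 2) (2 * r) r := by simpa using hasDerivAt_pow 2 r
    exact HasDerivAt.comp (h₂ := radialStep s t) (h := fun r : ℝ => r ^ 2) r h5 h6
  have hint : IntegrableOn (fun r => deriv (radialStep s t) (r ^ 2) * (2 * r)) (Ioi 0) := by
    have hc : Continuous fun r => deriv (radialStep s t) (r ^ 2) * (2 * r) := by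
      have := continuous_deriv_radialStep (s := s) (t := t)
      fun_prop
    refine IntegrableOn.of_forall_sdiff_eq_zero (hc.integrableOn_Icc (a := s) (b := t))
      measurableSet_Ioi ?_
    rintro r ⟨hr, hrt⟩
    rw [mem_Icc, not_and_or, not_le, not_le] at hrt
    rcases hrt with h | h
    · rw [deriv_radialStep_of_lt hs hst (pow_lt_pow_left₀ h (le_of_lt hr) two_ne_zero), zero_mul]
    · rw [deriv_radialStep_of_gt hs hst (pow_lt_pow_left₀ h (hs.trans hst.le) two_ne_zero),
        zero_mul]
  have hlim : Tendsto (fun r => radialStep s t (r ^ 2)) atTop (𝓝 1) := by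
    refine tendsto_const_nhds.congr' ?_
    filter_upwards [eventually_ge_atTop t] with r hr
    exact (radialStep_of_ge hs hst (pow_le_pow_left₀ (hs.trans hst.le) hr 2)).symm
  rw [integral_Ioi_of_hasDerivAt_of_tendsto' hderiv hint hlim,
    radialStep_of_le hs hst (u := (0 : ℝ) ^ 2) (by simpa using sq_nonneg s)]
  simp

end RadialStep

theorem integral_fderiv_eq_zero {F : ℂ → ℂ} (hF : ContDiff ℝ 1 F) (hFc : HasCompactSupport F)
    (v : ℂ) : ∫ z, fderiv ℝ F z v = 0 := by
  have hc : Continuous fun z => fderiv ℝ F z v :=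
    (hF.continuous_fderiv one_ne_zero).clm_apply continuous_const
  have hi : Integrable fun z => fderiv ℝ F z v :=
    hc.integrable_of_hasCompactSupport (hFc.fderiv_apply ℝ v)
  have h := integral_mul_fderiv_eq_neg_fderiv_mul_of_integrable (μ := volume) (𝕜 := ℂ)
    (f := fun _ : ℂ => (1 : ℂ)) (g := F) (v := v) (by simp) (by simpa using hi)
    (by simpa using hF.continuous.integrable_of_hasCompactSupport hFc)
    (fun z _ => differentiableAt_const _) (fun z _ => hF.differentiable one_ne_zero z)
  simpa using h

theorem hasFDerivAt_radialStep_norm_sq (s t : ℝ) (c z : ℂ) :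
    HasFDerivAt (fun z => ((radialStep s t (‖z - c‖ ^ 2) : ℝ) : ℂ))
      (ofRealCLM.comp ((deriv (radialStep s t) (‖z - c‖ ^ 2)) • (2 • innerSL ℝ (z - c)))) z := by
  have h1 : HasFDerivAt (fun z : ℂ => ‖z - c‖ ^ 2) (2 • innerSL ℝ (z - c)) z := by
    have := ((hasFDerivAt_id z).sub_const c).norm_sq
    simpa using! this
  have h2 := ((contDiff_radialStep (s := s) (t := t) (n := 1)).differentiable one_ne_zero
    (‖z - c‖ ^ 2)).hasDerivAt.comp_hasFDerivAt z h1
  exact ofRealCLM.hasFDerivAt.comp z h2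

theorem fderiv_radialStep_one_add (s t : ℝ) (c z : ℂ) :
    fderiv ℝ (fun z => ((radialStep s t (‖z - c‖ ^ 2) : ℝ) : ℂ)) z 1 +
      I * fderiv ℝ (fun z => ((radialStep s t (‖z - c‖ ^ 2) : ℝ) : ℂ)) z I =
    ((2 * deriv (radialStep s t) (‖z - c‖ ^ 2) : ℝ) : ℂ) * (z - c) := by
  rw [(hasFDerivAt_radialStep_norm_sq s t c z).fderiv]
  apply Complex.ext <;> simp [Complex.inner] <;> ring

theorem contDiff_radialStep_norm_sq (s t : ℝ) (c : ℂ) :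
    ContDiff ℝ 1 fun z => ((radialStep s t (‖z - c‖ ^ 2) : ℝ) : ℂ) :=
  ofRealCLM.contDiff.comp ((contDiff_radialStep (n := 1)).comp
    ((contDiff_id.sub contDiff_const).norm_sq ℝ))

/-- **Cauchy's theorem** for a disc with finitely many round holes. -/
theorem circleIntegral_eq_sum_circleIntegral {ι : Type*} [Fintype ι] {c : ι → ℂ} {s t : ι → ℝ}
    {S T : ℝ} (hs : ∀ j, 0 ≤ s j) (hst : ∀ j, s j < t j) (hS : 0 ≤ S) (hST : S < T)
    (hdisj : ∀ j k, j ≠ k → Disjoint (Metric.closedBall (c j) (t j)) (Metric.closedBall (c k) (t k)))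
    (hsub : ∀ j, Metric.closedBall (c j) (t j) ⊆ Metric.closedBall 0 S)
    {h : ℂ → ℂ} {V : Set ℂ} (hV : IsOpen V) (hh : DifferentiableOn ℂ h V)
    (hVsub : Metric.closedBall 0 T \ ⋃ j, Metric.ball (c j) (s j) ⊆ V)
    {J0 : ℂ} {J : ι → ℂ} (hJ0 : ∀ r ∈ Icc S T, (∮ z in C(0, r), h z) = J0)
    (hJ : ∀ j, ∀ r ∈ Icc (s j) (t j), (∮ z in C(c j, r), h z) = J j) :
    J0 = ∑ j, J j := by
  classical
  set ψ0 : ℂ → ℂ := fun z => ((radialStep S T (‖z - 0‖ ^ 2) : ℝ) : ℂ) with hψ0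
  set ψ : ι → ℂ → ℂ := fun j z => ((radialStep (s j) (t j) (‖z - c j‖ ^ 2) : ℝ) : ℂ) with hψ
  have ht : ∀ j, 0 ≤ t j := fun j => (hs j).trans (hst j).le
  have hψ0_in : ∀ z, ‖z‖ ≤ S → ψ0 z = 0 := fun z hz => by
    simp only [hψ0, sub_zero, radialStep_of_le hS hST (pow_le_pow_left₀ (norm_nonneg z) hz 2),
      ofReal_zero]
  have hψ0_out : ∀ z, T ≤ ‖z‖ → ψ0 z = 1 := fun z hz => by
    simp only [hψ0, sub_zero, radialStep_of_ge hS hST (pow_le_pow_left₀ (hS.trans hST.le) hz 2),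
      ofReal_one]
  have hψ_in : ∀ j z, ‖z - c j‖ ≤ s j → ψ j z = 0 := fun j z hz => by
    simp only [hψ, radialStep_of_le (hs j) (hst j) (pow_le_pow_left₀ (norm_nonneg _) hz 2),
      ofReal_zero]
  have hψ_out : ∀ j z, t j ≤ ‖z - c j‖ → ψ j z = 1 := fun j z hz => by
    simp only [hψ, radialStep_of_ge (hs j) (hst j) (pow_le_pow_left₀ (ht j) hz 2), ofReal_one]
  -- A cutoff that vanishes in the holes and outside the disc of radius `T`, so `χ h` extends by
  -- zero to a compactly supported function of class `C¹`. The integral of `(∂ₓ + i ∂_y)(χ h)` is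
  -- zero, and only the derivatives of the radial steps contribute to it.
  set χ : ℂ → ℂ := fun z => (1 - ψ0 z) - ∑ j, (1 - ψ j z) with hχ
  have hχc : ContDiff ℝ 1 χ :=
    (contDiff_const.sub (contDiff_radialStep_norm_sq S T 0)).sub
      (ContDiff.sum fun j _ => contDiff_const.sub (contDiff_radialStep_norm_sq (s j) (t j) (c j)))
  have hχ_out : ∀ z, T ≤ ‖z‖ → χ z = 0 := by
    intro z hz
    have h1 : ∀ j, ψ j z = 1 := fun j => by
      refine hψ_out j z ?_
      by_contra! hlt
      have := hsub j (mem_closedBall_iff_norm.2 hlt.le)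
      rw [mem_closedBall_zero_iff] at this
      linarith
    simp [hχ, hψ0_out z hz, h1]
  have hχ_hole : ∀ j z, ‖z - c j‖ ≤ s j → χ z = 0 := by
    intro j z hz
    have hmem : z ∈ Metric.closedBall (c j) (t j) :=
      mem_closedBall_iff_norm.2 (hz.trans (hst j).le)
    have h0 : ψ0 z = 0 := hψ0_in z (mem_closedBall_zero_iff.1 (hsub j hmem))
    have h1 : ∀ k, k ≠ j → 1 - ψ k z = 0 := fun k hk => by
      rw [hψ_out k z, sub_self]
      by_contra! hlt
      exact Set.disjoint_left.1 (hdisj k j hk) (mem_closedBall_iff_norm.2 hlt.le) hmem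
    simp only [hχ]
    rw [Finset.sum_eq_single j (fun k _ hk => h1 k hk) (by simp), h0, hψ_in j z hz]
    ring
  have hχ_V : ∀ z, z ∉ V → χ =ᶠ[𝓝 z] fun _ => 0 := by
    intro z hz
    by_cases hzT : T < ‖z‖
    · filter_upwards [(isOpen_lt continuous_const continuous_norm).mem_nhds hzT] with w hw
        using hχ_out w (le_of_lt hw)
    · have : ∃ j, z ∈ Metric.ball (c j) (s j) := by
        by_contra! hno
        refine hz (hVsub ⟨mem_closedBall_zero_iff.2 (not_lt.1 hzT), ?_⟩)
        simpa using hno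
      obtain ⟨j, hj⟩ := this
      filter_upwards [Metric.isOpen_ball.mem_nhds hj] with w hw
        using hχ_hole j w (mem_ball_iff_norm.1 hw).le
  have hanV : ∀ z ∈ V, ContDiffAt ℝ 1 h z := fun z hz =>
    ((hh.analyticAt (hV.mem_nhds hz)).contDiffAt (n := 1)).restrict_scalars ℝ
  set F : ℂ → ℂ := fun z => χ z * h z with hF
  have hFc : ContDiff ℝ 1 F := by
    rw [contDiff_iff_contDiffAt]
    intro z
    by_cases hz : z ∈ V
    · exact hχc.contDiffAt.mul (hanV z hz)
    · refine (contDiffAt_const (c := (0 : ℂ))).congr_of_eventuallyEq ?_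
      filter_upwards [hχ_V z hz] with w hw
      simp [hF, hw]
  have hFsupp : HasCompactSupport F := HasCompactSupport.intro (isCompact_closedBall 0 T)
    fun z hz => by
      rw [mem_closedBall_zero_iff, not_le] at hz
      simp [hF, hχ_out z hz.le]
  have hsub0 : Metric.closedBall (0 : ℂ) T \ Metric.ball 0 S ⊆ V := by
    rintro z ⟨hz1, hz2⟩
    refine hVsub ⟨hz1, ?_⟩
    simp only [mem_iUnion, not_exists]
    intro j hj
    have hball : Metric.ball (c j) (t j) ⊆ interior (Metric.closedBall (0 : ℂ) S) :=
      interior_maximal (Metric.ball_subset_closedBall.trans (hsub j)) Metric.isOpen_ball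
    have h1 := hball (Metric.ball_subset_ball (hst j).le hj)
    rcases hS.eq_or_lt with h0 | h0
    · rw [← h0, Metric.closedBall_zero, interior_singleton] at h1
      exact h1
    · rw [interior_closedBall _ h0.ne'] at h1
      exact hz2 h1
  have hsubj : ∀ j, Metric.closedBall (c j) (t j) \ Metric.ball (c j) (s j) ⊆ V := by
    rintro j z ⟨hz1, hz2⟩
    refine hVsub ⟨Metric.closedBall_subset_closedBall hST.le (hsub j hz1), ?_⟩
    simp only [mem_iUnion, not_exists]
    intro k hk
    by_cases hkj : k = j
    · subst hkj; exact hz2 hk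
    · exact Set.disjoint_left.1 (hdisj k j hkj)
        (Metric.ball_subset_closedBall (Metric.ball_subset_ball (hst k).le hk)) hz1
  have hpt : ∀ z, fderiv ℝ F z 1 + I * fderiv ℝ F z I =
      (∑ j, annulusKernel (s j) (t j) (c j) h z) - annulusKernel S T 0 h z := by
    intro z
    by_cases hz : z ∈ V
    · have hd0 := (contDiff_radialStep_norm_sq S T 0).differentiable one_ne_zero z
      have hdj := fun j => (contDiff_radialStep_norm_sq (s j) (t j) (c j)).differentiable
        one_ne_zero z
      have hdh := (hh.differentiableAt (hV.mem_nhds hz)).hasDerivAt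
      have hfh : HasFDerivAt h ((ContinuousLinearMap.toSpanSingleton ℂ
        (deriv h z)).restrictScalars ℝ) z := hdh.hasFDerivAt.restrictScalars ℝ
      have hχ' : HasFDerivAt χ ((0 - fderiv ℝ ψ0 z) - ∑ j, (0 - fderiv ℝ (ψ j) z)) z :=
        ((hasFDerivAt_const (1 : ℂ) z).sub hd0.hasFDerivAt).sub
          (HasFDerivAt.fun_sum fun j _ => (hasFDerivAt_const (1 : ℂ) z).sub (hdj j).hasFDerivAt)
      have hF' : HasFDerivAt F _ z := hχ'.mul hfh
      rw [hF'.fderiv]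
      have e0 := fderiv_radialStep_one_add S T 0 z
      have ej := fun j => fderiv_radialStep_one_add (s j) (t j) (c j) z
      simp only [annulusKernel, ← mul_assoc, ← e0, ← ej, ← Finset.sum_mul]
      simp only [← hψ0, hψ]
      simp only [zero_sub, add_apply, smul_apply,
        ContinuousLinearMap.coe_restrictScalars', ContinuousLinearMap.toSpanSingleton_apply,
        smul_eq_mul, sub_apply, neg_apply,
        sum_apply, Finset.sum_neg_distrib, Finset.sum_add_distrib,
        ← Finset.mul_sum]
      -- The Cauchy–Riemann equations for `h`: the term containing `h'` carries the factor `1 + I² =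
      -- 0`.
      linear_combination (χ z * deriv h z) * I_mul_I
    · have h1 : F =ᶠ[𝓝 z] fun _ => 0 := by
        filter_upwards [hχ_V z hz] with w hw
        simp [hF, hw]
      rw [h1.fderiv_eq, annulusKernel_eq_zero hS hST fun hm => hz (hsub0 hm),
        Finset.sum_eq_zero fun j _ => annulusKernel_eq_zero (hs j) (hst j)
          fun hm => hz (hsubj j hm)]
      simp
  have hint : ∫ z, (fderiv ℝ F z 1 + I * fderiv ℝ F z I) = 0 := by
    have hi : ∀ v, Integrable fun z => fderiv ℝ F z v := fun v =>
      ((hFc.continuous_fderiv one_ne_zero).clm_apply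
        continuous_const).integrable_of_hasCompactSupport (hFsupp.fderiv_apply ℝ v)
    rw [integral_add (hi 1) ((hi I).const_mul I), integral_const_mul,
      integral_fderiv_eq_zero hFc hFsupp, integral_fderiv_eq_zero hFc hFsupp]
    simp
  simp only [hpt] at hint
  have hij := fun j => integrable_annulusKernel (hs j) (hst j) hV (hsubj j) hh.continuousOn
  rw [integral_sub (integrable_finsetSum _ fun j _ => hij j)
    (integrable_annulusKernel hS hST hV hsub0 hh.continuousOn),
    integral_finsetSum _ fun j _ => hij j,
    integral_annulusKernel hS hST hV hsub0 hh.continuousOn hJ0] at hint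
  simp only [fun j => integral_annulusKernel (hs j) (hst j) hV (hsubj j) hh.continuousOn (hJ j)]
    at hint
  rw [← Finset.sum_div, ← sub_div, div_eq_zero_iff] at hint
  rcases hint with h1 | h1
  · exact (sub_eq_zero.1 h1).symm
  · exact absurd h1 I_ne_zero

/-! ### Circle means of `log |g|` and Jensen's formula on the punctured plane. -/

theorem hasDerivAt_log_norm {γ : ℝ → ℂ} {γ' : ℂ} {x : ℝ} (h : HasDerivAt γ γ' x)
    (h0 : γ x ≠ 0) : HasDerivAt (fun x => Real.log ‖γ x‖) (γ' / γ x).re x := by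
  have h1 := h.norm_sq
  have h2 : ‖γ x‖ ^ 2 ≠ 0 := pow_ne_zero 2 (norm_ne_zero_iff.2 h0)
  have h3 := (h1.log h2).const_mul (1 / 2 : ℝ)
  have h4 : (fun x => Real.log ‖γ x‖) = fun x => 1 / 2 * Real.log (‖γ x‖ ^ 2) := by
    ext y; rw [Real.log_pow]; push_cast; ring
  rw [h4]
  refine h3.congr_deriv ?_
  rw [Complex.inner, div_eq_mul_inv γ', Complex.inv_def, ← mul_assoc, mul_comm _ (ofReal _),
    re_ofReal_mul, normSq_eq_norm_sq]
  field_simp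

theorem isOpen_setOf_circle_subset {V : Set ℂ} (hV : IsOpen V) (c : ℂ) :
    IsOpen {ρ : ℝ | ∀ u ∈ Metric.sphere (0 : ℂ) 1, c + ρ * u ∈ V} := by
  rw [isOpen_iff_mem_nhds]
  intro ρ hρ
  refine (isCompact_sphere (0 : ℂ) 1).eventually_forall_of_forall_eventually
    (P := fun ρ : ℝ => fun u => c + ρ * u ∈ V) fun u hu => ?_
  have hc : ContinuousAt (fun p : ℝ × ℂ => c + p.1 * p.2) (ρ, u) := by fun_prop
  exact hc.eventually (hV.mem_nhds (hρ u hu))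

/-- The derivative in `ρ` of the circle mean is `Re (J / 2πi) / ρ`, where `J` is the circle integral
of `g' / g`. Cauchy's theorem on the annulus makes `J` independent of `ρ`, so the mean is affine in
`log ρ`. -/
theorem exists_circleAverage_log_norm_sub_eq {g : ℂ → ℂ} {V : Set ℂ} {c : ℂ} {s t : ℝ}
    (hV : IsOpen V) (hg : DifferentiableOn ℂ g V) (hg0 : ∀ z ∈ V, g z ≠ 0) (hs : 0 < s)
    (hsub : Metric.closedBall c t \ Metric.ball c s ⊆ V) :
    ∃ J : ℂ, (∀ ρ ∈ Icc s t, (∮ z in C(c, ρ), deriv g z / g z) = J) ∧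
      ∀ ρ ∈ Icc s t, Real.circleAverage (fun z => Real.log ‖g z‖) c ρ -
        Real.circleAverage (fun z => Real.log ‖g z‖) c s =
          (J / (2 * Real.pi * I)).re * (Real.log ρ - Real.log s) := by
  have hdg : DifferentiableOn ℂ (deriv g) V := hg.deriv hV
  have hh : DifferentiableOn ℂ (fun z => deriv g z / g z) V := hdg.div hg hg0
  have hmem : ∀ ρ ∈ Icc s t, ∀ u ∈ Metric.sphere (0 : ℂ) 1, c + ρ * u ∈ V := by
    intro ρ hρ u hu
    have : ‖(ρ : ℂ) * u‖ = ρ := by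
      rw [norm_mul, mem_sphere_zero_iff_norm.1 hu, norm_real, mul_one, Real.norm_of_nonneg
        (hs.le.trans hρ.1)]
    refine hsub ⟨?_, ?_⟩
    · rw [mem_closedBall_iff_norm, add_sub_cancel_left, this]; exact hρ.2
    · rw [mem_ball_iff_norm, add_sub_cancel_left, this, not_lt]; exact hρ.1
  set J := ∮ z in C(c, s), deriv g z / g z
  have hJρ : ∀ ρ ∈ Icc s t, (∮ z in C(c, ρ), deriv g z / g z) = J := by
    intro ρ hρ
    have hsub' : Metric.closedBall c ρ \ Metric.ball c s ⊆ V :=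
      (sdiff_subset_sdiff_left (Metric.closedBall_subset_closedBall hρ.2)).trans hsub
    refine circleIntegral_eq_of_differentiable_on_annulus_off_countable hs hρ.1
      Set.countable_empty (hh.continuousOn.mono hsub') fun z hz => ?_
    refine hh.differentiableAt (hV.mem_nhds (hsub' ⟨Metric.ball_subset_closedBall hz.1.1, ?_⟩))
    exact fun h => hz.1.2 (Metric.ball_subset_closedBall h)
  refine ⟨J, hJρ, ?_⟩
  set O := {ρ : ℝ | ∀ u ∈ Metric.sphere (0 : ℂ) 1, c + ρ * u ∈ V} with hO
  have hOo : IsOpen O := isOpen_setOf_circle_subset hV c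
  have hexp : ∀ θ : ℝ, exp (θ * I) ∈ Metric.sphere (0 : ℂ) 1 := fun θ => by
    rw [mem_sphere_zero_iff_norm, norm_exp_ofReal_mul_I]
  have hOV : ∀ ρ ∈ O, ∀ θ : ℝ, circleMap c ρ θ ∈ V := fun ρ hρ θ => hρ _ (hexp θ)
  have hder : ∀ ρ ∈ O, HasDerivAt (fun ρ => ∫ θ in (0 : ℝ)..2 * Real.pi,
      Real.log ‖g (circleMap c ρ θ)‖) (∫ θ in (0 : ℝ)..2 * Real.pi,
        (exp (θ * I) * (deriv g (circleMap c ρ θ) / g (circleMap c ρ θ))).re) ρ := by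
    intro ρ hρ
    refine hasDerivAt_intervalIntegral_of_continuousOn
      (w := fun ρ θ => Real.log ‖g (circleMap c ρ θ)‖)
      (w' := fun ρ θ => (exp (θ * I) * (deriv g (circleMap c ρ θ) / g (circleMap c ρ θ))).re)
      hOo hρ ?_ ?_ ?_
    · intro ρ hρ θ
      have h1 : HasDerivAt (fun ρ : ℝ => circleMap c ρ θ) (exp (θ * I)) ρ := by
        have := ((hasDerivAt_id ρ).ofReal_comp.mul_const (exp (θ * I))).const_add c
        simpa [circleMap] using! this
      have h2 := (hg.differentiableAt (hV.mem_nhds (hOV ρ hρ θ))).hasDerivAt.scomp ρ h1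
      have h3 := hasDerivAt_log_norm h2 (hg0 _ (hOV ρ hρ θ))
      refine h3.congr_deriv ?_
      simp [mul_div_assoc]
    · intro ρ hρ
      refine continuous_iff_continuousAt.2 fun θ => ?_
      have h1 : ContinuousAt (fun θ => g (circleMap c ρ θ)) θ :=
        (hg.continuousOn.continuousAt (hV.mem_nhds (hOV ρ hρ θ))).comp
          (f := fun θ => circleMap c ρ θ) (continuous_circleMap c ρ).continuousAt
      exact h1.norm.log (norm_ne_zero_iff.2 (hg0 _ (hOV ρ hρ θ)))
    · refine continuous_re.comp_continuousOn (ContinuousOn.mul (by fun_prop) ?_)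
      refine hh.continuousOn.comp (f := fun p : ℝ × ℝ => circleMap c p.1 p.2) ?_
        fun p hp => hOV _ hp.1 _
      unfold circleMap
      fun_prop
  have hint : ∀ ρ ∈ Icc s t, (∫ θ in (0 : ℝ)..2 * Real.pi,
      (exp (θ * I) * (deriv g (circleMap c ρ θ) / g (circleMap c ρ θ))).re) =
      2 * Real.pi * ((J / (2 * Real.pi * I)).re / ρ) := by
    intro ρ hρ
    have hρ0 : (ρ : ℂ) ≠ 0 := ofReal_ne_zero.2 (hs.trans_le hρ.1).ne'
    have hcont : Continuous fun θ : ℝ =>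
        exp (θ * I) * (deriv g (circleMap c ρ θ) / g (circleMap c ρ θ)) :=
      Continuous.mul (by fun_prop)
        (hh.continuousOn.comp_continuous (continuous_circleMap c ρ) (hOV ρ (hmem ρ hρ)))
    have h1 : (∫ θ in (0 : ℝ)..2 * Real.pi,
        exp (θ * I) * (deriv g (circleMap c ρ θ) / g (circleMap c ρ θ))) = J / (ρ * I) := by
      rw [← hJρ ρ hρ, circleIntegral, eq_div_iff (mul_ne_zero hρ0 I_ne_zero), mul_comm,
        ← intervalIntegral.integral_const_mul]
      refine intervalIntegral.integral_congr fun θ _ => ?_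
      simp only [deriv_circleMap, circleMap, smul_eq_mul, zero_add]
      ring
    have h2 := reCLM.intervalIntegral_comp_comm (hcont.intervalIntegrable 0 (2 * Real.pi)
      (μ := volume))
    simp only [reCLM_apply] at h2
    rw [h2, h1]
    have h3 : J / (ρ * I) = ((2 * Real.pi / ρ : ℝ) : ℂ) * (J / (2 * Real.pi * I)) := by
      push_cast
      have : (Real.pi : ℂ) ≠ 0 := ofReal_ne_zero.2 Real.pi_ne_zero
      field_simp
    rw [h3, re_ofReal_mul]
    ring
  set κ := (J / (2 * Real.pi * I)).re
  have hd : ∀ ρ ∈ Icc s t, HasDerivAt (fun ρ => Real.circleAverage (fun z => Real.log ‖g z‖) c ρ -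
      κ * Real.log ρ) 0 ρ := by
    intro ρ hρ
    have hρ0 : ρ ≠ 0 := (hs.trans_le hρ.1).ne'
    have h1 := ((hder ρ (hmem ρ hρ)).const_mul (2 * Real.pi)⁻¹).sub
      ((Real.hasDerivAt_log hρ0).const_mul κ)
    rw [hint ρ hρ] at h1
    refine (h1.congr_deriv ?_).congr_of_eventuallyEq (Eventually.of_forall fun ρ => ?_)
    · have := Real.pi_ne_zero
      field_simp
      ring
    · simp [Real.circleAverage]
  intro ρ hρ
  have := constant_of_has_deriv_right_zero (fun x hx => (hd x hx).continuousAt.continuousWithinAt)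
    (fun x hx => (hd x ⟨hx.1, hx.2.le⟩).hasDerivWithinAt) ρ hρ
  linear_combination this

/-- Beyond `R` the discs of radius `1 / R` around the punctures are disjoint and lie in the disc of
radius `R`. -/
structure IsSeparatingRadius {ι : Type*} (c : ι → ℂ) (R : ℝ) : Prop where
  pos : 0 < R
  lt_norm_sub : ∀ j k, j ≠ k → 2 / R < ‖c j - c k‖
  norm_add_lt : ∀ j, ‖c j‖ + 1 / R < R

/-- The compact set `{|z| ≤ r} \ ⋃ⱼ {|z - c_j| < 1 / r}`. -/
def compactPart {ι : Type*} (c : ι → ℂ) (r : ℝ) : Set ℂ :=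
  Metric.closedBall 0 r \ ⋃ j, Metric.ball (c j) (1 / r)

/-- The sum of the circle averages over the boundary circles of `compactPart c r`. -/
noncomputable def endSum {ι : Type*} [Fintype ι] (c : ι → ℂ) (φ : ℂ → ℝ) (r : ℝ) : ℝ :=
  Real.circleAverage φ 0 r + ∑ j, Real.circleAverage φ (c j) (1 / r)

section

variable {ι : Type*} {c : ι → ℂ} {R r : ℝ}

theorem IsSeparatingRadius.mono (h : IsSeparatingRadius c R) (hr : R ≤ r) :
    IsSeparatingRadius c r where
  pos := h.pos.trans_le hr
  lt_norm_sub j k hjk :=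
    (div_le_div_of_nonneg_left zero_le_two h.pos hr).trans_lt (h.lt_norm_sub j k hjk)
  norm_add_lt j := by
    have := h.norm_add_lt j
    have := div_le_div_of_nonneg_left zero_le_one h.pos hr
    linarith

theorem IsSeparatingRadius.disjoint_closedBall (h : IsSeparatingRadius c R) {s : ℝ}
    (hs : s ≤ 1 / R) {j k : ι} (hjk : j ≠ k) :
    Disjoint (Metric.closedBall (c j) s) (Metric.closedBall (c k) s) := by
  refine Metric.closedBall_disjoint_closedBall ?_
  rw [dist_eq_norm]
  have := h.lt_norm_sub j k hjk
  have h2 : 2 / R = 1 / R + 1 / R := by ring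
  linarith

theorem IsSeparatingRadius.closedBall_subset (h : IsSeparatingRadius c R) (j : ι) :
    Metric.closedBall (c j) (1 / R) ⊆ Metric.closedBall 0 R := by
  refine Metric.closedBall_subset_closedBall' ?_
  rw [dist_zero_right]
  linarith [h.norm_add_lt j]

theorem IsSeparatingRadius.sphere_zero_subset (h : IsSeparatingRadius c R) (hr : R ≤ r) :
    Metric.sphere 0 R ⊆ compactPart c r := by
  intro z hz
  rw [mem_sphere_zero_iff_norm] at hz
  refine ⟨mem_closedBall_zero_iff.2 (hz.le.trans hr), ?_⟩
  simp only [mem_iUnion, not_exists, mem_ball_iff_norm, not_lt]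
  intro j
  have h1 := h.norm_add_lt j
  have h2 := norm_sub_norm_le z (c j)
  have := div_le_div_of_nonneg_left zero_le_one h.pos hr
  linarith

theorem IsSeparatingRadius.sphere_subset (h : IsSeparatingRadius c R) (hr : R ≤ r) (j : ι) :
    Metric.sphere (c j) (1 / R) ⊆ compactPart c r := by
  intro z hz
  refine ⟨Metric.closedBall_subset_closedBall hr (h.closedBall_subset j
    (Metric.sphere_subset_closedBall hz)), ?_⟩
  simp only [mem_iUnion, not_exists, mem_ball_iff_norm, not_lt]
  intro k
  have h3 := div_le_div_of_nonneg_left zero_le_one h.pos hr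
  rw [mem_sphere_iff_norm] at hz
  by_cases hjk : j = k
  · subst hjk; linarith
  · have h1 := h.lt_norm_sub j k hjk
    have h2 : 2 / R = 1 / R + 1 / R := by ring
    have h4 : ‖c j - c k‖ ≤ ‖z - c k‖ + ‖z - c j‖ := by
      rw [← norm_neg (z - c j), neg_sub]
      simpa using norm_add_le (c j - z) (z - c k) |>.trans_eq (add_comm _ _)
    linarith

theorem isCompact_compactPart : IsCompact (compactPart c r) :=
  (isCompact_closedBall 0 r).diff (isOpen_iUnion fun _ => Metric.isOpen_ball)

theorem compactPart_mono (hR : 0 < R) (hr : R ≤ r) : compactPart c R ⊆ compactPart c r :=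
  sdiff_subset_sdiff (Metric.closedBall_subset_closedBall hr) (iUnion_mono fun _ =>
    Metric.ball_subset_ball (div_le_div_of_nonneg_left zero_le_one hR hr))

theorem compactPart_subset_compl_range (hr : 0 < r) : compactPart c r ⊆ (range c)ᶜ := by
  rintro z ⟨-, hz⟩ ⟨j, rfl⟩
  exact hz (mem_iUnion.2 ⟨j, Metric.mem_ball_self (by positivity)⟩)

end

section

variable {ι : Type*} {c : ι → ℂ} {R r : ℝ} {a : ℂ}

/-- The smallest `t` with `a ∈ compactPart c t`. -/
noncomputable def exhaustionRadius (c : ι → ℂ) (a : ℂ) : ℝ := max ‖a‖ (⨆ j, 1 / ‖a - c j‖)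

theorem exhaustionRadius_le_iff [Finite ι] (hr : 0 ≤ r) :
    exhaustionRadius c a ≤ r ↔ ‖a‖ ≤ r ∧ ∀ j, 1 / ‖a - c j‖ ≤ r := by
  rw [exhaustionRadius, max_le_iff]
  refine and_congr_right fun _ => ⟨fun h j => ?_, fun h => Real.iSup_le h hr⟩
  exact (le_ciSup (f := fun j => 1 / ‖a - c j‖) (Set.finite_range _).bddAbove j).trans h

/-- Punctures must be excluded: there `1 / ‖a - c j‖` is `0` by convention, and `exhaustionRadius`
would be finite although the point lies in a hole. -/
theorem mem_compactPart_iff [Finite ι] (hr : 0 < r) (ha : a ∉ range c) :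
    a ∈ compactPart c r ↔ exhaustionRadius c a ≤ r := by
  rw [exhaustionRadius_le_iff hr.le, compactPart, Set.mem_sdiff, mem_closedBall_zero_iff]
  refine and_congr_right fun _ => ?_
  simp only [mem_iUnion, not_exists, mem_ball_iff_norm, not_lt]
  refine forall_congr' fun j => ?_
  have : 0 < ‖a - c j‖ := norm_pos_iff.2 (sub_ne_zero.2 fun h => ha ⟨j, h.symm⟩)
  exact div_le_comm₀ hr this

theorem circleAverage_log_norm_sub_eq_log_max {x : ℂ} {ρ : ℝ} (hρ : 0 < ρ) :
    Real.circleAverage (fun z => Real.log ‖z - a‖) x ρ = Real.log (max ρ ‖a - x‖) := by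
  rw [circleAverage_log_norm_sub_const_eq_log_radius_add_posLog hρ.ne', norm_sub_rev]
  rcases le_total ‖a - x‖ ρ with h | h
  · rw [max_eq_left h, (Real.posLog_eq_zero_iff _).2, add_zero]
    rw [abs_of_nonneg (by positivity)]
    exact inv_mul_le_one_of_le₀ h hρ.le
  · have h0 : 0 < ‖a - x‖ := hρ.trans_le h
    rw [max_eq_right h, Real.posLog_eq_log, Real.log_mul (inv_ne_zero hρ.ne') h0.ne', Real.log_inv]
    · ring
    · rw [abs_of_nonneg (by positivity), ← div_eq_inv_mul, le_div_iff₀ hρ]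
      linarith

/-- Each mean is the logarithm of a maximum. By separation `a` lies in at most one hole, and then
within the disc of radius `r`; in that case the mean around `c j` is too large by `log (1 / ‖a - c
j‖) - log r`, exactly what the first term records. A linear factor thus contributes a constant until
`r` reaches `exhaustionRadius c a`, and grows like `log r` afterwards. -/
theorem endSum_log_norm_sub [Fintype ι] (h : IsSeparatingRadius c r) (ha : a ∉ range c) :
    endSum c (fun z => Real.log ‖z - a‖) r =
      Real.log (max r (exhaustionRadius c a)) + ∑ j, Real.log ‖a - c j‖ := by
  classical
  have hr := h.pos
  have h1r : 0 < 1 / r := by positivity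
  have hx : ∀ j, 0 < ‖a - c j‖ := fun j => norm_pos_iff.2 (sub_ne_zero.2 fun h => ha ⟨j, h.symm⟩)
  rw [endSum, circleAverage_log_norm_sub_eq_log_max hr, sub_zero]
  simp only [circleAverage_log_norm_sub_eq_log_max h1r]
  by_cases hj : ∃ j, ‖a - c j‖ < 1 / r
  · obtain ⟨j, hj⟩ := hj
    have hk : ∀ k, k ≠ j → 1 / r ≤ ‖a - c k‖ := by
      intro k hkj
      have h1 := h.lt_norm_sub j k (Ne.symm hkj)
      have h2 : 2 / r = 1 / r + 1 / r := by ring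
      have h3 : ‖c j - c k‖ ≤ ‖a - c k‖ + ‖a - c j‖ := by
        rw [← norm_neg (a - c j), neg_sub]
        simpa using (norm_add_le (c j - a) (a - c k)).trans_eq (add_comm _ _)
      linarith
    have har : ‖a‖ ≤ r := by
      have h1 := h.norm_add_lt j
      have h2 := norm_sub_norm_le a (c j)
      linarith
    have hrj : r ≤ 1 / ‖a - c j‖ := by
      rw [le_div_comm₀ hr (hx j)]; exact hj.le
    have hτ : exhaustionRadius c a = 1 / ‖a - c j‖ := by
      refine le_antisymm ?_ ?_
      · rw [exhaustionRadius_le_iff (by positivity)]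
        refine ⟨har.trans hrj, fun k => ?_⟩
        by_cases hkj : k = j
        · rw [hkj]
        · exact (div_le_of_le_mul₀ (hx k).le hr.le
            (by have := hk k hkj; rwa [div_le_iff₀' hr] at this)).trans hrj
      · exact ((exhaustionRadius_le_iff ((norm_nonneg a).trans (le_max_left _ _))).1 le_rfl).2 j
    rw [hτ, max_eq_left har, max_eq_right hrj,
      ← Finset.add_sum_erase _ _ (Finset.mem_univ j), ← Finset.add_sum_erase _ _ (Finset.mem_univ j),
      max_eq_left hj.le, Real.log_div one_ne_zero hr.ne', Real.log_div one_ne_zero (hx j).ne',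
      Real.log_one]
    rw [Finset.sum_congr rfl fun k hk' => by rw [max_eq_right (hk k (Finset.ne_of_mem_erase hk'))]]
    ring
  · push Not at hj
    congr 1
    · congr 1
      refine le_antisymm (max_le_max le_rfl (le_max_left _ _)) (max_le (le_max_left _ _) ?_)
      refine max_le (le_max_right _ _) ((Real.iSup_le (fun j => ?_) hr.le).trans (le_max_left _ _))
      rw [div_le_comm₀ (hx j) hr]
      exact hj j
    · exact Finset.sum_congr rfl fun j _ => by rw [max_eq_right (hj j)]

/-- Every mean is affine in `log r` with slope a period of `g' / g`, taken with opposite sign at the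
punctures because the radius there is `1 / r`. Cauchy's theorem equates the outer period with the
sum of the inner ones, so the growth cancels. -/
theorem endSum_log_norm_eq_of_ne_zero [Fintype ι] (hR : IsSeparatingRadius c R) (hr : R ≤ r)
    {g : ℂ → ℂ} (hg : AnalyticOnNhd ℂ g (compactPart c r)) (hg0 : ∀ z ∈ compactPart c r, g z ≠ 0) :
    endSum c (fun z => Real.log ‖g z‖) r = endSum c (fun z => Real.log ‖g z‖) R := by
  rcases hr.eq_or_lt with rfl | hlt
  · rfl
  have hR0 := hR.pos
  have hr0 : 0 < r := hR0.trans hlt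
  set V := {z | AnalyticAt ℂ g z ∧ g z ≠ 0}
  have hV : IsOpen V := by
    rw [isOpen_iff_mem_nhds]
    rintro z ⟨h1, h2⟩
    filter_upwards [(isOpen_analyticAt ℂ g).mem_nhds h1, h1.continuousAt.eventually_ne h2]
      with w hw1 hw2 using ⟨hw1, hw2⟩
  have hsub : compactPart c r ⊆ V := fun z hz => ⟨hg z hz, hg0 z hz⟩
  have hgV : DifferentiableOn ℂ g V := fun z hz => hz.1.differentiableAt.differentiableWithinAt
  have h1 : 1 / r < 1 / R := one_div_lt_one_div_of_lt hR0 hlt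
  have hsub0 : Metric.closedBall (0 : ℂ) r \ Metric.ball 0 R ⊆ V := by
    rintro z ⟨hz1, hz2⟩
    rw [mem_closedBall_zero_iff] at hz1
    rw [mem_ball_zero_iff, not_lt] at hz2
    have h2 := (hR.mono hz2).sphere_zero_subset hz1
    exact hsub (h2 (mem_sphere_zero_iff_norm.2 rfl))
  have hsubj : ∀ j, Metric.closedBall (c j) (1 / R) \ Metric.ball (c j) (1 / r) ⊆ V := by
    rintro j z ⟨hz1, hz2⟩
    rw [mem_closedBall_iff_norm] at hz1
    rw [mem_ball_iff_norm, not_lt] at hz2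
    have hz0 : 0 < ‖z - c j‖ := (by positivity : 0 < 1 / r).trans_le hz2
    have h2 := (hR.mono ((le_div_comm₀ hR0 hz0).2 hz1)).sphere_subset
      ((div_le_comm₀ hz0 hr0).2 hz2) j
    refine hsub (h2 (mem_sphere_iff_norm.2 ?_))
    rw [one_div_one_div]
  obtain ⟨J0, hJ0, hJ0'⟩ := exists_circleAverage_log_norm_sub_eq hV hgV (fun z hz => hz.2) hR0 hsub0
  choose J hJ hJ' using fun j => exists_circleAverage_log_norm_sub_eq hV hgV (fun z hz => hz.2)
    (by positivity) (hsubj j)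
  have hcauchy := circleIntegral_eq_sum_circleIntegral (fun _ => by positivity) (fun _ => h1)
    hR0.le hlt (fun j k hjk => hR.disjoint_closedBall le_rfl hjk) hR.closedBall_subset hV
    ((hgV.deriv hV).div hgV fun z hz => hz.2) hsub hJ0 hJ
  have e0 := hJ0' r ⟨hlt.le, le_rfl⟩
  have ej := fun j => hJ' j (1 / R) ⟨h1.le, le_rfl⟩
  have es := Finset.sum_congr rfl fun j (_ : j ∈ Finset.univ) => ej j
  rw [Finset.sum_sub_distrib, ← Finset.sum_mul, ← re_sum, ← Finset.sum_div, ← hcauchy,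
    Real.log_div one_ne_zero hR0.ne', Real.log_div one_ne_zero hr0.ne'] at es
  rw [endSum, endSum]
  linear_combination e0 - es

/-- **Jensen's formula** on the punctured plane. -/
theorem endSum_log_norm_sub_endSum [Fintype ι] (hR : IsSeparatingRadius c R) (hr : R ≤ r)
    {F : ℂ → ℂ} (hF : AnalyticOnNhd ℂ F (compactPart c r))
    (hF0 : ∀ z ∈ compactPart c r, analyticOrderAt F z ≠ ⊤) {Z : Finset ℂ}
    (hZ : (Z : Set ℂ) ⊆ compactPart c r) (hZF : ∀ z ∈ compactPart c r, F z = 0 → z ∈ Z) :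
    endSum c (fun z => Real.log ‖F z‖) r - endSum c (fun z => Real.log ‖F z‖) R =
      ∑ a ∈ Z, (analyticOrderNatAt F a : ℝ) *
        (Real.log r - Real.log (max R (exhaustionRadius c a))) := by
  have hR0 := hR.pos
  have hr0 : 0 < r := hR0.trans_le hr
  set U := compactPart c r with hU
  set D := MeromorphicOn.divisor F U with hD
  have hDZ : ∀ u, u ∉ Z → D u = 0 := by
    intro u hu
    by_cases huU : u ∈ U
    · rw [hD, MeromorphicOn.AnalyticOnNhd.divisor_apply hF huU]
      have : F u ≠ 0 := fun h => hu (hZF u huU h)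
      simp [(hF u huU).analyticOrderAt_eq_zero.2 this]
    · exact Function.locallyFinsuppWithin.apply_eq_zero_of_notMem D huU
  have hDord : ∀ u ∈ Z, (D u : ℝ) = analyticOrderNatAt F u := by
    intro u hu
    rw [hD, MeromorphicOn.AnalyticOnNhd.divisor_apply hF (hZ hu),
      ← Nat.cast_analyticOrderNatAt (hF0 u (hZ hu)), ENat.map_natCast]
    simp
  have hmer : MeromorphicOn F U := fun z hz => (hF z hz).meromorphicAt
  -- `F` is a product of powers `(z - u)^(D u)` and a zero-free `g`, off a discrete exceptional set
  -- which the circle averages do not see. The factor `g` contributes nothing to the difference.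
  obtain ⟨g, hg, hg0, hFg⟩ := hmer.extract_zeros_poles (fun u => by
      rw [(hF u u.2).meromorphicOrderAt_eq]
      simpa using hF0 u u.2)
    (Z.finite_toSet.subset fun u hu => by
      by_contra h
      exact hu (hDZ u h))
  have hlog := MeromorphicOn.extract_zeros_poles_log hg0 hFg
  have hsum : (∑ᶠ u, fun z : ℂ => ((D u : ℤ) : ℝ) * Real.log ‖z - u‖) =
      ∑ u ∈ Z, fun z : ℂ => ((D u : ℤ) : ℝ) * Real.log ‖z - u‖ := by
    refine finsum_eq_sum_of_support_subset _ fun u hu => ?_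
    by_contra h
    refine hu ?_
    ext z
    simp [hDZ u h]
  rw [← hD, hsum] at hlog
  have key : ∀ x : ℂ, ∀ ρ : ℝ, 0 < ρ → Metric.sphere x ρ ⊆ U →
      Real.circleAverage (fun z => Real.log ‖F z‖) x ρ =
        ∑ u ∈ Z, (D u : ℝ) * Real.circleAverage (fun z => Real.log ‖z - u‖) x ρ +
          Real.circleAverage (fun z => Real.log ‖g z‖) x ρ := by
    intro x ρ hρ hs
    rw [← abs_of_pos hρ] at hs
    rw [Real.circleAverage_congr_codiscreteWithin (hlog.filter_mono
      (Filter.codiscreteWithin_mono hs)) hρ.ne']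
    have hi : ∀ u, CircleIntegrable (fun z => Real.log ‖z - u‖) x ρ := fun u =>
      MeromorphicOn.circleIntegrable_log_norm (f := fun z => z - u)
        fun z _ => (by fun_prop : AnalyticAt ℂ (fun z => z - u) z).meromorphicAt
    have hig : CircleIntegrable (fun z => Real.log ‖g z‖) x ρ :=
      MeromorphicOn.circleIntegrable_log_norm fun z hz => (hg z (hs hz)).meromorphicAt
    have hi' : ∀ u ∈ Z, CircleIntegrable (fun z => (D u : ℝ) * Real.log ‖z - u‖) x ρ :=
      fun u _ => (hi u).const_fun_smul (a := (D u : ℝ))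
    rw [Real.circleAverage_add (CircleIntegrable.sum Z hi') hig, Real.circleAverage_sum hi']
    congr 1
    exact Finset.sum_congr rfl fun u _ => Real.circleAverage_fun_smul (a := (D u : ℝ))
  have key' : ∀ ρ, R ≤ ρ → ρ ≤ r → endSum c (fun z => Real.log ‖F z‖) ρ =
      ∑ u ∈ Z, (D u : ℝ) * endSum c (fun z => Real.log ‖z - u‖) ρ +
        endSum c (fun z => Real.log ‖g z‖) ρ := by
    intro ρ h1 h2
    have hs := hR.mono h1
    have hρ := hs.pos
    simp only [endSum]
    rw [key 0 ρ hρ (hs.sphere_zero_subset h2), Finset.sum_congr rfl fun j _ =>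
      key (c j) (1 / ρ) (by positivity) (hs.sphere_subset h2 j), Finset.sum_add_distrib,
      Finset.sum_comm]
    simp only [mul_add, Finset.sum_add_distrib, Finset.mul_sum]
    ring
  rw [key' r hr le_rfl, key' R le_rfl hr, endSum_log_norm_eq_of_ne_zero hR hr hg
    fun z hz => hg0 ⟨z, hz⟩, add_sub_add_right_eq_sub, ← Finset.sum_sub_distrib]
  refine Finset.sum_congr rfl fun u hu => ?_
  have hu' : u ∉ range c := compactPart_subset_compl_range hr0 (hZ hu)
  -- The sum of the `log ‖u - c j‖` is the same at both radii and cancels.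
  rw [endSum_log_norm_sub (hR.mono hr) hu', endSum_log_norm_sub hR hu', hDord u hu,
    max_eq_left ((mem_compactPart_iff hr0 hu').1 (hZ hu))]
  ring

end

/-! ### The radius `r0` and the counting function as a sum over zeros. -/

section

variable {M : ℕ} {c : Fin M → ℂ}

theorem isOpen_Omega : IsOpen (Omega c) := (Set.finite_range c).isClosed.isOpen_compl

theorem isPreconnected_Omega : IsPreconnected (Omega c) :=
  ((Set.finite_range c).countable.isConnected_compl_of_one_lt_rank
    (by simp [rank_real_complex])).isPreconnected

/-- With `m = max ‖c j‖`, two distinct centres give `0 < d ≤ (‖c j‖ + ‖c k‖) / 2 ≤ m`. Then `r0 = 1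
/ d + m` exceeds both `1 / d` and `d`, that is, `1 / r0 < d` and `1 / r0 < 1 / d`; these are the two
separation conditions. -/
theorem isSeparatingRadius_r0 (hM : 2 ≤ M) (hc : Function.Injective c) :
    IsSeparatingRadius c (r0 c) := by
  have : Nonempty (Fin M) := ⟨⟨0, by omega⟩⟩
  set i0 : Fin M := ⟨0, by omega⟩
  set i1 : Fin M := ⟨1, by omega⟩
  have h01 : i0 ≠ i1 := by simp [i0, i1]
  have : Nonempty {p : Fin M × Fin M // p.1 ≠ p.2} := ⟨⟨(i0, i1), h01⟩⟩
  have hle : ∀ j k, j ≠ k → halfMinDist c ≤ ‖c j - c k‖ / 2 := by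
    intro j k hjk
    have := ciInf_le (f := fun p : {p : Fin M × Fin M // p.1 ≠ p.2} => ‖c p.1.1 - c p.1.2‖)
      (Set.finite_range _).bddBelow ⟨(j, k), hjk⟩
    rw [halfMinDist]
    linarith
  have hd : 0 < halfMinDist c := by
    obtain ⟨p, hp⟩ := exists_eq_ciInf_of_finite
      (f := fun p : {p : Fin M × Fin M // p.1 ≠ p.2} => ‖c p.1.1 - c p.1.2‖)
    rw [halfMinDist, ← hp]
    have : 0 < ‖c p.1.1 - c p.1.2‖ := norm_pos_iff.2 (sub_ne_zero.2 (hc.ne p.2))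
    positivity
  have hm : ∀ j, ‖c j‖ ≤ ⨆ j, ‖c j‖ := fun j => le_ciSup (f := fun j => ‖c j‖)
    (Set.finite_range _).bddAbove j
  set m := ⨆ j, ‖c j‖ with hm'
  have hdm : halfMinDist c ≤ m := by
    have h1 := hle i0 i1 h01
    have h2 := norm_sub_le (c i0) (c i1)
    linarith [hm i0, hm i1]
  have hr : r0 c = 1 / halfMinDist c + m := rfl
  have hd1 : 0 < 1 / halfMinDist c := by positivity
  have hr0 : 0 < r0 c := by linarith
  have h1 : 1 / r0 c < halfMinDist c := by
    rw [one_div_lt hr0 hd]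
    linarith
  have h2 : 1 / r0 c < 1 / halfMinDist c := one_div_lt_one_div_of_lt hd (by linarith)
  refine ⟨hr0, fun j k hjk => ?_, fun j => ?_⟩
  · have := hle j k hjk
    have e : 2 / r0 c = 2 * (1 / r0 c) := by ring
    linarith
  · linarith [hm j]

theorem closure_OmegaAt_subset {t : ℝ} : closure (OmegaAt c t) ⊆ compactPart c t :=
  closure_minimal (sdiff_subset_sdiff Metric.ball_subset_closedBall
    (iUnion_mono fun _ => Metric.ball_subset_closedBall)) isCompact_compactPart.isClosed

theorem mem_OmegaAt_of_exhaustionRadius_lt {z : ℂ} {t : ℝ} (hz : z ∈ Omega c)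
    (ht : exhaustionRadius c z < t) : z ∈ OmegaAt c t := by
  have h0 : 0 ≤ exhaustionRadius c z := (norm_nonneg z).trans (le_max_left _ _)
  obtain ⟨h1, h2⟩ := (exhaustionRadius_le_iff h0).1 (le_refl (exhaustionRadius c z))
  refine ⟨mem_ball_zero_iff.2 (h1.trans_lt ht), ?_⟩
  simp only [mem_iUnion, not_exists, mem_closedBall_iff_norm, not_le]
  intro j
  have hj : 0 < ‖z - c j‖ := norm_pos_iff.2 (sub_ne_zero.2 fun h => hz ⟨j, h.symm⟩)
  exact (div_lt_comm₀ hj (h0.trans_lt ht)).1 ((h2 j).trans_lt ht)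

theorem integral_indicator_Ioi_inv {R r τ : ℝ} (hR : 0 < R) (hr : R ≤ r) (hτ : τ ≤ r) :
    IntervalIntegrable ((Ioi τ).indicator fun t : ℝ => t⁻¹) volume R r ∧
    ∫ t in R..r, (Ioi τ).indicator (fun t : ℝ => t⁻¹) t = Real.log r - Real.log (max R τ) := by
  have hm : 0 < max R τ := hR.trans_le (le_max_left _ _)
  constructor
  · rw [intervalIntegrable_iff]
    refine Integrable.indicator ?_ measurableSet_Ioi
    rw [← IntegrableOn, ← intervalIntegrable_iff, intervalIntegrable_inv_iff]
    right
    rw [uIcc_of_le hr]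
    exact fun h => hR.not_ge h.1
  · rw [intervalIntegral.integral_of_le hr, setIntegral_indicator measurableSet_Ioi,
      Ioc_inter_Ioi, max_comm R τ, ← intervalIntegral.integral_of_le (max_le hτ hr),
      integral_inv_of_pos (max_comm R τ ▸ hm) (hR.trans_le hr), Real.log_div (hR.trans_le hr).ne'
        (max_comm R τ ▸ hm).ne']

namespace HolomorphicCurve

variable {n : ℕ}

theorem T_eq_endSum (f : HolomorphicCurve c n) (r : ℝ) :
    f.T r = endSum c (fun z => Real.log ‖f.toFun z‖) r := rfl

theorem differentiableOn_pair (f : HolomorphicCurve c n) (a : Fin (n + 1) → ℂ) :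
    DifferentiableOn ℂ (f.pair a) (Omega c) :=
  DifferentiableOn.fun_sum (u := Finset.univ) (A := fun i z => a i * f.toFun z i)
    fun i _ => (f.holomorphic i).const_mul (a i)

theorem analyticOnNhd_pair (f : HolomorphicCurve c n) (a : Fin (n + 1) → ℂ) :
    AnalyticOnNhd ℂ (f.pair a) (Omega c) :=
  (f.differentiableOn_pair a).analyticOnNhd isOpen_Omega

/-- A zero enters the count when `t` passes its `exhaustionRadius`, and integrating `1 / t` from
there gives the logarithm. At the exact entry values membership in the closure of `Ω_t` is not
decided; these are finitely many `t` and do not affect the integral. -/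
theorem N_eq_sum (f : HolomorphicCurve c n) (hR : IsSeparatingRadius c (r0 c)) (δ : ℕ)
    (a : Fin (n + 1) → ℂ) {r : ℝ} (hr : r0 c ≤ r) {Z : Finset ℂ}
    (hZ : (Z : Set ℂ) ⊆ compactPart c r) (hZF : ∀ z ∈ compactPart c r, f.pair a z = 0 → z ∈ Z) :
    f.N δ r a = ∑ z ∈ Z, ((min (analyticOrderNatAt (f.pair a) z) δ : ℕ) : ℝ) *
      (Real.log r - Real.log (max (r0 c) (exhaustionRadius c z))) := by
  classical
  have hR0 := hR.pos
  have hr0 : 0 < r := hR0.trans_le hr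
  set m : ℂ → ℕ := fun z => min (analyticOrderNatAt (f.pair a) z) δ with hm
  have hτ : ∀ z ∈ Z, exhaustionRadius c z ≤ r := fun z hz =>
    (mem_compactPart_iff hr0 (compactPart_subset_compl_range hr0 (hZ hz))).1 (hZ hz)
  have hcount : ∀ t ∈ Ioc (r0 c) r, t ∉ Z.image (exhaustionRadius c) →
      (f.truncatedCount δ a t : ℝ) / t =
        ∑ z ∈ Z, (m z : ℝ) * (Ioi (exhaustionRadius c z)).indicator (fun t : ℝ => t⁻¹) t := by
    intro t ht htZ
    have ht0 : 0 < t := hR0.trans ht.1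
    have h1 : f.truncatedCount δ a t = ∑ z ∈ Z with exhaustionRadius c z < t, m z := by
      rw [truncatedCount]
      refine finsum_mem_eq_sum_of_inter_support_eq _ (Set.ext fun z => ?_)
      simp only [Set.mem_inter_iff, Finset.coe_filter, Set.mem_ofPred_eq]
      refine and_congr_left fun hz => ⟨fun h => ?_, fun h => ?_⟩
      · have h2 := closure_OmegaAt_subset h
        have h3 : f.pair a z = 0 := by
          refine apply_eq_zero_of_analyticOrderNatAt_ne_zero fun h0 => hz ?_
          simp [h0]
        have hzZ := hZF z (compactPart_mono ht0 ht.2 h2) h3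
        refine ⟨hzZ, lt_of_le_of_ne ((mem_compactPart_iff ht0
          (compactPart_subset_compl_range ht0 h2)).1 h2) fun h4 => htZ ?_⟩
        exact Finset.mem_image.2 ⟨z, hzZ, h4⟩
      · exact subset_closure (mem_OmegaAt_of_exhaustionRadius_lt
          (compactPart_subset_compl_range hr0 (hZ h.1)) h.2)
    rw [h1, Finset.sum_filter, Nat.cast_sum, Finset.sum_div]
    refine Finset.sum_congr rfl fun z _ => ?_
    by_cases h : exhaustionRadius c z < t
    · rw [if_pos h, Set.indicator_of_mem (Set.mem_Ioi.2 h), div_eq_mul_inv]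
    · rw [if_neg h, Set.indicator_of_notMem (by simpa using h)]
      simp
  have hae : ∀ᵐ t : ℝ, t ∉ Z.image (exhaustionRadius c) :=
    measure_eq_zero_iff_ae_notMem.1
      ((Z.image (exhaustionRadius c)).finite_toSet.measure_zero volume)
  rw [N, intervalIntegral.integral_congr_ae (g := fun t => ∑ z ∈ Z, (m z : ℝ) *
    (Ioi (exhaustionRadius c z)).indicator (fun t : ℝ => t⁻¹) t),
    intervalIntegral.integral_finsetSum]
  · refine Finset.sum_congr rfl fun z hz => ?_
    rw [intervalIntegral.integral_const_mul, (integral_indicator_Ioi_inv hR0 hr (hτ z hz)).2]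
  · exact fun z hz => (integral_indicator_Ioi_inv hR0 hr (hτ z hz)).1.const_mul _
  · filter_upwards [hae] with t ht htI
    rw [uIoc_of_le hr] at htI
    exact hcount t htI ht

end HolomorphicCurve

theorem analyticOrderAt_ne_top_of_exists_ne_zero {F : ℂ → ℂ} {V : Set ℂ} (hV : IsPreconnected V)
    (hF : AnalyticOnNhd ℂ F V) (h0 : ∃ z ∈ V, F z ≠ 0) {z : ℂ} (hz : z ∈ V) :
    analyticOrderAt F z ≠ ⊤ := by
  intro h
  obtain ⟨w, hw, hw0⟩ := h0
  exact hw0 (hF.eqOn_zero_of_preconnected_of_eventuallyEq_zero hV hz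
    (analyticOrderAt_eq_top.1 h) hw)

theorem finite_zeros_of_isCompact {F : ℂ → ℂ} {K : Set ℂ} (hK : IsCompact K)
    (hF : AnalyticOnNhd ℂ F K) (h0 : ∀ z ∈ K, analyticOrderAt F z ≠ ⊤) :
    {z ∈ K | F z = 0}.Finite := by
  by_contra hinf
  obtain ⟨z, hz, hacc⟩ := Set.Infinite.exists_accPt_of_subset_isCompact hinf hK (sep_subset _ _)
  refine h0 z hz (analyticOrderAt_eq_top.2 ?_)
  refine (hF z hz).frequently_zero_iff_eventually_zero.1 ?_
  exact (accPt_iff_frequently_nhdsNE.1 hacc).mono fun w hw => hw.2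

end

/-! ### Wronskian determinants. -/

/-- The Wronskian matrix of a family of functions. -/
noncomputable def wronskianMatrix {m : ℕ} (g : Fin m → ℂ → ℂ) (z : ℂ) : Matrix (Fin m) (Fin m) ℂ :=
  Matrix.of fun k i => iteratedDeriv k (g i) z

/-- The Wronskian determinant of a family of functions. -/
noncomputable def wronskianDet {m : ℕ} (g : Fin m → ℂ → ℂ) (z : ℂ) : ℂ := (wronskianMatrix g z).det

section

variable {m : ℕ} {g : Fin m → ℂ → ℂ} {z : ℂ}

theorem analyticAt_iteratedDeriv {φ : ℂ → ℂ} (h : AnalyticAt ℂ φ z) (k : ℕ) :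
    AnalyticAt ℂ (iteratedDeriv k φ) z := by
  rw [iteratedDeriv_eq_iterate]
  exact h.iterated_deriv k

theorem analyticAt_matrix_det {A : ℂ → Matrix (Fin m) (Fin m) ℂ}
    (hA : ∀ i j, AnalyticAt ℂ (fun w => A w i j) z) : AnalyticAt ℂ (fun w => (A w).det) z := by
  simp only [Matrix.det_apply']
  refine Finset.analyticAt_fun_sum _ fun σ _ => ?_
  exact analyticAt_const.mul (Finset.analyticAt_fun_prod _ fun i _ => hA _ _)

theorem analyticAt_wronskianDet (hg : ∀ i, AnalyticAt ℂ (g i) z) :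
    AnalyticAt ℂ (wronskianDet g) z :=
  analyticAt_matrix_det fun k i => analyticAt_iteratedDeriv (hg i) k

/-- By the Leibniz rule the new matrix is the old one multiplied on the left by a lower triangular
matrix whose diagonal entries are all `φ z`. -/
theorem wronskianDet_mul {φ : ℂ → ℂ} (hφ : AnalyticAt ℂ φ z) (hg : ∀ i, AnalyticAt ℂ (g i) z) :
    wronskianDet (fun i w => φ w * g i w) z = φ z ^ m * wronskianDet g z := by
  set L : Matrix (Fin m) (Fin m) ℂ := Matrix.of fun k j =>
    if (j : ℕ) ≤ k then ((k : ℕ).choose j : ℂ) * iteratedDeriv (k - j) φ z else 0 with hL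
  have h1 : wronskianMatrix (fun i w => φ w * g i w) z = L * wronskianMatrix g z := by
    ext k i
    have h2 := iteratedDeriv_mul (n := k) (hg i).contDiffAt hφ.contDiffAt
    have h3 : (fun w => φ w * g i w) = g i * φ := by ext w; simp [mul_comm]
    simp only [wronskianMatrix, Matrix.mul_apply, Matrix.of_apply, h3, h2, hL]
    rw [← Fin.sum_univ_eq_sum_range (n := k + 1) (f := fun j =>
      ((k : ℕ).choose j : ℂ) * iteratedDeriv j (g i) z * iteratedDeriv (k - j) φ z)]
    rw [Fin.sum_univ_eq_sum_range (n := k + 1) (f := fun j =>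
      ((k : ℕ).choose j : ℂ) * iteratedDeriv j (g i) z * iteratedDeriv (k - j) φ z),
      Fin.sum_univ_eq_sum_range (n := m) (f := fun j =>
      (if j ≤ k then ((k : ℕ).choose j : ℂ) * iteratedDeriv (k - j) φ z else 0) *
        iteratedDeriv j (g i) z)]
    have h4 : Finset.range (k + 1) ⊆ Finset.range m := Finset.range_subset_range.2 k.2
    rw [← Finset.sum_subset h4]
    · refine Finset.sum_congr rfl fun j hj => ?_
      rw [if_pos (Nat.lt_succ_iff.1 (Finset.mem_range.1 hj))]
      ring
    · intro j _ hj
      rw [if_neg fun h => hj (Finset.mem_range.2 (Nat.lt_succ_iff.2 h)), zero_mul]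
  rw [wronskianDet, h1, Matrix.det_mul, Matrix.det_of_isLowerTriangular L fun i j hij => ?_]
  · simp [hL, wronskianDet]
  · simp only [hL, Matrix.of_apply]
    rw [if_neg]
    simpa using hij

theorem wronskianDet_sum_mul (B : Fin m → Fin m → ℂ) (hg : ∀ i, AnalyticAt ℂ (g i) z) :
    wronskianDet (fun i w => ∑ j, B i j * g j w) z = (Matrix.of B).det * wronskianDet g z := by
  have h1 : wronskianMatrix (fun i w => ∑ j, B i j * g j w) z =
      wronskianMatrix g z * (Matrix.of B).transpose := by
    ext k i
    simp only [wronskianMatrix, Matrix.mul_apply, Matrix.of_apply, Matrix.transpose_apply]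
    rw [iteratedDeriv_fun_sum (f := fun j w => B i j * g j w)
      fun j _ => (analyticAt_const.mul (hg j)).contDiffAt]
    refine Finset.sum_congr rfl fun j _ => ?_
    rw [iteratedDeriv_const_mul_field, mul_comm]
  rw [wronskianDet, h1, Matrix.det_mul, Matrix.det_transpose, mul_comm, wronskianDet]

theorem wronskianDet_succ_of_eq_one {g : Fin (m + 1) → ℂ → ℂ} (h0 : g 0 = fun _ => 1) :
    wronskianDet g z = wronskianDet (fun i => deriv (g i.succ)) z := by
  rw [wronskianDet, Matrix.det_succ_column_zero, Fin.sum_univ_succ]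
  rw [Finset.sum_eq_zero fun i _ => ?_]
  · simp only [Fin.val_zero, pow_zero, one_mul, add_zero]
    have : wronskianMatrix g z 0 0 = 1 := by simp [wronskianMatrix, h0]
    rw [this, one_mul, wronskianDet]
    congr 1
    ext k i
    simp [wronskianMatrix, iteratedDeriv_succ']
  · have : wronskianMatrix g z i.succ 0 = 0 := by
      simp [wronskianMatrix, h0, iteratedDeriv_const]
    simp [this]

theorem natCast_le_analyticOrderAt_iteratedDeriv {φ : ℂ → ℂ} (hφ : AnalyticAt ℂ φ z) {d k : ℕ}
    (h : (d + k : ℕ) ≤ analyticOrderAt φ z) :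
    (d : ℕ∞) ≤ analyticOrderAt (iteratedDeriv k φ) z := by
  rw [natCast_le_analyticOrderAt_iff_iteratedDeriv_eq_zero hφ] at h
  rw [natCast_le_analyticOrderAt_iff_iteratedDeriv_eq_zero (analyticAt_iteratedDeriv hφ k)]
  intro i hi
  have := h (i + k) (by omega)
  rwa [iteratedDeriv_eq_iterate, Function.iterate_add_apply, ← iteratedDeriv_eq_iterate,
    ← iteratedDeriv_eq_iterate] at this

/-- A lower bound for the vanishing order of a Wronskian. -/
theorem sum_le_analyticOrderAt_wronskianDet (hg : ∀ i, AnalyticAt ℂ (g i) z)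
    (hg0 : ∀ i, analyticOrderAt (g i) z ≠ ⊤) :
    ((∑ i, (analyticOrderNatAt (g i) z - (m - 1)) : ℕ) : ℕ∞) ≤
      analyticOrderAt (wronskianDet g) z := by
  -- At most `m - 1` derivatives occur, so every entry of column `i` keeps the factor `(w - z) ^ e
  -- i`, which can be pulled out of the determinant. Truncated subtraction gives exponent `0` for
  -- low orders.
  set e : Fin m → ℕ := fun i => analyticOrderNatAt (g i) z - (m - 1) with he
  have h1 : ∀ k i : Fin m, ∃ v : ℂ → ℂ, AnalyticAt ℂ v z ∧
      ∀ᶠ w in 𝓝 z, iteratedDeriv k (g i) w = (w - z) ^ e i • v w := by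
    intro k i
    rw [← natCast_le_analyticOrderAt (analyticAt_iteratedDeriv (hg i) k)]
    by_cases hi : e i = 0
    · simp [hi]
    refine natCast_le_analyticOrderAt_iteratedDeriv (hg i) ?_
    rw [← Nat.cast_analyticOrderNatAt (hg0 i)]
    have := k.2
    simp only [he] at hi ⊢
    exact_mod_cast (by omega)
  choose v hv hvg using h1
  rw [natCast_le_analyticOrderAt (analyticAt_wronskianDet hg)]
  refine ⟨fun w => (Matrix.of fun k i => v k i w).det, analyticAt_matrix_det fun k i => hv k i, ?_⟩
  filter_upwards [eventually_all.2 fun k => eventually_all.2 fun i => hvg k i] with w hw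
  have : wronskianMatrix g w = Matrix.of fun k i => (w - z) ^ e i * (Matrix.of fun k i => v k i w) k i := by
    ext k i
    simp only [wronskianMatrix, Matrix.of_apply]
    exact hw k i
  rw [wronskianDet, this, Matrix.det_mul_row, Finset.prod_pow_eq_pow_sum, smul_eq_mul]

end

/-- Analytic functions with vanishing Wronskian are linearly dependent on some disc. -/
theorem exists_sum_eq_zero_of_wronskianDet_eq_zero {m : ℕ} {g : Fin m → ℂ → ℂ} {z : ℂ} {ε : ℝ}
    (hε : 0 < ε) (hg : ∀ i, AnalyticOnNhd ℂ (g i) (Metric.ball z ε))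
    (hW : ∀ w ∈ Metric.ball z ε, wronskianDet g w = 0) :
    ∃ a : Fin m → ℂ, a ≠ 0 ∧ ∃ z' ε', 0 < ε' ∧ Metric.ball z' ε' ⊆ Metric.ball z ε ∧
      ∀ w ∈ Metric.ball z' ε', ∑ i, a i * g i w = 0 := by
  induction m generalizing z ε with
  | zero => simpa [wronskianDet] using hW z (Metric.mem_ball_self hε)
  | succ m ih =>
    by_cases h0 : ∀ w ∈ Metric.ball z ε, g 0 w = 0
    · refine ⟨Pi.single 0 1, by simp, z, ε, hε, Subset.rfl, fun w hw => ?_⟩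
      rw [Finset.sum_eq_single 0]
      · simp [h0 w hw]
      · intro i _ hi; simp [hi]
      · simp
    push Not at h0
    obtain ⟨z1, hz1, hgz1⟩ := h0
    obtain ⟨ε1, hε1, hb1⟩ : ∃ ε1 > 0, Metric.ball z1 ε1 ⊆ Metric.ball z ε ∩ {w | g 0 w ≠ 0} := by
      rw [← Metric.mem_nhds_iff]
      exact inter_mem (Metric.isOpen_ball.mem_nhds hz1) ((hg 0 z1 hz1).continuousAt.eventually_ne hgz1)
    have hq : ∀ i, AnalyticOnNhd ℂ (fun w => g i w / g 0 w) (Metric.ball z1 ε1) := fun i w hw =>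
      (hg i w (hb1 hw).1).div (hg 0 w (hb1 hw).1) (hb1 hw).2
    -- Dividing by `g 0` where it is nonzero turns the first function into `1`, and the Wronskian
    -- reduces to that of the `m` derivatives, to which the induction hypothesis applies.
    set u : Fin (m + 1) → ℂ → ℂ := fun i => if i = 0 then fun _ => 1 else fun w => g i w / g 0 w
      with hu
    have hua : ∀ i, AnalyticOnNhd ℂ (u i) (Metric.ball z1 ε1) := fun i => by
      by_cases hi : i = 0
      · simp only [hu, hi, if_true]; exact fun w _ => analyticAt_const
      · simp only [hu, hi, if_false]; exact hq i
    have hW1 : ∀ w ∈ Metric.ball z1 ε1, wronskianDet (fun i => deriv (u i.succ)) w = 0 := by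
      intro w hw
      have h1 := hW w (hb1 hw).1
      have h2 : wronskianDet g w = wronskianDet (fun i w => g 0 w * u i w) w := by
        simp only [wronskianDet]
        congr 1
        ext k i
        simp only [wronskianMatrix, Matrix.of_apply]
        refine Filter.EventuallyEq.iteratedDeriv_eq k ?_
        filter_upwards [Metric.isOpen_ball.mem_nhds hw] with y hy
        by_cases hi : i = 0
        · simp [hu, hi]
        · simp only [hu, hi, if_false]
          rw [mul_div_cancel₀ _ (hb1 hy).2]
      rw [h2, wronskianDet_mul (hg 0 w (hb1 hw).1) fun i => hua i w hw,
        wronskianDet_succ_of_eq_one (by simp [hu])] at h1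
      exact (mul_eq_zero.1 h1).resolve_left (pow_ne_zero _ (hb1 hw).2)
    obtain ⟨b, hb, z2, ε2, hε2, hb2, hsum⟩ := ih hε1 (fun i => (hua i.succ).deriv) hW1
    have hconst : ∀ w ∈ Metric.ball z2 ε2, ∑ i, b i * u i.succ w = ∑ i, b i * u i.succ z2 := by
      intro w hw
      have hd : ∀ y ∈ Metric.ball z2 ε2,
          HasDerivAt (fun w => ∑ i, b i * u i.succ w) 0 y := by
        intro y hy
        have := HasDerivAt.fun_sum (u := Finset.univ) fun i _ =>
          (hua i.succ y (hb2 hy)).differentiableAt.hasDerivAt.const_mul (b i)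
        rwa [hsum y hy] at this
      exact Metric.isOpen_ball.is_const_of_deriv_eq_zero (convex_ball z2 ε2).isPreconnected
        (fun y hy => (hd y hy).differentiableAt.differentiableWithinAt)
        (fun y hy => (hd y hy).deriv) hw (Metric.mem_ball_self hε2)
    -- A linear relation between the derivatives integrates to a constant, and minus this constant
    -- is the coefficient of `g 0`.
    refine ⟨Fin.cons (-∑ i, b i * u i.succ z2) b, fun h => hb ?_, z2, ε2, hε2,
      hb2.trans fun w hw => (hb1 hw).1, fun w hw => ?_⟩
    · ext i
      have := congrFun h i.succ
      simpa using this
    · have h1 := hconst w hw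
      have h2 := (hb1 (hb2 hw)).2
      rw [Fin.sum_univ_succ, Fin.cons_zero, ← h1]
      simp only [Fin.cons_succ, hu, Fin.succ_ne_zero, if_false]
      rw [neg_mul, Finset.sum_mul, neg_add_eq_zero]
      refine Finset.sum_congr rfl fun i _ => ?_
      have h3 : g 0 w ≠ 0 := h2
      field_simp

/-! ### Higher derivatives of quotients along an end. -/

/-- The numerator of the `k`-th derivative of `G / F` over the denominator `F ^ (k + 1)`. -/
noncomputable def quotNum (G F : ℂ → ℂ) : ℕ → ℂ → ℂ
  | 0 => G
  | k + 1 => fun z => deriv (quotNum G F k) z * F z - (k + 1) * (quotNum G F k z * deriv F z)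

/-- The quotient `(G / F)^(k) / (G / F)`. -/
noncomputable def derivRatio (G F : ℂ → ℂ) (k : ℕ) (z : ℂ) : ℂ :=
  quotNum G F k z / (F z ^ k * G z)

section

variable {G F : ℂ → ℂ} {V : Set ℂ}

theorem analyticOnNhd_quotNum (hG : AnalyticOnNhd ℂ G V) (hF : AnalyticOnNhd ℂ F V) (k : ℕ) :
    AnalyticOnNhd ℂ (quotNum G F k) V := by
  induction k with
  | zero => exact hG
  | succ k ih =>
    exact (ih.deriv.mul hF).sub (analyticOnNhd_const.mul (ih.mul hF.deriv))

/-- The recursion for `quotNum` is the quotient rule with denominators cleared. The numerators stay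
holomorphic where `F` vanishes, so the logarithmic derivative lemma applies to them. -/
theorem iteratedDeriv_div_eq (hV : IsOpen V) (hG : AnalyticOnNhd ℂ G V)
    (hF : AnalyticOnNhd ℂ F V) (k : ℕ) {z : ℂ} (hz : z ∈ V) (hFz : F z ≠ 0) :
    iteratedDeriv k (fun w => G w / F w) z = quotNum G F k z / F z ^ (k + 1) := by
  induction k generalizing z with
  | zero => simp [quotNum]
  | succ k ih =>
    have h1 : iteratedDeriv k (fun w => G w / F w) =ᶠ[𝓝 z]
        fun w => quotNum G F k w / F w ^ (k + 1) := by
      filter_upwards [hV.mem_nhds hz, (hF z hz).continuousAt.eventually_ne hFz] with w hw hFw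
        using ih hw hFw
    have h2 := (analyticOnNhd_quotNum hG hF k z hz).differentiableAt.hasDerivAt
    have h3 := (hF z hz).differentiableAt.hasDerivAt
    rw [iteratedDeriv_succ, h1.deriv_eq, (h2.fun_div (h3.fun_pow (k + 1))
      (pow_ne_zero _ hFz)).deriv, quotNum]
    push_cast
    field_simp
    ring

theorem iteratedDeriv_div_eq_mul_derivRatio (hV : IsOpen V) (hG : AnalyticOnNhd ℂ G V)
    (hF : AnalyticOnNhd ℂ F V) (k : ℕ) {z : ℂ} (hz : z ∈ V) (hFz : F z ≠ 0) (hGz : G z ≠ 0) :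
    iteratedDeriv k (fun w => G w / F w) z = G z / F z * derivRatio G F k z := by
  rw [iteratedDeriv_div_eq hV hG hF k hz hFz, derivRatio]
  field_simp
  ring

end

/-- A parametrization of an end of `V` by a half-plane. -/
structure IsEndMap (E : ℂ → ℂ) (V : Set ℂ) (a : ℝ) : Prop where
  differentiableOn : DifferentiableOn ℂ E (halfPlane a)
  mapsTo : MapsTo E (halfPlane a) V
  periodic : Function.Periodic E (2 * Real.pi * I)
  exp_le_norm_deriv : ∀ ζ ∈ halfPlane a, Real.exp (-|ζ.re|) ≤ ‖deriv E ζ‖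

namespace IsEndMap

variable {E : ℂ → ℂ} {V : Set ℂ} {a : ℝ}

theorem deriv_ne_zero (hE : IsEndMap E V a) {ζ : ℂ} (hζ : ζ ∈ halfPlane a) : deriv E ζ ≠ 0 :=
  norm_pos_iff.1 ((Real.exp_pos _).trans_le (hE.exp_le_norm_deriv ζ hζ))

theorem differentiableOn_comp (hE : IsEndMap E V a) {H : ℂ → ℂ} (hH : AnalyticOnNhd ℂ H V) :
    DifferentiableOn ℂ (fun ζ => H (E ζ)) (halfPlane a) :=
  hH.differentiableOn.comp hE.differentiableOn hE.mapsTo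

theorem periodic_comp (hE : IsEndMap E V a) {β : Type*} (H : ℂ → β) :
    Function.Periodic (fun ζ => H (E ζ)) (2 * Real.pi * I) :=
  fun ζ => congrArg H (hE.periodic ζ)

/-- Since `E' ≠ 0`, punctured neighbourhoods go to punctured neighbourhoods. Vanishing of `H ∘ E`
would make zeros of `H` accumulate, against the identity theorem. -/
theorem exists_comp_ne_zero (hE : IsEndMap E V a) (hV : IsPreconnected V) {H : ℂ → ℂ}
    (hH : AnalyticOnNhd ℂ H V) (h0 : ∃ z ∈ V, H z ≠ 0) : ∃ ζ ∈ halfPlane a, H (E ζ) ≠ 0 := by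
  by_contra! hz
  have hmem : ((a + 1 : ℝ) : ℂ) ∈ halfPlane a := by simp [halfPlane]
  have hd := (hE.differentiableOn.differentiableAt
    ((isOpen_halfPlane a).mem_nhds hmem)).hasDerivAt
  have h1 := hd.tendsto_nhdsNE (hE.deriv_ne_zero hmem)
  have h2 : ∃ᶠ ζ in 𝓝[≠] ((a + 1 : ℝ) : ℂ), H (E ζ) = 0 := by
    refine Eventually.frequently (nhdsWithin_le_nhds ?_)
    filter_upwards [(isOpen_halfPlane a).mem_nhds hmem] with ζ hζ using hz ζ hζ
  obtain ⟨z, hzV, hz0⟩ := h0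
  exact hz0 (hH.eqOn_zero_of_preconnected_of_frequently_eq_zero hV (hE.mapsTo hmem)
    (h1.frequently h2) hzV)

theorem ae_comp_ne_zero (hE : IsEndMap E V a) (hV : IsPreconnected V) {H : ℂ → ℂ}
    (hH : AnalyticOnNhd ℂ H V) (h0 : ∃ z ∈ V, H z ≠ 0) {x : ℝ} (hx : a < x) :
    ∀ᵐ y : ℝ, H (E (x + y * I)) ≠ 0 :=
  ae_ne_zero_of_exists_ne_zero (hE.differentiableOn_comp hH) (hE.exists_comp_ne_zero hV hH h0) hx

theorem continuous_comp (hE : IsEndMap E V a) {β : Type*} [TopologicalSpace β] {H : ℂ → β}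
    (hH : ContinuousOn H V) {x : ℝ} (hx : a < x) : Continuous fun y : ℝ => H (E (x + y * I)) :=
  continuous_comp_add_mul_I (f := fun ζ => H (E ζ))
    (hH.comp hE.differentiableOn.continuousOn hE.mapsTo) hx

/-- One step of the logarithmic derivative chain, along an end. -/
theorem logDerivQuot_comp_eq (hE : IsEndMap E V a) {G F : ℂ → ℂ} (hG : AnalyticOnNhd ℂ G V)
    (hF : AnalyticOnNhd ℂ F V) (k : ℕ) {ζ : ℂ} (hζ : ζ ∈ halfPlane a) (hFζ : F (E ζ) ≠ 0) :
    logDerivQuot (fun ζ => quotNum G F k (E ζ)) (fun ζ => F (E ζ) ^ (k + 1)) ζ =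
      deriv E ζ * (quotNum G F (k + 1) (E ζ) / (quotNum G F k (E ζ) * F (E ζ))) := by
  have hd := (hE.differentiableOn.differentiableAt ((isOpen_halfPlane a).mem_nhds hζ)).hasDerivAt
  have h1 := (analyticOnNhd_quotNum hG hF k _ (hE.mapsTo hζ)).differentiableAt.hasDerivAt.comp ζ hd
  have h2 := ((hF _ (hE.mapsTo hζ)).differentiableAt.hasDerivAt.comp ζ hd).fun_pow (k + 1)
  simp only [Function.comp_def] at h1 h2
  rw [logDerivQuot, h1.deriv, h2.deriv, Nat.add_sub_cancel, quotNum]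
  push_cast
  by_cases h0 : quotNum G F k (E ζ) = 0
  · simp [h0]
  field_simp
  ring

/-- Consecutive ratios differ by the logarithmic derivative of `quotNum G F k / F ^ (k + 1)`. In the
coordinate `ζ` the chain rule inserts `E'`, and dividing it out costs at most `|Re ζ|`. -/
theorem posLog_derivRatio_succ_le (hE : IsEndMap E V a) {G F : ℂ → ℂ} (hG : AnalyticOnNhd ℂ G V)
    (hF : AnalyticOnNhd ℂ F V) (k : ℕ) {ζ : ℂ} (hζ : ζ ∈ halfPlane a) (hFζ : F (E ζ) ≠ 0)
    (hkζ : quotNum G F k (E ζ) ≠ 0) :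
    Real.posLog ‖derivRatio G F (k + 1) (E ζ)‖ ≤ Real.posLog ‖derivRatio G F k (E ζ)‖ +
      Real.posLog ‖logDerivQuot (fun ζ => quotNum G F k (E ζ)) (fun ζ => F (E ζ) ^ (k + 1)) ζ‖ +
        |ζ.re| := by
  have hd := hE.deriv_ne_zero hζ
  have h1 : derivRatio G F (k + 1) (E ζ) = derivRatio G F k (E ζ) *
      (logDerivQuot (fun ζ => quotNum G F k (E ζ)) (fun ζ => F (E ζ) ^ (k + 1)) ζ *
        (deriv E ζ)⁻¹) := by
    rw [hE.logDerivQuot_comp_eq hG hF k hζ hFζ, derivRatio, derivRatio]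
    by_cases hGζ : G (E ζ) = 0
    · simp [hGζ]
    field_simp
    ring
  have h2 : Real.posLog ‖(deriv E ζ)⁻¹‖ ≤ |ζ.re| := by
    rw [Real.posLog_apply]
    refine max_le (abs_nonneg _) ?_
    rw [norm_inv, Real.log_inv, neg_le, Real.le_log_iff_exp_le (norm_pos_iff.2 hd)]
    exact hE.exp_le_norm_deriv ζ hζ
  rw [h1, norm_mul, norm_mul]
  have h3 := Real.posLog_mul (x := ‖derivRatio G F k (E ζ)‖)
    (y := ‖logDerivQuot (fun ζ => quotNum G F k (E ζ)) (fun ζ => F (E ζ) ^ (k + 1)) ζ‖ *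
      ‖(deriv E ζ)⁻¹‖)
  have h4 := Real.posLog_mul
    (x := ‖logDerivQuot (fun ζ => quotNum G F k (E ζ)) (fun ζ => F (E ζ) ^ (k + 1)) ζ‖)
    (y := ‖(deriv E ζ)⁻¹‖)
  linarith

theorem aestronglyMeasurable_posLog_derivRatio (hE : IsEndMap E V a) {G F : ℂ → ℂ}
    (hG : AnalyticOnNhd ℂ G V) (hF : AnalyticOnNhd ℂ F V) (k : ℕ) {x : ℝ} (hx : a < x)
    (μ : Measure ℝ) :
    AEStronglyMeasurable (fun y : ℝ => Real.posLog ‖derivRatio G F k (E (x + y * I))‖) μ := by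
  have h1 := hE.continuous_comp (analyticOnNhd_quotNum hG hF k).continuousOn hx
  have h2 := hE.continuous_comp hG.continuousOn hx
  have h3 := hE.continuous_comp hF.continuousOn hx
  exact (Real.continuous_posLog.measurable.comp (h1.measurable.div
    ((h3.pow k).mul h2).measurable).norm).aestronglyMeasurable

end IsEndMap

theorem log_one_add_max_le {k : ℕ} {C x τ s : ℝ} (hC : 0 ≤ C)
    (hs : s ≤ (k + 1) * max τ 0 + C * (1 + |x| + Real.log (1 + max τ 0))) :
    Real.log (1 + max s 0) ≤ Real.log (k + 2 + C) + |x| + Real.log (1 + max τ 0) := by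
  set t := max τ 0 with ht
  have ht0 : 0 ≤ t := le_max_right _ _
  have hx0 := abs_nonneg x
  have hk : (0 : ℝ) ≤ k := k.cast_nonneg
  have h1 : Real.log (1 + t) ≤ t := by linarith [Real.log_le_sub_one_of_pos (by linarith : 0 < 1 + t)]
  have h2 : 1 + max s 0 ≤ (k + 2 + C) * ((1 + |x|) * (1 + t)) := by
    have h3 : max s 0 ≤ (k + 1) * t + C * (1 + |x| + t) := by
      refine max_le (hs.trans ?_) (by positivity)
      gcongr
    have h4 : 0 ≤ |x| * t := by positivity
    nlinarith [mul_nonneg hC h4, mul_nonneg hk h4, mul_nonneg hk hx0]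
  have h5 : Real.log (1 + |x|) ≤ |x| := by
    linarith [Real.log_le_sub_one_of_pos (by linarith : 0 < 1 + |x|)]
  have h6 := Real.log_le_log (by positivity) h2
  rw [Real.log_mul (by positivity) (by positivity), Real.log_mul (by positivity) (by positivity)]
    at h6
  linarith

/-- **Lemma on the logarithmic derivative** for higher derivatives of a quotient, along an end. -/
theorem IsEndMap.exists_integral_posLog_derivRatio_le {E : ℂ → ℂ} {V : Set ℂ} {a b : ℝ}
    (hE : IsEndMap E V a) (hab : a < b) (hVo : IsOpen V) (hV : IsPreconnected V) {G F : ℂ → ℂ}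
    (hG : AnalyticOnNhd ℂ G V) (hF : AnalyticOnNhd ℂ F V) (hG0 : ∃ z ∈ V, G z ≠ 0)
    (hF0 : ∃ z ∈ V, F z ≠ 0) {ψ : ℂ → ℝ} (hψ : ContinuousOn ψ V)
    (hGψ : ∀ z ∈ V, G z ≠ 0 → Real.log ‖G z‖ ≤ ψ z)
    (hFψ : ∀ z ∈ V, F z ≠ 0 → Real.log ‖F z‖ ≤ ψ z) (k : ℕ) :
    ∃ C S, 0 ≤ C ∧ ExpNegligible S ∧ ∀ x, b < x → x ∉ S →
      IntervalIntegrable (fun y : ℝ => Real.posLog ‖derivRatio G F k (E (x + y * I))‖) volume 0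
        (2 * Real.pi) ∧
      ∫ y in (0 : ℝ)..2 * Real.pi, Real.posLog ‖derivRatio G F k (E (x + y * I))‖ ≤
        C * (1 + |x| + Real.log (1 + max
          (∫ y in (0 : ℝ)..2 * Real.pi, ψ (E (x + y * I))) 0)) := by
  have hpi := Real.two_pi_pos.le
  induction k with
  | zero =>
    have h0 : ∀ z, Real.posLog ‖derivRatio G F 0 z‖ = 0 := by
      intro z
      simp only [derivRatio, quotNum, pow_zero, one_mul]
      by_cases h : G z = 0
      · simp [h]
      · simp [div_self h]
    refine ⟨0, ∅, le_rfl, .empty, fun x _ _ => ?_⟩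
    simp [h0]
  | succ k ih =>
    by_cases hk0 : ∃ z ∈ V, quotNum G F k z ≠ 0
    · obtain ⟨C, S, hC, hS, h⟩ := ih
      have hHk := analyticOnNhd_quotNum hG hF k
      have hB0 : ∃ ζ ∈ halfPlane a, F (E ζ) ^ (k + 1) ≠ 0 := by
        obtain ⟨ζ, h1, h2⟩ := hE.exists_comp_ne_zero hV hF hF0
        exact ⟨ζ, h1, pow_ne_zero _ h2⟩
      have hAd := hE.differentiableOn_comp hHk
      have hBd : DifferentiableOn ℂ (fun ζ => F (E ζ) ^ (k + 1)) (halfPlane a) :=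
        (hE.differentiableOn_comp hF).pow (k + 1)
      obtain ⟨C1, S1, hC1, hS1, h1⟩ := exists_integral_posLog_logDerivQuot_le hAd hBd
        (hE.exists_comp_ne_zero hV hHk hk0) hB0 (hE.periodic_comp _)
        (hE.periodic_comp fun z => F z ^ (k + 1)) hab
      refine ⟨C + C1 * (2 + |Real.log (k + 2 + C)|) + 2 * Real.pi, S ∪ S1, by positivity,
        hS.union hS1, fun x hx hxS => ?_⟩
      have hxa : a < x := hab.trans hx
      have hkC : (0 : ℝ) ≤ k := k.cast_nonneg
      obtain ⟨hi, hle⟩ := h x hx fun h => hxS (Or.inl h)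
      obtain ⟨hi1, hle1⟩ := h1 x hx fun h => hxS (Or.inr h)
      set τ := ∫ y in (0 : ℝ)..2 * Real.pi, ψ (E (x + y * I)) with hτ
      have haeF := hE.ae_comp_ne_zero hV hF hF0 hxa
      have haeG := hE.ae_comp_ne_zero hV hG hG0 hxa
      have haeH := hE.ae_comp_ne_zero hV hHk hk0 hxa
      have hψi : IntervalIntegrable (fun y : ℝ => ψ (E (x + y * I))) volume 0 (2 * Real.pi) :=
        (hE.continuous_comp hψ hxa).intervalIntegrable _ _
      -- Since `quotNum G F k = derivRatio G F k · F ^ k · G`, the characteristic of the pair is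
      -- controlled by `(k + 1) τ` and the `log⁺` integral already estimated for `k`. This closes
      -- the induction.
      have hchar : charInt (fun ζ => quotNum G F k (E ζ)) (fun ζ => F (E ζ) ^ (k + 1)) x ≤
          (k + 1) * τ +
            ∫ y in (0 : ℝ)..2 * Real.pi, Real.posLog ‖derivRatio G F k (E (x + y * I))‖ := by
        rw [hτ, ← intervalIntegral.integral_const_mul, ← intervalIntegral.integral_add
          (hψi.const_mul _) hi]
        refine intervalIntegral.integral_mono_ae hpi (intervalIntegrable_max_log hAd hBd hxa _ _)
          ((hψi.const_mul _).add hi) ?_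
        filter_upwards [haeF, haeG, haeH] with y hFy hGy hHy
        have hm := hE.mapsTo (ofReal_add_mul_I_mem_halfPlane.2 hxa : (x : ℂ) + y * I ∈ _)
        have e1 := hFψ _ hm hFy
        have e2 := hGψ _ hm hGy
        have e3 : Real.log ‖quotNum G F k (E (x + y * I))‖ ≤
            Real.posLog ‖derivRatio G F k (E (x + y * I))‖ +
              (k * Real.log ‖F (E (x + y * I))‖ + Real.log ‖G (E (x + y * I))‖) := by
          have e4 : Real.log ‖derivRatio G F k (E (x + y * I))‖ ≤
              Real.posLog ‖derivRatio G F k (E (x + y * I))‖ := by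
            rw [Real.posLog_apply]; exact le_max_right _ _
          rw [derivRatio, norm_div, norm_mul, norm_pow,
            Real.log_div (norm_ne_zero_iff.2 hHy) (by positivity),
            Real.log_mul (by positivity) (by positivity), Real.log_pow,
            ← norm_pow, ← norm_mul, ← norm_div, ← derivRatio] at e4
          linarith
        refine max_le ?_ ?_
        · have := mul_le_mul_of_nonneg_left e1 hkC
          linarith
        · rw [norm_pow, Real.log_pow]
          have := mul_le_mul_of_nonneg_left e1 (by positivity : (0 : ℝ) ≤ k + 1)
          have := Real.posLog_nonneg (x := ‖derivRatio G F k (E (x + y * I))‖)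
          push_cast
          linarith
      have hlog := log_one_add_max_le (k := k) (x := x) (τ := τ) hC (hchar.trans (add_le_add
        (mul_le_mul_of_nonneg_left (le_max_left _ _) (by positivity)) hle))
      have hgi : IntervalIntegrable (fun y : ℝ => Real.posLog ‖derivRatio G F k (E (x + y * I))‖ +
          Real.posLog ‖logDerivQuot (fun ζ => quotNum G F k (E ζ)) (fun ζ => F (E ζ) ^ (k + 1))
            (x + y * I)‖ + |x|) volume 0 (2 * Real.pi) :=
        (hi.add hi1).add intervalIntegrable_const
      have hpt : ∀ᵐ y : ℝ, Real.posLog ‖derivRatio G F (k + 1) (E (x + y * I))‖ ≤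
          Real.posLog ‖derivRatio G F k (E (x + y * I))‖ +
          Real.posLog ‖logDerivQuot (fun ζ => quotNum G F k (E ζ)) (fun ζ => F (E ζ) ^ (k + 1))
            (x + y * I)‖ + |x| := by
        filter_upwards [haeF, haeH] with y hFy hHy
        have := hE.posLog_derivRatio_succ_le hG hF k
          (ofReal_add_mul_I_mem_halfPlane.2 hxa : (x : ℂ) + y * I ∈ _) hFy hHy
        simpa using this
      have hfi : IntervalIntegrable (fun y : ℝ =>
          Real.posLog ‖derivRatio G F (k + 1) (E (x + y * I))‖) volume 0 (2 * Real.pi) := by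
        refine hgi.mono_fun
          (hE.aestronglyMeasurable_posLog_derivRatio hG hF (k + 1) hxa _) (ae_restrict_of_ae ?_)
        filter_upwards [hpt] with y hy
        rw [Real.norm_of_nonneg Real.posLog_nonneg]
        exact hy.trans (Real.le_norm_self _)
      refine ⟨hfi, (intervalIntegral.integral_mono_ae hpi hfi hgi hpt).trans ?_⟩
      rw [intervalIntegral.integral_add (hi.add hi1) intervalIntegrable_const,
        intervalIntegral.integral_add hi hi1, intervalIntegral.integral_const, sub_zero,
        smul_eq_mul]
      have hL : 0 ≤ Real.log (1 + max τ 0) := Real.log_nonneg (by simp)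
      have hx0 := abs_nonneg x
      set L := Real.log (1 + max τ 0)
      set c0 := Real.log (k + 2 + C)
      have h5 := mul_le_mul_of_nonneg_left (add_le_add_right hlog (1 + |x|)) hC1
      have h6 : C1 * (1 + |x| + (c0 + |x| + L)) ≤ C1 * ((2 + |c0|) * (1 + |x| + L)) := by
        refine mul_le_mul_of_nonneg_left ?_ hC1
        nlinarith [le_abs_self c0, abs_nonneg c0, mul_nonneg (abs_nonneg c0) hx0,
          mul_nonneg (abs_nonneg c0) hL]
      have h7 : 2 * Real.pi * |x| ≤ 2 * Real.pi * (1 + |x| + L) := by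
        refine mul_le_mul_of_nonneg_left ?_ hpi
        linarith
      nlinarith
    -- If the `k`-th numerator vanishes identically, so does the next one, and there is nothing to
    -- estimate.
    · push Not at hk0
      refine ⟨0, ∅, le_rfl, .empty, fun x hx _ => ?_⟩
      have hxa : a < x := hab.trans hx
      have h0 : ∀ y : ℝ, Real.posLog ‖derivRatio G F (k + 1) (E (x + y * I))‖ = 0 := by
        intro y
        have hm := hE.mapsTo (ofReal_add_mul_I_mem_halfPlane.2 hxa : (x : ℂ) + y * I ∈ _)
        have h1 : quotNum G F k =ᶠ[𝓝 (E (x + y * I))] fun _ => 0 := by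
          filter_upwards [hVo.mem_nhds hm] with z hz using hk0 z hz
        simp [derivRatio, quotNum, h1.deriv_eq, hk0 _ hm]
      simp [h0]

/-! ### The ends of the punctured plane and averages over them. -/

/-- Half-plane parametrizations of the neighbourhoods of `∞` and of the punctures. -/
noncomputable def endMap {ι : Type*} (c : ι → ℂ) : Option ι → ℂ → ℂ
  | none => exp
  | some j => fun ζ => c j + exp (-ζ)

section

variable {M : ℕ} {c : Fin M → ℂ} {R : ℝ}

theorem isEndMap_endMap (hR : IsSeparatingRadius c R) (o : Option (Fin M)) :
    IsEndMap (endMap c o) (Omega c) (Real.log R) := by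
  have hR0 := hR.pos
  have hexp : ∀ ζ ∈ halfPlane (Real.log R), R < Real.exp ζ.re := fun ζ hζ =>
    (Real.log_lt_iff_lt_exp hR0).1 hζ
  rcases o with _ | j
  · refine ⟨differentiable_exp.differentiableOn, ?_, exp_periodic, ?_⟩
    · rintro ζ hζ ⟨j, hj⟩
      have h1 := hR.norm_add_lt j
      have h2 : ‖c j‖ = Real.exp ζ.re := by rw [hj]; exact norm_exp ζ
      have h3 := hexp ζ hζ
      have h4 : 0 < 1 / R := by positivity
      linarith
    · intro ζ _
      simp only [endMap, Complex.deriv_exp, norm_exp]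
      exact Real.exp_le_exp.2 (neg_abs_le _)
  · have hd : ∀ ζ : ℂ, HasDerivAt (fun ζ => c j + exp (-ζ)) (-exp (-ζ)) ζ := fun ζ => by
      simpa using ((hasDerivAt_neg ζ).cexp).const_add (c j)
    refine ⟨fun ζ _ => (hd ζ).differentiableAt.differentiableWithinAt, ?_, ?_, ?_⟩
    · rintro ζ hζ ⟨k, hk⟩
      simp only [endMap] at hk
      by_cases hkj : k = j
      · rw [hkj, left_eq_add] at hk
        exact exp_ne_zero _ hk
      · have h1 := hR.lt_norm_sub k j hkj
        rw [hk, add_sub_cancel_left, norm_exp, neg_re, Real.exp_neg, ← one_div] at h1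
        have h2 := one_div_lt_one_div_of_lt hR0 (hexp ζ hζ)
        have h3 : 2 / R = 1 / R + 1 / R := by ring
        have h4 : 0 < 1 / R := by positivity
        linarith
    · intro ζ
      simp only [endMap, neg_add, exp_add, exp_neg (2 * Real.pi * I), exp_two_pi_mul_I, inv_one,
        mul_one]
    · intro ζ _
      simp only [endMap, (hd ζ).deriv, norm_neg, norm_exp, neg_re]
      exact Real.exp_le_exp.2 (neg_le_neg (le_abs_self _))

/-- The line `Re ζ = x` wraps around the circle of radius `e^x` about `0`, or, reversed, around the
circle of radius `e^{-x}` about a puncture. Orientation does not affect the averages. -/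
theorem endSum_exp_eq_sum (φ : ℂ → ℝ) (x : ℝ) :
    endSum c φ (Real.exp x) = (2 * Real.pi)⁻¹ *
      ∑ o, ∫ y in (0 : ℝ)..2 * Real.pi, φ (endMap c o (x + y * I)) := by
  rw [Fintype.sum_option, endSum, mul_add, Finset.mul_sum]
  congr 1
  · simp only [Real.circleAverage, smul_eq_mul, circleMap, endMap, zero_add, exp_add, ofReal_exp]
  · refine Finset.sum_congr rfl fun j _ => ?_
    have h1 : ∀ y : ℝ, endMap c (some j) (x + y * I) = circleMap (c j) (1 / Real.exp x) (-y) := by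
      intro y
      simp only [endMap, circleMap, neg_add, exp_add, ofReal_inv, ofReal_exp, ofReal_neg,
        exp_neg (x : ℂ), neg_mul, one_div]
    have h2 : Function.Periodic (fun y => φ (circleMap (c j) (1 / Real.exp x) y)) (2 * Real.pi) :=
      fun y => congrArg φ (periodic_circleMap _ _ y)
    have h3 := h2.intervalIntegral_add_eq (-(2 * Real.pi)) 0
    rw [neg_add_cancel, zero_add] at h3
    simp only [h1]
    rw [intervalIntegral.integral_comp_neg fun y => φ (circleMap (c j) (1 / Real.exp x) y),
      neg_zero, h3, Real.circleAverage, smul_eq_mul]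

/-- `φ` is integrable over the curves that `endSum c φ (exp x)` averages over. -/
def EndIntegrable (c : Fin M → ℂ) (φ : ℂ → ℝ) (x : ℝ) : Prop :=
  ∀ o, IntervalIntegrable (fun y : ℝ => φ (endMap c o (x + y * I))) volume 0 (2 * Real.pi)

variable {φ χ : ℂ → ℝ} {x : ℝ}

theorem EndIntegrable.add (h : EndIntegrable c φ x) (h' : EndIntegrable c χ x) :
    EndIntegrable c (fun z => φ z + χ z) x := fun o => (h o).add (h' o)

theorem EndIntegrable.sub (h : EndIntegrable c φ x) (h' : EndIntegrable c χ x) :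
    EndIntegrable c (fun z => φ z - χ z) x := fun o => (h o).sub (h' o)

theorem EndIntegrable.const_mul (h : EndIntegrable c φ x) (k : ℝ) :
    EndIntegrable c (fun z => k * φ z) x := fun o => (h o).const_mul k

theorem EndIntegrable.const (k : ℝ) : EndIntegrable c (fun _ => k) x := fun _ =>
  intervalIntegrable_const

theorem EndIntegrable.sum {κ : Type*} {s : Finset κ} {φ : κ → ℂ → ℝ}
    (h : ∀ i ∈ s, EndIntegrable c (φ i) x) : EndIntegrable c (fun z => ∑ i ∈ s, φ i z) x :=
  fun o => by
    have := IntervalIntegrable.sum s fun i hi => h i hi o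
    simpa only [Finset.sum_fn] using! this

theorem endSum_add (h : EndIntegrable c φ x) (h' : EndIntegrable c χ x) :
    endSum c (fun z => φ z + χ z) (Real.exp x) =
      endSum c φ (Real.exp x) + endSum c χ (Real.exp x) := by
  simp only [endSum_exp_eq_sum]
  rw [← mul_add, ← Finset.sum_add_distrib]
  congr 1
  exact Finset.sum_congr rfl fun o _ => intervalIntegral.integral_add (h o) (h' o)

theorem endSum_const_mul (k : ℝ) :
    endSum c (fun z => k * φ z) (Real.exp x) = k * endSum c φ (Real.exp x) := by
  simp only [endSum_exp_eq_sum, intervalIntegral.integral_const_mul]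
  rw [← Finset.mul_sum]
  ring

theorem endSum_sub (h : EndIntegrable c φ x) (h' : EndIntegrable c χ x) :
    endSum c (fun z => φ z - χ z) (Real.exp x) =
      endSum c φ (Real.exp x) - endSum c χ (Real.exp x) := by
  simp only [endSum_exp_eq_sum]
  rw [← mul_sub, ← Finset.sum_sub_distrib]
  congr 1
  exact Finset.sum_congr rfl fun o _ => intervalIntegral.integral_sub (h o) (h' o)

theorem endSum_sum {κ : Type*} {s : Finset κ} {φ : κ → ℂ → ℝ}
    (h : ∀ i ∈ s, EndIntegrable c (φ i) x) :
    endSum c (fun z => ∑ i ∈ s, φ i z) (Real.exp x) = ∑ i ∈ s, endSum c (φ i) (Real.exp x) := by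
  simp only [endSum_exp_eq_sum]
  rw [← Finset.mul_sum, Finset.sum_comm]
  congr 1
  exact Finset.sum_congr rfl fun o _ => intervalIntegral.integral_finsetSum fun i hi => h i hi o

theorem endSum_const (k : ℝ) (r : ℝ) : endSum c (fun _ => k) r = (M + 1) * k := by
  simp only [endSum, Real.circleAverage_const, Finset.sum_const, Finset.card_univ,
    Fintype.card_fin, nsmul_eq_mul]
  ring

theorem endSum_mono_ae (h : EndIntegrable c φ x) (h' : EndIntegrable c χ x)
    (hle : ∀ o, ∀ᵐ y : ℝ, φ (endMap c o (x + y * I)) ≤ χ (endMap c o (x + y * I))) :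
    endSum c φ (Real.exp x) ≤ endSum c χ (Real.exp x) := by
  simp only [endSum_exp_eq_sum]
  refine mul_le_mul_of_nonneg_left (Finset.sum_le_sum fun o _ => ?_) (by positivity)
  exact intervalIntegral.integral_mono_ae Real.two_pi_pos.le (h o) (h' o) (hle o)

theorem endIntegrable_of_continuousOn (hR : IsSeparatingRadius c R) (hφ : ContinuousOn φ (Omega c))
    (hx : Real.log R < x) : EndIntegrable c φ x := fun o =>
  ((isEndMap_endMap hR o).continuous_comp hφ hx).intervalIntegrable _ _

theorem endIntegrable_log_norm (hR : IsSeparatingRadius c R) {F : ℂ → ℂ}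
    (hF : AnalyticOnNhd ℂ F (Omega c)) (hx : Real.log R < x) :
    EndIntegrable c (fun z => Real.log ‖F z‖) x := fun o =>
  intervalIntegrable_log_norm_line ((isEndMap_endMap hR o).differentiableOn_comp hF) hx _ _

end

namespace HolomorphicCurve

variable {M : ℕ} {c : Fin M → ℂ} {n : ℕ}

theorem LinearlyNondegenerate.exists_pair_ne_zero {f : HolomorphicCurve c n}
    (hf : f.LinearlyNondegenerate) {a : Fin (n + 1) → ℂ} (ha : a ≠ 0) :
    ∃ z ∈ Omega c, f.pair a z ≠ 0 := by
  have := hf a ha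
  simp only [Set.not_subset] at this
  obtain ⟨p, ⟨z, rfl⟩, hp⟩ := this
  exact ⟨z, z.2, fun h => hp ((mk_mem_hyperplane _ _ _).2 h)⟩

theorem continuousOn_log_norm (f : HolomorphicCurve c n) :
    ContinuousOn (fun z => Real.log ‖f.toFun z‖) (Omega c) :=
  (continuousOn_pi.2 fun i => (f.holomorphic i).continuousOn).norm.log fun z hz =>
    norm_ne_zero_iff.2 (f.no_common_zero z hz)

theorem log_norm_pair_le (f : HolomorphicCurve c n) (a : Fin (n + 1) → ℂ) {z : ℂ}
    (hz : z ∈ Omega c) (h0 : f.pair a z ≠ 0) :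
    Real.log ‖f.pair a z‖ ≤ Real.log ‖f.toFun z‖ + ∑ i, ‖a i‖ := by
  have hf := norm_pos_iff.2 (f.no_common_zero z hz)
  have h1 : ‖f.pair a z‖ ≤ (1 + ∑ i, ‖a i‖) * ‖f.toFun z‖ := by
    rw [pair, dotProduct, add_mul, one_mul, Finset.sum_mul]
    refine (norm_sum_le _ _).trans ?_
    refine (Finset.sum_le_sum fun i _ => ?_).trans (le_add_of_nonneg_left (norm_nonneg _))
    rw [norm_mul]
    exact mul_le_mul_of_nonneg_left (norm_le_pi_norm _ i) (norm_nonneg _)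
  have h2 : 0 ≤ ∑ i, ‖a i‖ := Finset.sum_nonneg fun i _ => norm_nonneg _
  have h3 := Real.log_le_log (norm_pos_iff.2 h0) h1
  rw [Real.log_mul (by positivity) hf.ne'] at h3
  have h4 := Real.log_le_sub_one_of_pos (by positivity : 0 < 1 + ∑ i, ‖a i‖)
  linarith

/-- The mean of `log ‖f‖` over an end is bounded by the characteristic function. -/
theorem exists_integral_endMap_le (f : HolomorphicCurve c n) (hf : f.LinearlyNondegenerate)
    {R b : ℝ} (hR : IsSeparatingRadius c R) (hb : Real.log R < b) :
    ∃ C, 0 ≤ C ∧ ∀ x, b ≤ x → ∀ o,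
      ∫ y in (0 : ℝ)..2 * Real.pi, Real.log ‖f.toFun (endMap c o (x + y * I))‖ ≤
        2 * Real.pi * f.T (Real.exp x) + C * (1 + |x|) := by
  -- `f_0` serves as a minorant: `log ‖f‖ ≥ log |f_0| - const` off its zeros, and the integral of
  -- `log |f_0|` falls at most linearly on every end.
  set a : Fin (n + 1) → ℂ := Pi.single 0 1 with ha
  have ha0 : a ≠ 0 := by simp [ha]
  have hF := f.analyticOnNhd_pair a
  have hF0 := hf.exists_pair_ne_zero ha0
  have hlow : ∀ o, ∃ C, 0 ≤ C ∧ ∀ x, b ≤ x →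
      -(C * (1 + |x|)) ≤ ∫ y in (0 : ℝ)..2 * Real.pi,
        Real.log ‖f.toFun (endMap c o (x + y * I))‖ := by
    intro o
    have hE := isEndMap_endMap hR o
    obtain ⟨C, hC, h⟩ := exists_le_integral_log_norm (hE.differentiableOn_comp hF)
      (hE.exists_comp_ne_zero isPreconnected_Omega hF hF0) (hE.periodic_comp _) hb
    refine ⟨C * (1 + |b|) + 2 * Real.pi * ∑ i, ‖a i‖, by positivity, fun x hx => ?_⟩
    have hxR := hb.trans_le hx
    have hi := endIntegrable_of_continuousOn hR f.continuousOn_log_norm hxR o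
    have h1 := intervalIntegral.integral_mono_ae Real.two_pi_pos.le
      (endIntegrable_log_norm hR hF hxR o) (hi.add (intervalIntegrable_const (c := ∑ i, ‖a i‖))) (by
        filter_upwards [hE.ae_comp_ne_zero isPreconnected_Omega hF hF0 hxR] with y hy
        exact f.log_norm_pair_le a (hE.mapsTo (ofReal_add_mul_I_mem_halfPlane.2 hxR)) hy)
    rw [intervalIntegral.integral_add hi intervalIntegrable_const, intervalIntegral.integral_const,
      sub_zero, smul_eq_mul] at h1
    have h2 := h x hx
    have h3 : C * (x - b + 1) ≤ C * ((1 + |b|) * (1 + |x|)) := by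
      refine mul_le_mul_of_nonneg_left ?_ hC
      nlinarith [le_abs_self x, neg_abs_le b, abs_nonneg x, abs_nonneg b,
        mul_nonneg (abs_nonneg x) (abs_nonneg b)]
    have h4 : 0 ≤ 2 * Real.pi * (∑ i, ‖a i‖) * |x| := by positivity
    nlinarith
  choose C hC h using hlow
  refine ⟨∑ o, C o, Finset.sum_nonneg fun o _ => hC o, fun x hx o => ?_⟩
  have hT := f.T_eq_endSum (Real.exp x)
  rw [endSum_exp_eq_sum, eq_inv_mul_iff_mul_eq₀ Real.two_pi_pos.ne'] at hT
  -- `2π T` is the sum over all ends. The ends other than `o` can lower it only by a linear amount,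
  -- so `o` alone is bounded by `2π T` up to that error.
  rw [hT, ← Finset.add_sum_erase _ _ (Finset.mem_univ o), Finset.sum_mul, add_assoc]
  refine le_add_of_nonneg_right ?_
  have h1 := Finset.sum_le_sum_of_subset_of_nonneg (Finset.subset_univ (Finset.univ.erase o))
    fun i _ _ => mul_nonneg (hC i) (by positivity : 0 ≤ 1 + |x|)
  have h2 := Finset.sum_le_sum fun i (_ : i ∈ Finset.univ.erase o) => h i x hx
  rw [Finset.sum_neg_distrib] at h2
  linarith

/-- The lemma on the logarithmic derivative for a pair of hyperplanes. -/
theorem exists_endSum_posLog_derivRatio_le (f : HolomorphicCurve c n)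
    (hf : f.LinearlyNondegenerate) {R b : ℝ} (hR : IsSeparatingRadius c R) (hb : Real.log R < b)
    {a a' : Fin (n + 1) → ℂ} (ha : a ≠ 0) (ha' : a' ≠ 0) (k : ℕ) :
    ∃ C S, 0 ≤ C ∧ ExpNegligible S ∧ ∀ x, b < x → x ∉ S →
      EndIntegrable c (fun z => Real.posLog ‖derivRatio (f.pair a) (f.pair a') k z‖) x ∧
      endSum c (fun z => Real.posLog ‖derivRatio (f.pair a) (f.pair a') k z‖) (Real.exp x) ≤
        C * (1 + |x| + Real.log (1 + max (f.T (Real.exp x)) 0)) := by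
  classical
  obtain ⟨C0, hC0, h0⟩ := f.exists_integral_endMap_le hf hR hb
  set B := (∑ i, ‖a i‖) + ∑ i, ‖a' i‖ with hB
  have hBa : 0 ≤ ∑ i, ‖a i‖ := Finset.sum_nonneg fun i _ => norm_nonneg _
  have hBa' : 0 ≤ ∑ i, ‖a' i‖ := Finset.sum_nonneg fun i _ => norm_nonneg _
  have hone : ∀ o, ∃ C S, 0 ≤ C ∧ ExpNegligible S ∧ ∀ x, b < x → x ∉ S →
      IntervalIntegrable (fun y : ℝ => Real.posLog
        ‖derivRatio (f.pair a) (f.pair a') k (endMap c o (x + y * I))‖) volume 0 (2 * Real.pi) ∧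
      ∫ y in (0 : ℝ)..2 * Real.pi, Real.posLog
        ‖derivRatio (f.pair a) (f.pair a') k (endMap c o (x + y * I))‖ ≤
        C * (1 + |x| + Real.log (1 + max (f.T (Real.exp x)) 0)) := by
    intro o
    have hE := isEndMap_endMap hR o
    obtain ⟨C, S, hC, hS, h⟩ := hE.exists_integral_posLog_derivRatio_le hb isOpen_Omega
      isPreconnected_Omega (f.analyticOnNhd_pair a) (f.analyticOnNhd_pair a')
      (hf.exists_pair_ne_zero ha) (hf.exists_pair_ne_zero ha')
      (ψ := fun z => Real.log ‖f.toFun z‖ + B) (f.continuousOn_log_norm.add continuousOn_const)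
      (fun z hz hz0 => (f.log_norm_pair_le a hz hz0).trans (by simp only [hB]; linarith))
      (fun z hz hz0 => (f.log_norm_pair_le a' hz hz0).trans (by simp only [hB]; linarith)) k
    set C1 := C0 + 2 * Real.pi * B with hC1
    have hB0 : 0 ≤ B := add_nonneg hBa hBa'
    have hC10 : 0 ≤ C1 := by positivity
    -- The `6` is the parameter `k` of `log_one_add_max_le`, which allows the factor `k + 1 = 7 ≥
    -- 2π` in front of `T`.
    set κ := |Real.log ((6 : ℕ) + 2 + C1)| with hκ
    refine ⟨C * (2 + κ), S, by positivity, hS, fun x hx hxS => ?_⟩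
    obtain ⟨h1, h2⟩ := h x hx hxS
    refine ⟨h1, h2.trans ?_⟩
    set t := f.T (Real.exp x)
    have hi := endIntegrable_of_continuousOn hR f.continuousOn_log_norm (hb.trans hx) o
    have hL : 0 ≤ Real.log (1 + max t 0) := Real.log_nonneg (by simp)
    have h3 : ∫ y in (0 : ℝ)..2 * Real.pi, (Real.log ‖f.toFun (endMap c o (x + y * I))‖ + B) ≤
        ((6 : ℕ) + 1) * max t 0 + C1 * (1 + |x| + Real.log (1 + max t 0)) := by
      rw [intervalIntegral.integral_add hi intervalIntegrable_const,
        intervalIntegral.integral_const, sub_zero, smul_eq_mul]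
      have h4 := h0 x hx.le o
      have h5 : 2 * Real.pi * t ≤ 7 * max t 0 :=
        (mul_le_mul_of_nonneg_left (le_max_left t 0) Real.two_pi_pos.le).trans
          (mul_le_mul_of_nonneg_right (by linarith [Real.pi_lt_d2]) (le_max_right _ _))
      have h6 : 0 ≤ 2 * Real.pi * B * |x| := by positivity
      have h7 : 0 ≤ C1 * Real.log (1 + max t 0) := mul_nonneg hC10 hL
      push_cast
      nlinarith
    have h8 := log_one_add_max_le hC10 h3
    have h9 : 0 ≤ κ := abs_nonneg _
    have h10 := le_abs_self (Real.log ((6 : ℕ) + 2 + C1))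
    rw [mul_assoc]
    refine mul_le_mul_of_nonneg_left ?_ hC
    nlinarith [abs_nonneg x, mul_nonneg h9 (abs_nonneg x), mul_nonneg h9 hL]
  choose C S hC hS h using hone
  refine ⟨(2 * Real.pi)⁻¹ * ∑ o, C o, ⋃ o ∈ Finset.univ, S o,
    mul_nonneg (by positivity) (Finset.sum_nonneg fun o _ => hC o),
    ExpNegligible.biUnion _ fun o _ => hS o, fun x hx hxS => ?_⟩
  have hxS' : ∀ o, x ∉ S o := fun o ho => hxS (by simpa using ⟨o, ho⟩)
  refine ⟨fun o => (h o x hx (hxS' o)).1, ?_⟩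
  rw [endSum_exp_eq_sum, mul_assoc, Finset.sum_mul]
  refine mul_le_mul_of_nonneg_left (Finset.sum_le_sum fun o _ => ?_) (by positivity)
  exact (h o x hx (hxS' o)).2

end HolomorphicCurve

/-! ### General position and Cartan's pointwise estimates. -/

theorem exists_injective_subset_range {m q : ℕ} {s : Finset (Fin q)} (hs : s.card ≤ m)
    (hm : m ≤ q) : ∃ σ : Fin m → Fin q, Function.Injective σ ∧ ∀ l ∈ s, ∃ i, σ i = l := by
  obtain ⟨t, hst, -, ht⟩ := Finset.exists_subsuperset_card_eq (Finset.subset_univ s) hs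
    (by simpa using hm)
  refine ⟨t.orderEmbOfFin ht, (t.orderEmbOfFin ht).injective, fun l hl => ?_⟩
  have : l ∈ Set.range (t.orderEmbOfFin ht) := by
    rw [Finset.range_orderEmbOfFin]
    exact hst hl
  exact this

theorem exists_injective_range_subset {m q : ℕ} {s : Finset (Fin q)} (hs : m ≤ s.card) :
    ∃ σ : Fin m → Fin q, Function.Injective σ ∧ ∀ i, σ i ∈ s := by
  obtain ⟨t, hts, ht⟩ := Finset.exists_subset_card_eq hs
  exact ⟨t.orderEmbOfFin ht, (t.orderEmbOfFin ht).injective,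
    fun i => hts (Finset.orderEmbOfFin_mem t ht i)⟩

namespace InGeneralPosition

variable {n q : ℕ} {a : Fin q → Fin (n + 1) → ℂ}

theorem eq_zero_of_dotProduct_eq_zero (h : InGeneralPosition a) {σ : Fin (n + 1) → Fin q}
    (hσ : Function.Injective σ) {v : Fin (n + 1) → ℂ} (hv : ∀ i, a (σ i) ⬝ᵥ v = 0) : v = 0 := by
  by_contra h0
  have : Projectivization.mk ℂ v h0 ∈ ⋂ k, hyperplane (a (σ k)) :=
    mem_iInter.2 fun k => (mk_mem_hyperplane _ _ _).2 (hv k)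
  rw [h σ hσ] at this
  exact this

theorem det_ne_zero (h : InGeneralPosition a) {σ : Fin (n + 1) → Fin q}
    (hσ : Function.Injective σ) : (Matrix.of fun i => a (σ i)).det ≠ 0 := by
  intro h0
  obtain ⟨v, hv, hAv⟩ := Matrix.exists_mulVec_eq_zero_iff.2 h0
  exact hv (h.eq_zero_of_dotProduct_eq_zero hσ fun i => congrFun hAv i)

/-- Any `n + 1` of the coefficient vectors form an invertible matrix, and there are only finitely
many choices, so the norms of the inverses have a common bound. -/
theorem exists_norm_le (h : InGeneralPosition a) :
    ∃ B, 1 ≤ B ∧ ∀ σ : Fin (n + 1) → Fin q, Function.Injective σ → ∀ v : Fin (n + 1) → ℂ,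
      ‖v‖ ≤ B * ‖fun i => a (σ i) ⬝ᵥ v‖ := by
  classical
  set L : (Fin (n + 1) → Fin q) → ((Fin (n + 1) → ℂ) →L[ℂ] (Fin (n + 1) → ℂ)) := fun σ =>
    (Matrix.mulVecLin (Matrix.of fun i => a (σ i))⁻¹).toContinuousLinearMap
  refine ⟨1 + ∑ σ, ‖L σ‖, by
    have := Finset.sum_nonneg fun σ (_ : σ ∈ Finset.univ) => norm_nonneg (L σ)
    linarith, fun σ hσ v => ?_⟩
  have h1 : v = L σ fun i => a (σ i) ⬝ᵥ v := by
    have h2 : (fun i => a (σ i) ⬝ᵥ v) = (Matrix.of fun i => a (σ i)).mulVec v := rfl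
    rw [h2, LinearMap.coe_toContinuousLinearMap', Matrix.mulVecLin_apply, Matrix.mulVec_mulVec,
      Matrix.nonsing_inv_mul _ (h.det_ne_zero hσ).isUnit, Matrix.one_mulVec]
  calc ‖v‖ = ‖L σ fun i => a (σ i) ⬝ᵥ v‖ := by rw [← h1]
    _ ≤ ‖L σ‖ * ‖fun i => a (σ i) ⬝ᵥ v‖ := (L σ).le_opNorm _
    _ ≤ _ := by
      refine mul_le_mul_of_nonneg_right ?_ (norm_nonneg _)
      have := Finset.single_le_sum (f := fun σ => ‖L σ‖) (fun σ _ => norm_nonneg _)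
        (Finset.mem_univ σ)
      linarith

end InGeneralPosition

theorem posLog_norm_det_le {m : ℕ} {L : Matrix (Fin m) (Fin m) ℂ} {Λ : ℝ}
    (h : ∀ k i, Real.posLog ‖L k i‖ ≤ Λ) :
    Real.posLog ‖L.det‖ ≤ Real.log (m.factorial) + m.factorial * (m * Λ) := by
  rw [Matrix.det_apply']
  refine (Real.posLog_norm_sum_le _ _).trans (add_le_add ?_ ?_)
  · rw [Finset.card_univ, Fintype.card_perm, Fintype.card_fin]
  · have h1 : ∀ σ : Equiv.Perm (Fin m),
        Real.posLog ‖((Equiv.Perm.sign σ : ℤ) : ℂ) * ∏ i, L (σ i) i‖ ≤ m * Λ := by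
      intro σ
      have h2 : ‖((Equiv.Perm.sign σ : ℤ) : ℂ)‖ = 1 := by
        rcases Int.units_eq_one_or (Equiv.Perm.sign σ) with h | h <;> simp [h]
      rw [norm_mul, h2, one_mul, norm_prod]
      refine (Real.posLog_prod _ _).trans ((Finset.sum_le_sum fun i _ => h (σ i) i).trans ?_)
      simp
    refine (Finset.sum_le_sum fun σ _ => h1 σ).trans ?_
    rw [Finset.sum_const, Finset.card_univ, Fintype.card_perm, Fintype.card_fin, nsmul_eq_mul]

theorem wronskianDet_congr {m : ℕ} {g g' : Fin m → ℂ → ℂ} {z : ℂ} (h : ∀ i, g i =ᶠ[𝓝 z] g' i) :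
    wronskianDet g z = wronskianDet g' z := by
  simp only [wronskianDet]
  congr 1
  ext k i
  exact (h i).iteratedDeriv_eq k

/-- Divide all functions by `g 0`, then pull `g i / g 0` out of column `i`. The powers of `g 0`
cancel, leaving a matrix of ratios of derivatives to functions. -/
theorem wronskianDet_eq_prod_mul_det {m : ℕ} {g : Fin (m + 1) → ℂ → ℂ} {V : Set ℂ}
    (hV : IsOpen V) (hg : ∀ i, AnalyticOnNhd ℂ (g i) V) {z : ℂ} (hz : z ∈ V)
    (h0 : ∀ i, g i z ≠ 0) :
    wronskianDet g z =
      (∏ i, g i z) * (Matrix.of fun k i : Fin (m + 1) => derivRatio (g i) (g 0) k z).det := by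
  have h1 : wronskianDet g z = wronskianDet (fun i w => g 0 w * (g i w / g 0 w)) z := by
    refine wronskianDet_congr fun i => ?_
    filter_upwards [(hg 0 z hz).continuousAt.eventually_ne (h0 0)] with w hw
    rw [mul_div_cancel₀ _ hw]
  have h2 : wronskianMatrix (fun i w => g i w / g 0 w) z = Matrix.of fun k i =>
      (g i z / g 0 z) * (Matrix.of fun k i : Fin (m + 1) => derivRatio (g i) (g 0) k z) k i := by
    ext k i
    simp only [wronskianMatrix, Matrix.of_apply]
    exact iteratedDeriv_div_eq_mul_derivRatio hV (hg i) (hg 0) k hz (h0 0) (h0 i)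
  rw [h1, wronskianDet_mul (g := fun i w => g i w / g 0 w) (hg 0 z hz)
    fun i => (hg i z hz).div (hg 0 z hz) (h0 0), wronskianDet,
    h2, Matrix.det_mul_row, Finset.prod_div_distrib, Finset.prod_const, Finset.card_univ,
    Fintype.card_fin, ← mul_assoc, mul_div_cancel₀ _ (pow_ne_zero _ (h0 0))]

namespace HolomorphicCurve

variable {M : ℕ} {c : Fin M → ℂ} {n q : ℕ} (f : HolomorphicCurve c n)

/-- The Wronskian of a reduced representation. -/
noncomputable def wronskian : ℂ → ℂ := wronskianDet fun i z => f.toFun z i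

theorem analyticOnNhd_coord (i : Fin (n + 1)) :
    AnalyticOnNhd ℂ (fun z => f.toFun z i) (Omega c) :=
  (f.holomorphic i).analyticOnNhd isOpen_Omega

theorem analyticOnNhd_wronskian : AnalyticOnNhd ℂ f.wronskian (Omega c) := fun z hz =>
  analyticAt_wronskianDet fun i => f.analyticOnNhd_coord i z hz

theorem wronskianDet_pair (b : Fin (n + 1) → Fin (n + 1) → ℂ) {z : ℂ} (hz : z ∈ Omega c) :
    wronskianDet (fun i => f.pair (b i)) z = (Matrix.of b).det * f.wronskian z :=
  wronskianDet_sum_mul b fun i => f.analyticOnNhd_coord i z hz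

variable {f}

/-- A vanishing Wronskian would give a linear relation on a small disc, which the identity theorem
extends to the connected set `Omega c`. -/
theorem LinearlyNondegenerate.exists_wronskian_ne_zero (hf : f.LinearlyNondegenerate) :
    ∃ z ∈ Omega c, f.wronskian z ≠ 0 := by
  by_contra! h
  obtain ⟨z, hz, -⟩ := hf.exists_pair_ne_zero (a := Pi.single 0 1) (by simp)
  obtain ⟨ε, hε, hball⟩ := Metric.isOpen_iff.1 isOpen_Omega z hz
  obtain ⟨b, hb, z', ε', hε', hsub, hsum⟩ := exists_sum_eq_zero_of_wronskianDet_eq_zero hε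
    (fun i => (f.analyticOnNhd_coord i).mono hball) fun w hw => h w (hball hw)
  obtain ⟨w, hw, hw0⟩ := hf.exists_pair_ne_zero hb
  refine hw0 ((f.analyticOnNhd_pair b).eqOn_zero_of_preconnected_of_eventuallyEq_zero
    isPreconnected_Omega (hball (hsub (Metric.mem_ball_self hε'))) ?_ hw)
  filter_upwards [Metric.ball_mem_nhds z' hε'] with y hy using hsum y hy

/-- The pointwise truncation inequality. -/
theorem sum_analyticOrderNatAt_le (hf : f.LinearlyNondegenerate) (hq : n < q)
    {a : Fin q → Fin (n + 1) → ℂ} (ha : ∀ l, a l ≠ 0) (hgp : InGeneralPosition a) {z : ℂ}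
    (hz : z ∈ Omega c) :
    ∑ l, analyticOrderNatAt (f.pair (a l)) z ≤ analyticOrderNatAt f.wronskian z +
      ∑ l, min (analyticOrderNatAt (f.pair (a l)) z) n := by
  classical
  set o : Fin q → ℕ := fun l => analyticOrderNatAt (f.pair (a l)) z with ho
  set s : Finset (Fin q) := Finset.univ.filter fun l => o l ≠ 0 with hs
  -- The pairings with `n + 1` distinct hyperplanes cannot all vanish at `z`. This bound is sharp
  -- only up to one, but it suffices to fit all vanishing indices into one family of `n + 1`.
  have hcard : s.card ≤ n + 1 := by
    by_contra! hlt
    obtain ⟨σ, hσ, hσs⟩ := exists_injective_range_subset hlt.le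
    refine f.no_common_zero z hz (hgp.eq_zero_of_dotProduct_eq_zero hσ fun i => ?_)
    have : f.pair (a (σ i)) z = 0 :=
      apply_eq_zero_of_analyticOrderNatAt_ne_zero (Finset.mem_filter.1 (hσs i)).2
    exact this
  obtain ⟨σ, hσ, hσs⟩ := exists_injective_subset_range hcard hq
  have hne : ∀ l, analyticOrderAt (f.pair (a l)) z ≠ ⊤ := fun l =>
    analyticOrderAt_ne_top_of_exists_ne_zero isPreconnected_Omega (f.analyticOnNhd_pair _)
      (hf.exists_pair_ne_zero (ha l)) hz
  have hW : analyticOrderAt f.wronskian z ≠ ⊤ :=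
    analyticOrderAt_ne_top_of_exists_ne_zero isPreconnected_Omega f.analyticOnNhd_wronskian
      hf.exists_wronskian_ne_zero hz
  have h1 := sum_le_analyticOrderAt_wronskianDet (g := fun i => f.pair (a (σ i))) (z := z)
    (fun i => f.analyticOnNhd_pair _ z hz) fun i => hne _
  have h2 : wronskianDet (fun i => f.pair (a (σ i))) =ᶠ[𝓝 z]
      fun w => (Matrix.of fun i => a (σ i)).det * f.wronskian w := by
    filter_upwards [isOpen_Omega.mem_nhds hz] with w hw using f.wronskianDet_pair _ hw
  have h3 : analyticOrderAt (fun w => (Matrix.of fun i => a (σ i)).det * f.wronskian w) z =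
      analyticOrderAt f.wronskian z := by
    have := analyticOrderAt_mul (f := fun _ => (Matrix.of fun i => a (σ i)).det)
      (analyticAt_const (x := z)) (f.analyticOnNhd_wronskian z hz)
    rw [analyticAt_const.analyticOrderAt_eq_zero.2 (hgp.det_ne_zero hσ), zero_add] at this
    exact this
  rw [analyticOrderAt_congr h2, h3, ← Nat.cast_analyticOrderNatAt hW, Nat.cast_le] at h1
  simp only [Nat.add_sub_cancel] at h1
  have h4 : ∑ i, (o (σ i) - n) = ∑ l, (o l - n) := by
    rw [← Finset.sum_image (f := fun l => o l - n) (s := Finset.univ) (g := σ)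
      fun i _ j _ hij => hσ hij]
    refine Finset.sum_subset (Finset.subset_univ _) fun l _ hl => ?_
    have : o l = 0 := by
      by_contra h0
      obtain ⟨i, hi⟩ := hσs l (Finset.mem_filter.2 ⟨Finset.mem_univ l, h0⟩)
      exact hl (Finset.mem_image.2 ⟨i, Finset.mem_univ i, hi⟩)
    simp [this]
  -- The excess over `n` is paid for by the order of the Wronskian; the rest is the truncated order.
  have h5 : ∑ l, o l = ∑ l, (o l - n) + ∑ l, min (o l) n := by
    rw [← Finset.sum_add_distrib]
    exact Finset.sum_congr rfl fun l _ => by omega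
  change ∑ l, o l ≤ _ + ∑ l, min (o l) n
  rw [h5]
  have h6 : ∑ i, (o (σ i) - n) ≤ analyticOrderNatAt f.wronskian z := h1
  omega

/-- The sum of the `log⁺ |(F_l / F_m)^(k) / (F_l / F_m)|`, `F_l = (a_l, f)`. -/
noncomputable def derivRatioSum (f : HolomorphicCurve c n) (a : Fin q → Fin (n + 1) → ℂ)
    (z : ℂ) : ℝ :=
  ∑ p : Fin (n + 1) × Fin q × Fin q,
    Real.posLog ‖derivRatio (f.pair (a p.2.1)) (f.pair (a p.2.2)) p.1 z‖

theorem posLog_derivRatio_le_derivRatioSum (f : HolomorphicCurve c n)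
    (a : Fin q → Fin (n + 1) → ℂ) (k : Fin (n + 1)) (l m : Fin q) (z : ℂ) :
    Real.posLog ‖derivRatio (f.pair (a l)) (f.pair (a m)) k z‖ ≤ f.derivRatioSum a z := by
  set g : Fin (n + 1) × Fin q × Fin q → ℝ := fun p =>
    Real.posLog ‖derivRatio (f.pair (a p.2.1)) (f.pair (a p.2.2)) p.1 z‖ with hg
  have h0 : ∀ p, 0 ≤ g p := fun p => Real.posLog_nonneg
  have h1 : f.derivRatioSum a z = ∑ p, g p := rfl
  have h2 : Real.posLog ‖derivRatio (f.pair (a l)) (f.pair (a m)) k z‖ = g (k, l, m) := rfl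
  rw [h1, h2]
  exact Finset.single_le_sum (fun p _ => h0 p) (Finset.mem_univ (k, l, m))

/-- Cartan's estimate: the `q - n - 1` hyperplanes far from the point contribute `log ‖f‖` up to a
constant each, and the `n + 1` remaining ones are compared with the Wronskian through the
determinant of logarithmic derivative terms. -/
theorem exists_mul_log_norm_le (f : HolomorphicCurve c n) (hq : n < q)
    {a : Fin q → Fin (n + 1) → ℂ} (hgp : InGeneralPosition a) :
    ∃ C K, 0 ≤ K ∧ ∀ z ∈ Omega c, (∀ l, f.pair (a l) z ≠ 0) → f.wronskian z ≠ 0 →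
      ((q : ℝ) - n - 1) * Real.log ‖f.toFun z‖ ≤ ∑ l, Real.log ‖f.pair (a l) z‖ -
        Real.log ‖f.wronskian z‖ + K * f.derivRatioSum a z + C := by
  classical
  obtain ⟨B, hB1, hB⟩ := hgp.exists_norm_le
  -- The family `σ` of near hyperplanes varies with `z`; summing over all `σ` makes the constant
  -- uniform.
  set D : ℝ := ∑ σ : Fin (n + 1) → Fin q, |Real.log ‖(Matrix.of fun i => a (σ i)).det‖| with hD
  refine ⟨((q : ℝ) - n - 1) * Real.log B + D + Real.log ((n + 1).factorial),
    (n + 1).factorial * ((n + 1 : ℕ) : ℝ), by positivity, fun z hz hF hW => ?_⟩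
  have hf0 := f.no_common_zero z hz
  have hv : 0 < ‖f.toFun z‖ := norm_pos_iff.2 hf0
  have hB0 : 0 < B := by linarith
  set s : Finset (Fin q) := Finset.univ.filter fun l => B * ‖f.pair (a l) z‖ < ‖f.toFun z‖ with hs
  have hcard : s.card ≤ n + 1 := by
    by_contra! hlt
    obtain ⟨σ, hσ, hσs⟩ := exists_injective_range_subset hlt.le
    have h1 : ‖fun i => a (σ i) ⬝ᵥ f.toFun z‖ < ‖f.toFun z‖ / B := by
      refine (pi_norm_lt_iff (by positivity)).2 fun i => ?_
      rw [lt_div_iff₀' hB0]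
      exact (Finset.mem_filter.1 (hσs i)).2
    rw [lt_div_iff₀' hB0] at h1
    exact absurd (hB σ hσ (f.toFun z)) (not_le.2 h1)
  obtain ⟨σ, hσ, hσs⟩ := exists_injective_subset_range hcard hq
  have hfar : ∀ l ∉ Finset.univ.image σ,
      Real.log ‖f.toFun z‖ - Real.log B ≤ Real.log ‖f.pair (a l) z‖ := by
    intro l hl
    have h1 : ‖f.toFun z‖ ≤ B * ‖f.pair (a l) z‖ := by
      by_contra! h
      obtain ⟨i, hi⟩ := hσs l (Finset.mem_filter.2 ⟨Finset.mem_univ l, h⟩)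
      exact hl (Finset.mem_image.2 ⟨i, Finset.mem_univ i, hi⟩)
    have h2 := Real.log_le_log hv h1
    rw [Real.log_mul hB0.ne' (norm_ne_zero_iff.2 (hF l))] at h2
    linarith
  have hcardσ : (Finset.univ.image σ).card = n + 1 := by
    rw [Finset.card_image_of_injective _ hσ, Finset.card_univ, Fintype.card_fin]
  have h1 : ((q : ℝ) - n - 1) * (Real.log ‖f.toFun z‖ - Real.log B) ≤
      ∑ l, Real.log ‖f.pair (a l) z‖ - ∑ i, Real.log ‖f.pair (a (σ i)) z‖ := by
    rw [← Finset.sum_image (f := fun l => Real.log ‖f.pair (a l) z‖) (s := Finset.univ) (g := σ)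
      fun i _ j _ hij => hσ hij, ← Finset.sum_compl_add_sum (Finset.univ.image σ),
      add_sub_cancel_right]
    have h2 := Finset.card_nsmul_le_sum (Finset.univ.image σ)ᶜ
      (fun l => Real.log ‖f.pair (a l) z‖) _ fun l hl => hfar l (Finset.mem_compl.1 hl)
    rw [Finset.card_compl, hcardσ, Fintype.card_fin, nsmul_eq_mul,
      Nat.cast_sub (by omega : n + 1 ≤ q)] at h2
    push_cast at h2
    linarith
  -- The same Wronskian is computed twice, as a constant times `f.wronskian` and as the product of
  -- the pairings times `L.det`.
  have h2 := wronskianDet_eq_prod_mul_det (g := fun i => f.pair (a (σ i))) isOpen_Omega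
    (fun i => f.analyticOnNhd_pair _) hz fun i => hF (σ i)
  rw [f.wronskianDet_pair _ hz] at h2
  set L : Matrix (Fin (n + 1)) (Fin (n + 1)) ℂ := Matrix.of fun k i =>
    derivRatio (f.pair (a (σ i))) (f.pair (a (σ 0))) k z with hL
  have hA0 := hgp.det_ne_zero hσ
  have hprod : ∏ i, f.pair (a (σ i)) z ≠ 0 := Finset.prod_ne_zero_iff.2 fun i _ => hF (σ i)
  have hL0 : L.det ≠ 0 := by
    intro h0
    rw [h0, mul_zero] at h2
    exact mul_ne_zero hA0 hW h2
  have h3 := congrArg (fun w => Real.log ‖w‖) h2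
  simp only [norm_mul] at h3
  rw [Real.log_mul (norm_ne_zero_iff.2 hA0) (norm_ne_zero_iff.2 hW),
    Real.log_mul (norm_ne_zero_iff.2 hprod) (norm_ne_zero_iff.2 hL0), norm_prod,
    Real.log_prod fun i _ => norm_ne_zero_iff.2 (hF (σ i))] at h3
  have h4 : Real.log ‖L.det‖ ≤ Real.posLog ‖L.det‖ := by
    rw [Real.posLog_apply]; exact le_max_right _ _
  have h5 := posLog_norm_det_le (L := L) (Λ := f.derivRatioSum a z) fun k i =>
    f.posLog_derivRatio_le_derivRatioSum a k (σ i) (σ 0) z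
  have h6 : |Real.log ‖(Matrix.of fun i => a (σ i)).det‖| ≤ D := by
    rw [hD]; exact
    Finset.single_le_sum (f := fun σ : Fin (n + 1) → Fin q =>
      |Real.log ‖(Matrix.of fun i => a (σ i)).det‖|) (fun _ _ => abs_nonneg _) (Finset.mem_univ σ)
  have h7 := neg_abs_le (Real.log ‖(Matrix.of fun i => a (σ i)).det‖)
  rw [mul_assoc]
  linarith

end HolomorphicCurve

/-! ### Assembly: growth of `T` and the main inequality. -/

theorem exists_ne_zero_dotProduct_eq_zero {n : ℕ} (hn : 1 ≤ n) (v : Fin (n + 1) → ℂ) :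
    ∃ a : Fin (n + 1) → ℂ, a ≠ 0 ∧ a ⬝ᵥ v = 0 := by
  by_cases h0 : v 0 = 0
  · exact ⟨Pi.single 0 1, by simp, by simp [h0]⟩
  · have h01 : Fin.last n ≠ 0 := by simp [Fin.ext_iff]; omega
    refine ⟨Pi.single (Fin.last n) (v 0) - Pi.single 0 (v (Fin.last n)), fun h => h0 ?_, ?_⟩
    · have := congrFun h (Fin.last n)
      simpa [h01] using this
    · rw [sub_dotProduct, single_dotProduct, single_dotProduct]
      ring

section

variable {M : ℕ} {c : Fin M → ℂ}

theorem exists_finset_zeros {κ : Type*} [Finite κ] {F : κ → ℂ → ℂ}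
    (hF : ∀ i, AnalyticOnNhd ℂ (F i) (Omega c)) (hF0 : ∀ i, ∃ z ∈ Omega c, F i z ≠ 0) {r : ℝ}
    (hr : 0 < r) : ∃ Z : Finset ℂ, (Z : Set ℂ) ⊆ compactPart c r ∧
      ∀ i, ∀ z ∈ compactPart c r, F i z = 0 → z ∈ Z := by
  have hsub := compactPart_subset_compl_range (c := c) hr
  have hfin : (⋃ i, {z ∈ compactPart c r | F i z = 0}).Finite := Set.finite_iUnion fun i =>
    finite_zeros_of_isCompact isCompact_compactPart ((hF i).mono hsub) fun z hz =>
      analyticOrderAt_ne_top_of_exists_ne_zero isPreconnected_Omega (hF i) (hF0 i) (hsub hz)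
  refine ⟨hfin.toFinset, fun z hz => ?_, fun i z hz h0 => ?_⟩
  · rw [Set.Finite.coe_toFinset] at hz
    obtain ⟨i, hi⟩ := mem_iUnion.1 hz
    exact hi.1
  · rw [Set.Finite.mem_toFinset]
    exact mem_iUnion.2 ⟨i, hz, h0⟩

theorem log_sub_log_max_nonneg {R r : ℝ} (hR : 0 < R) (hr : R ≤ r) {z : ℂ}
    (hz : z ∈ compactPart c r) : 0 ≤ Real.log r - Real.log (max R (exhaustionRadius c z)) := by
  have hr0 := hR.trans_le hr
  have h1 := (mem_compactPart_iff hr0 (compactPart_subset_compl_range hr0 hz)).1 hz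
  have := Real.log_le_log (hR.trans_le (le_max_left R (exhaustionRadius c z))) (max_le hr h1)
  linarith

end

namespace HolomorphicCurve

variable {M : ℕ} {c : Fin M → ℂ} {n q : ℕ} {f : HolomorphicCurve c n} {R b : ℝ}

theorem jensen {F : ℂ → ℂ} (hR : IsSeparatingRadius c R) {r : ℝ} (hr : R ≤ r)
    (hF : AnalyticOnNhd ℂ F (Omega c)) (hF0 : ∃ z ∈ Omega c, F z ≠ 0) {Z : Finset ℂ}
    (hZ : (Z : Set ℂ) ⊆ compactPart c r) (hZF : ∀ z ∈ compactPart c r, F z = 0 → z ∈ Z) :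
    endSum c (fun z => Real.log ‖F z‖) r - endSum c (fun z => Real.log ‖F z‖) R =
      ∑ a ∈ Z, (analyticOrderNatAt F a : ℝ) *
        (Real.log r - Real.log (max R (exhaustionRadius c a))) := by
  have hsub := compactPart_subset_compl_range (c := c) (hR.pos.trans_le hr)
  exact endSum_log_norm_sub_endSum hR hr (hF.mono hsub) (fun z hz =>
    analyticOrderAt_ne_top_of_exists_ne_zero isPreconnected_Omega hF hF0 (hsub hz)) hZ hZF

/-- The characteristic function grows at least logarithmically. -/
theorem LinearlyNondegenerate.exists_le_T (hf : f.LinearlyNondegenerate) (hn : 1 ≤ n)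
    (hR : IsSeparatingRadius c R) : ∃ C X, ∀ x, X ≤ x → x - C ≤ f.T (Real.exp x) := by
  obtain ⟨z1, hz1, -⟩ := hf.exists_pair_ne_zero (a := Pi.single 0 1) (by simp)
  -- As `n ≥ 1`, some hyperplane passes through the image of `z1`. The zero it produces already
  -- forces logarithmic growth in Jensen's formula.
  obtain ⟨a, ha, haz⟩ := exists_ne_zero_dotProduct_eq_zero hn (f.toFun z1)
  have hF := f.analyticOnNhd_pair a
  have hF0 := hf.exists_pair_ne_zero ha
  set F := f.pair a with hFdef
  set τ := max R (exhaustionRadius c z1) with hτ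
  have hτ0 : 0 < τ := hR.pos.trans_le (le_max_left _ _)
  set B := ∑ i, ‖a i‖ with hB
  refine ⟨Real.log τ + (M + 1) * B - endSum c (fun z => Real.log ‖F z‖) R, Real.log τ + 1,
    fun x hx => ?_⟩
  have hτx : τ ≤ Real.exp x := by
    rw [← Real.log_le_iff_le_exp hτ0]; linarith
  have hRx : R ≤ Real.exp x := (le_max_left _ _).trans hτx
  have hlogR : Real.log R < x := by
    have := Real.log_le_log hR.pos (le_max_left R (exhaustionRadius c z1))
    linarith
  have hr0 := Real.exp_pos x
  obtain ⟨Z, hZ, hZF⟩ := exists_finset_zeros (F := fun _ : Unit => F) (fun _ => hF) (fun _ => hF0)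
    hr0
  have hJ := jensen hR hRx hF hF0 hZ (hZF ())
  have hz1mem : z1 ∈ compactPart c (Real.exp x) :=
    (mem_compactPart_iff hr0 hz1).2 ((le_max_right _ _).trans hτx)
  have hord : (1 : ℝ) ≤ analyticOrderNatAt F z1 := by
    have h1 := analyticOrderAt_ne_top_of_exists_ne_zero isPreconnected_Omega hF hF0 hz1
    have h2 : analyticOrderAt F z1 ≠ 0 := by
      rw [(hF z1 hz1).analyticOrderAt_ne_zero]; exact haz
    rw [← Nat.cast_analyticOrderNatAt h1] at h2
    exact_mod_cast Nat.one_le_iff_ne_zero.2 fun h => h2 (by rw [h]; rfl)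
  have hterm := Finset.single_le_sum (f := fun z => (analyticOrderNatAt F z : ℝ) *
    (Real.log (Real.exp x) - Real.log (max R (exhaustionRadius c z))))
    (fun z hz => mul_nonneg (Nat.cast_nonneg _) (log_sub_log_max_nonneg hR.pos hRx (hZ hz)))
    (hZF () z1 hz1mem haz)
  have hterm' := mul_le_mul_of_nonneg_right hord (log_sub_log_max_nonneg hR.pos hRx hz1mem)
  have hφ := endIntegrable_of_continuousOn hR f.continuousOn_log_norm hlogR
  have hle := endSum_mono_ae (endIntegrable_log_norm hR hF hlogR)
    (hφ.add (EndIntegrable.const B)) fun o => by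
      have hE := isEndMap_endMap hR o
      filter_upwards [hE.ae_comp_ne_zero isPreconnected_Omega hF hF0 hlogR] with y hy
      exact f.log_norm_pair_le a (hE.mapsTo (ofReal_add_mul_I_mem_halfPlane.2 hlogR)) hy
  rw [endSum_add hφ (EndIntegrable.const B), endSum_const, ← f.T_eq_endSum] at hle
  rw [Real.log_exp] at *
  linarith

theorem LinearlyNondegenerate.exists_endSum_derivRatioSum_le (hf : f.LinearlyNondegenerate)
    (hR : IsSeparatingRadius c R) (hb : Real.log R < b) {a : Fin q → Fin (n + 1) → ℂ}
    (ha : ∀ l, a l ≠ 0) :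
    ∃ C S, 0 ≤ C ∧ ExpNegligible S ∧ ∀ x, b < x → x ∉ S →
      EndIntegrable c (f.derivRatioSum a) x ∧
      endSum c (f.derivRatioSum a) (Real.exp x) ≤
        C * (1 + |x| + Real.log (1 + max (f.T (Real.exp x)) 0)) := by
  choose C S hC hS h using fun p : Fin (n + 1) × Fin q × Fin q =>
    f.exists_endSum_posLog_derivRatio_le hf hR hb (ha p.2.1) (ha p.2.2) p.1
  refine ⟨∑ p, C p, ⋃ p ∈ Finset.univ, S p, Finset.sum_nonneg fun p _ => hC p,
    ExpNegligible.biUnion _ fun p _ => hS p, fun x hx hxS => ?_⟩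
  have hxS' : ∀ p, x ∉ S p := fun p hp => hxS (mem_biUnion (Finset.mem_univ p) hp)
  have hi := fun p (_ : p ∈ Finset.univ) => (h p x hx (hxS' p)).1
  refine ⟨EndIntegrable.sum hi, ?_⟩
  have := endSum_sum hi
  change endSum c (f.derivRatioSum a) (Real.exp x) = _ at this
  rw [this, Finset.sum_mul]
  exact Finset.sum_le_sum fun p _ => (h p x hx (hxS' p)).2

/-- The second main theorem, before the error term is simplified. -/
theorem LinearlyNondegenerate.exists_mul_T_le (hf : f.LinearlyNondegenerate) (hq : n < q)
    {a : Fin q → Fin (n + 1) → ℂ} (ha : ∀ l, a l ≠ 0) (hgp : InGeneralPosition a)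
    (hR : IsSeparatingRadius c (r0 c)) :
    ∃ A D S, 0 ≤ D ∧ ExpNegligible S ∧ ∀ x, Real.log (r0 c) + 1 < x → x ∉ S →
      ((q : ℝ) - n - 1) * f.T (Real.exp x) ≤ ∑ l, f.N n (Real.exp x) (a l) + A +
        D * (1 + |x| + Real.log (1 + max (f.T (Real.exp x)) 0)) := by
  obtain ⟨CΛ, S, hCΛ, hS, hΛ⟩ := hf.exists_endSum_derivRatioSum_le hR
    (lt_add_one (Real.log (r0 c))) ha
  obtain ⟨C, K, hK, hpt⟩ := f.exists_mul_log_norm_le hq hgp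
  have hF : ∀ l, AnalyticOnNhd ℂ (f.pair (a l)) (Omega c) := fun l => f.analyticOnNhd_pair _
  have hF0 : ∀ l, ∃ z ∈ Omega c, f.pair (a l) z ≠ 0 := fun l => hf.exists_pair_ne_zero (ha l)
  have hW := f.analyticOnNhd_wronskian
  have hW0 := hf.exists_wronskian_ne_zero
  refine ⟨∑ l, endSum c (fun z => Real.log ‖f.pair (a l) z‖) (r0 c) -
    endSum c (fun z => Real.log ‖f.wronskian z‖) (r0 c) + (M + 1) * C, K * CΛ, S,
    mul_nonneg hK hCΛ, hS, fun x hx hxS => ?_⟩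
  obtain ⟨hΛi, hΛle⟩ := hΛ x hx hxS
  have hlogR : Real.log (r0 c) < x := by linarith
  have hRx : r0 c ≤ Real.exp x := ((Real.log_lt_iff_lt_exp hR.pos).1 hlogR).le
  have hr0 := Real.exp_pos x
  have hφ := endIntegrable_of_continuousOn hR f.continuousOn_log_norm hlogR
  have hFi := fun l (_ : l ∈ Finset.univ) => endIntegrable_log_norm hR (hF l) hlogR
  have hWi := endIntegrable_log_norm hR hW hlogR
  have hFs := EndIntegrable.sum hFi
  have hle := endSum_mono_ae (hφ.const_mul ((q : ℝ) - n - 1))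
    (((hFs.sub hWi).add (hΛi.const_mul K)).add (EndIntegrable.const C)) fun o => by
      have hE := isEndMap_endMap hR o
      filter_upwards [ae_all_iff.2 fun l => hE.ae_comp_ne_zero isPreconnected_Omega (hF l) (hF0 l)
        hlogR, hE.ae_comp_ne_zero isPreconnected_Omega hW hW0 hlogR] with y hy hWy
      exact hpt _ (hE.mapsTo (ofReal_add_mul_I_mem_halfPlane.2 hlogR)) hy hWy
  rw [endSum_const_mul, endSum_add ((hFs.sub hWi).add (hΛi.const_mul K)) (EndIntegrable.const C),
    endSum_add (hFs.sub hWi) (hΛi.const_mul K), endSum_sub hFs hWi, endSum_sum hFi,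
    endSum_const_mul, endSum_const, ← f.T_eq_endSum] at hle
  -- One finite set holds the zeros of the Wronskian (`none`) and of all pairings (`some l`), so the
  -- Jensen sums can be compared term by term.
  obtain ⟨Z, hZ, hZF⟩ := exists_finset_zeros
    (F := fun o : Option (Fin q) => o.elim f.wronskian fun l => f.pair (a l))
    (by rintro (_ | l); exacts [hW, hF l]) (by rintro (_ | l); exacts [hW0, hF0 l]) hr0
  have hJF := fun l => jensen hR hRx (hF l) (hF0 l) hZ (hZF (some l))
  have hJW := jensen hR hRx hW hW0 hZ (hZF none)
  have hN := fun l => f.N_eq_sum hR n (a l) hRx hZ (hZF (some l))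
  -- The pointwise truncation inequality is summed against the nonnegative weights `log r - log (max
  -- r0 (exhaustionRadius c z))`.
  have hkey : ∑ l, ∑ z ∈ Z, (analyticOrderNatAt (f.pair (a l)) z : ℝ) *
      (Real.log (Real.exp x) - Real.log (max (r0 c) (exhaustionRadius c z))) ≤
      ∑ z ∈ Z, (analyticOrderNatAt f.wronskian z : ℝ) *
        (Real.log (Real.exp x) - Real.log (max (r0 c) (exhaustionRadius c z))) +
      ∑ l, f.N n (Real.exp x) (a l) := by
    simp only [hN]
    rw [Finset.sum_comm, Finset.sum_comm (s := Finset.univ), ← Finset.sum_add_distrib]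
    refine Finset.sum_le_sum fun z hz => ?_
    rw [← Finset.sum_mul, ← Finset.sum_mul, ← add_mul]
    refine mul_le_mul_of_nonneg_right ?_ (log_sub_log_max_nonneg hR.pos hRx (hZ hz))
    exact_mod_cast sum_analyticOrderNatAt_le hf hq ha hgp
      (compactPart_subset_compl_range hr0 (hZ hz))
  simp only [← hJF, ← hJW, Finset.sum_sub_distrib] at hkey
  have hKΛ := mul_le_mul_of_nonneg_left hΛle hK
  rw [← mul_assoc] at hKΛ
  linarith

end HolomorphicCurve

end PuncturedPlane

end

theorem theorem2 {M : ℕ} (hM : 2 ≤ M) (c : Fin M → ℂ) (hc : Function.Injective c)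
    {n : ℕ} (hn : 1 ≤ n) (f : PuncturedPlane.HolomorphicCurve c n)
    (hf : f.LinearlyNondegenerate)
    {q : ℕ} (hq : n < q) (a : Fin q → Fin (n + 1) → ℂ) (ha : ∀ l, a l ≠ 0)
    (hgp : PuncturedPlane.InGeneralPosition a) :
    ∃ (C : ℝ) (E : Set ℝ), 0 ≤ C ∧ MeasurableSet E ∧ MeasureTheory.volume E < ⊤ ∧
      ∀ r : ℝ, PuncturedPlane.r0 c < r → r ∉ E →
        0 < f.T r ∧
        ((q : ℝ) - n - 1) * f.T r ≤
          ∑ l, f.N n r (a l) + C * (Real.log r + Real.log (f.T r)) := by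
  have hR := PuncturedPlane.isSeparatingRadius_r0 hM hc
  obtain ⟨CT, XT, hT⟩ := hf.exists_le_T hn hR
  obtain ⟨A, D, S, hD, hS, h⟩ := hf.exists_mul_T_le hq ha hgp hR
  -- Beyond `X` one has `T ≥ 1`, `x > 1` and the range of the main estimate. The radii from `r0` to
  -- `e^X` form a bounded interval and go into the exceptional set.
  set X := max (max XT (CT + 1)) (max 1 (Real.log (PuncturedPlane.r0 c) + 1)) with hX
  refine ⟨|A| + 3 * D, Real.exp '' S ∪ Set.Icc (PuncturedPlane.r0 c) (Real.exp X),
    by positivity, hS.volume_image.1.union measurableSet_Icc,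
    (MeasureTheory.measure_union_le _ _).trans_lt
      (ENNReal.add_lt_top.2 ⟨hS.volume_image.2, measure_Icc_lt_top⟩), fun r hr hrE => ?_⟩
  have hr0 : 0 < r := hR.pos.trans hr
  obtain ⟨x, rfl⟩ : ∃ x, Real.exp x = r := ⟨Real.log r, Real.exp_log hr0⟩
  have hxS : x ∉ S := fun hx => hrE (Or.inl ⟨x, hx, rfl⟩)
  have hXx : X < x := by
    by_contra! hle
    exact hrE (Or.inr ⟨hr.le, Real.exp_le_exp.2 hle⟩)
  simp only [hX, max_lt_iff] at hXx
  obtain ⟨⟨h1, h2⟩, h3, h4⟩ := hXx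
  have hTx := hT x h1.le
  have hT1 : 1 ≤ f.T (Real.exp x) := by linarith
  refine ⟨by linarith, (h x h4 hxS).trans ?_⟩
  rw [Real.log_exp, abs_of_pos (by linarith), max_eq_left (by linarith)]
  set t := f.T (Real.exp x)
  have h5 : Real.log (1 + t) ≤ 1 + Real.log t := by
    have h6 := Real.log_le_log (by linarith) (by linarith : 1 + t ≤ 2 * t)
    rw [Real.log_mul two_ne_zero (by linarith)] at h6
    linarith [Real.log_two_lt_d9]
  have h7 : 0 ≤ Real.log t := Real.log_nonneg hT1
  have h8 : A ≤ |A| * (x + Real.log t) := by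
    refine (le_abs_self A).trans (le_mul_of_one_le_right (abs_nonneg A) (by linarith))
  -- From `log (1 + t) ≤ 1 + log t` and `x > 1`: `2 + x + log t ≤ 3 (x + log t)`, which explains `3
  -- * D`.
  have h9 : D * (1 + x + Real.log (1 + t)) ≤ D * (3 * (x + Real.log t)) :=
    mul_le_mul_of_nonneg_left (by linarith) hD
  linarith
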